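/- Let $k$ be an imaginary quadratic field with ring of integers $O_k$, discriminant $\Delta<0$, different $\mathfrak d$ and non-trivial automorphism $\alpha\mapsto\bar\alpha$. Let $B$ be a quaternion algebra over $\mathbb Q$ (definite or indefinite, possibly split), $i:k\to B$ an embedding, and $\delta\in B$ with $\delta^2=\kappa\in\mathbb Q^\times$ and $\delta\, i(\alpha)=i(\bar\alpha)\,\delta$ for $\alpha\in k$, so that $B=k+k\delta$. Let $D$ be the product of the primes that ramify in $B$ and $D_1$ the product of the primes that ramify in both $k$ and $B$. Write $\mathfrak d=\mathfrak d_1\mathfrak d_2$ with integral ideals such that $N(\mathfrak d_1)=D_1$. Let $\mathrm{Max}_B(O_k)$ be the set of maximal orders $O_B$ of $B$ with $i^{-1}(O_B)=O_k$. Call a pair $(\mathfrak a,\lambda)$ *admissible* for $\delta$ if $\mathfrak a$ is a fractional ideal of $k$ with $N(\mathfrak a)=|\kappa|\,|\Delta|/D$, and $\lambda$ is a generator of the $O_k$-module $\mathfrak d_2^{-1}\mathfrak a/\mathfrak a$ with $N(\lambda)\equiv\kappa \bmod N(\mathfrak a)\mathbb Z$. (This condition, and the set below, depend only on the class of $\lambda$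 modulo $\mathfrak a$.) For such a pair put $$O_{\mathfrak a,\lambda,B}=\{\alpha+\beta\delta \mid \alpha\in\mathfrak d_2^{-1},\ \beta\in\mathfrak a^{-1},\ \alpha+\lambda\beta\in O_k\}.$$ (i) For every admissible pair, $O_{\mathfrak a,\lambda,B}$ is an element of $\mathrm{Max}_B(O_k)$. (ii) Every element of $\mathrm{Max}_B(O_k)$ is of the form $O_{\mathfrak a,\lambda,B}$ for some admissible pair $(\mathfrak a,\lambda)$. (iii) The finite idèles $\mathbf b\in\mathbb A_{k,f}^\times$, embedded in $(B\otimes_{\mathbb Q}\mathbb A_{\mathbb Q,f})^\times$ via $i$, act on $\mathrm{Max}_B(O_k)$ by conjugation, $O_B\mapsto \mathbf b O_B\mathbf b^{-1}:=\mathbf b\,\widehat O_B\,\mathbf b^{-1}\cap B$, where $\widehat O_B=O_B\otimes\widehat{\mathbb Z}$, and this action is transitive. Explicitly, for every admissible pair $(\mathfrak a,\lambda)$, $$\mathbf b\,O_{\mathfrak a,\lambda,B}\,\mathbf b^{-1}=O_{\mathfrak a_{\mathbf b},\lambda_{\mathbf b},B},\qquad \mathfrak a_{\mathbf b}=\bar{\mathfrak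 b}\,\mathfrak b^{-1}\mathfrak a,\quad \lambda_{\mathbf b}=\bar{\mathbf b}\,\mathbf b^{-1}\lambda,$$ with $(\mathfrak a_{\mathbf b},\lambda_{\mathbf b})$ again admissible. Here $\mathfrak b$ is the fractional ideal determined by $\mathbf b$, and $\lambda_{\mathbf b}$ is the class in $\mathfrak d_2^{-1}\mathfrak a_{\mathbf b}/\mathfrak a_{\mathbf b}$ of the elements of $k$ congruent to $\bar{\mathbf b}\mathbf b^{-1}\lambda$ modulo $\widehat{\mathfrak a}_{\mathbf b}=\mathfrak a_{\mathbf b}\otimes\widehat{\mathbb Z}$; such elements exist. (Equivalently, $O_B\mapsto\mathbf b^{-1}O_B\mathbf b$ corresponds to $(\mathfrak a,\lambda)\mapsto(\mathfrak b\bar{\mathfrak b}^{-1}\mathfrak a,\ \mathbf b\bar{\mathbf b}^{-1}\lambda)$.) (iv) Let $\beta_0\in k^\times$ and replace $\delta$ by $\delta'=\beta_0\delta$, so that $\delta'\alpha=\bar\alpha\delta'$ and $\delta'^2=\kappa'=N(\beta_0)\kappa$. If $(\mathfrak a,\lambda)$ is admissible for $\delta$, then $(\beta_0\mathfrak a,\beta_0\lambda)$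 is admissible for $\delta'$, and the order $O_{\mathfrak a,\lambda,B}$ formed with $\delta$ equals the order $O_{\beta_0\mathfrak a,\beta_0\lambda,B}$ formed with $\delta'$. -/

import Mathlib

open scoped TensorProduct nonZeroDivisors NumberField
open IsDedekindDomain

noncomputable section

namespace QuatOrder

/-! ### Adelic objects -/

/-- The ring of finite adeles of `ℚ`. -/
abbrev FinAdele : Type := FiniteAdeleRing ℤ ℚ

/-- The ring of integral finite adeles, i.e. the profinite completion of `ℤ`, inside the finite
adeles of `ℚ`: the adeles all of whose components are integral. -/
def zHat : Subring FinAdele where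
  carrier := {x | ∀ v, x v ∈ v.adicCompletionIntegers ℚ}
  mul_mem' hx hy v := mul_mem (hx v) (hy v)
  one_mem' v := one_mem (v.adicCompletionIntegers ℚ)
  add_mem' hx hy v := add_mem (hx v) (hy v)
  zero_mem' v := zero_mem (v.adicCompletionIntegers ℚ)
  neg_mem' hx v := neg_mem (hx v)

/-- For a `ℤ`-submodule `L` of a rational vector space `V`, the image of the completion `L ⊗ Ẑ` in
`V ⊗ 𝔸_f`. -/
def hat {V : Type*} [AddCommGroup V] [Module ℚ V] (L : Submodule ℤ V) :
    Submodule ℤ (V ⊗[ℚ] FinAdele) :=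
  Submodule.span ℤ {t | ∃ x ∈ L, ∃ z ∈ zHat, t = x ⊗ₜ[ℚ] z}

/-- The ring of finite adeles of a number field `k`, in the form `k ⊗_ℚ 𝔸_{ℚ,f}`. -/
abbrev FinAdeleOf (k : Type*) [Field k] [NumberField k] : Type _ := k ⊗[ℚ] FinAdele

lemma int_denominator_adele (a : FinAdele) :
    ∃ m : ℤ, m ≠ 0 ∧ (m : FinAdele) * a ∈ zHat := by
  classical
  choose f hf hfa using fun v : HeightOneSpectrum ℤ =>
    HeightOneSpectrum.adicCompletion.mul_nonZeroDivisor_mem_adicCompletionIntegers v (a v)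
  have hfin : {v : HeightOneSpectrum ℤ | a v ∉ v.adicCompletionIntegers ℚ}.Finite := a.2
  have hcast : ∀ (m : ℤ) (v : HeightOneSpectrum ℤ), ((m : FinAdele) * a) v =
      algebraMap ℤ (v.adicCompletion ℚ) m * a v := by
    intro m v
    let ev : FinAdele →+* v.adicCompletion ℚ :=
      { toFun := fun x => x v
        map_one' := rfl
        map_mul' := fun _ _ => rfl
        map_zero' := rfl
        map_add' := fun _ _ => rfl }
    have h1 : ev (m * a) = ev m * ev a := map_mul ev _ _
    rw [map_intCast ev m] at h1
    rw [eq_intCast (algebraMap ℤ (v.adicCompletion ℚ)) m]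
    exact h1
  refine ⟨∏ v ∈ hfin.toFinset, f v,
    Finset.prod_ne_zero_iff.mpr fun v _ => nonZeroDivisors.ne_zero (hf v), fun v => ?_⟩
  rw [hcast]
  by_cases hv : a v ∈ v.adicCompletionIntegers ℚ
  · exact mul_mem (HeightOneSpectrum.coe_mem_adicCompletionIntegers v _) hv
  · have hv' : v ∈ hfin.toFinset := by simpa using hv
    rw [← Finset.prod_erase_mul _ _ hv', map_mul, mul_assoc]
    refine mul_mem (HeightOneSpectrum.coe_mem_adicCompletionIntegers v _) ?_
    rw [mul_comm]
    exact hfa v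

lemma rat_mem_zHat {q : ℚ} (h : algebraMap ℚ FinAdele q ∈ zHat) : ∃ n : ℤ, (n : ℚ) = q := by
  obtain ⟨n, hn⟩ := HeightOneSpectrum.mem_integers_of_valuation_le_one (R := ℤ) ℚ q (fun v => by
    have := h v
    rw [HeightOneSpectrum.mem_adicCompletionIntegers] at this
    rwa [← HeightOneSpectrum.valuedAdicCompletion_eq_valuation'])
  exact ⟨n, by simpa using hn⟩

section NumberField

variable (k : Type*) [Field k] [NumberField k]

/-- The ring of integers as a `ℤ`-submodule of `k`. -/
def intSubmodule : Submodule ℤ k := (integralClosure ℤ k).toSubmodule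

variable {k}

lemma hat_int_mul {s t : FinAdeleOf k} (hs : s ∈ hat (intSubmodule k))
    (ht : t ∈ hat (intSubmodule k)) : s * t ∈ hat (intSubmodule k) := by
  refine Submodule.span_induction (p := fun s _ => s * t ∈ hat (intSubmodule k)) ?_ ?_ ?_ ?_ hs
  · rintro _ ⟨x, hx, z, hz, rfl⟩
    refine Submodule.span_induction
      (p := fun t _ => x ⊗ₜ[ℚ] z * t ∈ hat (intSubmodule k)) ?_ ?_ ?_ ?_ ht
    · rintro _ ⟨y, hy, w, hw, rfl⟩
      exact Submodule.subset_span ⟨x * y, IsIntegral.mul hx hy, z * w, mul_mem hz hw, by simp⟩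
    · simp
    · intro s t _ _ h1 h2; rw [mul_add]; exact add_mem h1 h2
    · intro n s _ h1; rw [mul_smul_comm]; exact Submodule.smul_mem _ n h1
  · simp
  · intro s t _ _ h1 h2; rw [add_mul]; exact add_mem h1 h2
  · intro n s _ h1; rw [smul_mul_assoc]; exact Submodule.smul_mem _ n h1

lemma int_denominator (t : FinAdeleOf k) :
    ∃ m : ℤ, m ≠ 0 ∧ (m : FinAdeleOf k) * t ∈ hat (intSubmodule k) := by
  induction t using TensorProduct.induction_on with
  | zero => exact ⟨1, one_ne_zero, by simp⟩
  | tmul x a =>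
    obtain ⟨m, hm, hma⟩ := int_denominator_adele a
    have halg : IsAlgebraic ℤ x :=
      (IsFractionRing.isAlgebraic_iff ℤ ℚ k).mpr (Algebra.IsAlgebraic.isAlgebraic x)
    obtain ⟨n, hn, hnx⟩ := halg.exists_integral_multiple
    refine ⟨n * m, mul_ne_zero hn hm, Submodule.subset_span ⟨n • x, hnx, m * a, hma, ?_⟩⟩
    have h1 : ((n * m : ℤ) : FinAdeleOf k) = (n : k) ⊗ₜ[ℚ] (m : FinAdele) := by
      have h2 : (n : FinAdeleOf k) = (n : k) ⊗ₜ[ℚ] (1 : FinAdele) := by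
        rw [← map_intCast (Algebra.TensorProduct.includeLeft : k →ₐ[ℚ] k ⊗[ℚ] FinAdele) n,
          Algebra.TensorProduct.includeLeft_apply]
      have h3 : (m : FinAdeleOf k) = (1 : k) ⊗ₜ[ℚ] (m : FinAdele) := by
        rw [← map_intCast (Algebra.TensorProduct.includeRight : FinAdele →ₐ[ℚ] k ⊗[ℚ] FinAdele) m,
          Algebra.TensorProduct.includeRight_apply]
      rw [Int.cast_mul, h2, h3]; simp
    rw [h1]; simp
  | add s t hs ht =>
    obtain ⟨m, hm, hms⟩ := hs
    obtain ⟨n, hn, hnt⟩ := ht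
    refine ⟨m * n, mul_ne_zero hm hn, ?_⟩
    have h : ((m * n : ℤ) : FinAdeleOf k) * (s + t) = n • ((m : FinAdeleOf k) * s) +
        m • ((n : FinAdeleOf k) * t) := by
      simp only [zsmul_eq_mul]; push_cast; ring
    rw [h]
    exact add_mem (Submodule.smul_mem _ _ hms) (Submodule.smul_mem _ _ hnt)

lemma mem_of_mem_hat_int {x : k} (h : x ⊗ₜ[ℚ] (1 : FinAdele) ∈ hat (intSubmodule k)) :
    IsIntegral ℤ x := by
  let b := NumberField.integralBasis k
  have key : ∀ i, ∃ n : ℤ, (n : ℚ) = b.repr x i := by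
    intro i
    let φ : FinAdeleOf k →ₗ[ℚ] FinAdele :=
      (TensorProduct.lid ℚ FinAdele).toLinearMap ∘ₗ LinearMap.rTensor FinAdele (b.coord i)
    have hφ : ∀ t ∈ hat (intSubmodule k), φ t ∈ zHat := by
      intro t ht
      refine Submodule.span_induction ?_ ?_ ?_ ?_ ht
      · rintro _ ⟨y, hy, z, hz, rfl⟩
        have : φ (y ⊗ₜ[ℚ] z) = b.repr y i • z := by simp [φ]
        rw [this]
        have hrep := NumberField.integralBasis_repr_apply k ⟨y, hy⟩ i
        have hrep' : b.repr y i = (((NumberField.RingOfIntegers.basis k).repr ⟨y, hy⟩ i : ℤ) : ℚ) :=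
          hrep
        rw [hrep', Int.cast_smul_eq_zsmul]
        exact zsmul_mem hz _
      · simp
      · intro s t _ _ hs ht; rw [map_add]; exact add_mem hs ht
      · intro n s _ hs; rw [map_zsmul]; exact zsmul_mem hs _
    have h2 := hφ _ h
    have h3 : φ (x ⊗ₜ[ℚ] (1 : FinAdele)) = algebraMap ℚ FinAdele (b.repr x i) := by
      simp [φ, Algebra.algebraMap_eq_smul_one]
    rw [h3] at h2
    exact rat_mem_zHat h2
  rw [← b.sum_repr x]
  refine IsIntegral.sum _ fun i _ => ?_
  obtain ⟨n, hn⟩ := key i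
  rw [← hn, Int.cast_smul_eq_zsmul]
  refine IsIntegral.zsmul ?_ n
  rw [NumberField.integralBasis_apply]
  exact NumberField.RingOfIntegers.isIntegral_coe _

/-- The fractional ideal determined by a finite idele `b` of `k`, namely `k ∩ b Ô_k`. -/
def ideleIdeal (b : (FinAdeleOf k)ˣ) : FractionalIdeal (𝓞 k)⁰ k :=
  ⟨{ carrier := {x | (↑b⁻¹ : FinAdeleOf k) * (x ⊗ₜ[ℚ] (1 : FinAdele)) ∈ hat (intSubmodule k)}
     add_mem' := by
      intro x y hx hy
      simp only [Set.mem_ofPred_eq, TensorProduct.add_tmul, mul_add] at hx hy ⊢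
      exact add_mem hx hy
     zero_mem' := by simp
     smul_mem' := by
      intro r x hx
      have hr : (r : k) ⊗ₜ[ℚ] (1 : FinAdele) ∈ hat (intSubmodule k) :=
        Submodule.subset_span ⟨r, r.2, 1, one_mem _, rfl⟩
      have h := hat_int_mul hr hx
      have he : (r • x) ⊗ₜ[ℚ] (1 : FinAdele) =
          ((r : k) ⊗ₜ[ℚ] (1 : FinAdele)) * (x ⊗ₜ[ℚ] (1 : FinAdele)) := by
        simp [Algebra.smul_def]
      simp only [Set.mem_ofPred_eq]
      rw [he, mul_left_comm]
      exact h }, by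
    obtain ⟨m, hm, hmb⟩ := int_denominator (b : FinAdeleOf k)
    refine ⟨(m : 𝓞 k), mem_nonZeroDivisors_of_ne_zero (by exact_mod_cast hm), fun x hx => ?_⟩
    have h := hat_int_mul hmb hx
    rw [mul_assoc, Units.mul_inv_cancel_left] at h
    have he : (m : FinAdeleOf k) * (x ⊗ₜ[ℚ] (1 : FinAdele)) =
        ((m : k) * x) ⊗ₜ[ℚ] (1 : FinAdele) := by
      rw [← map_intCast (Algebra.TensorProduct.includeLeft : k →ₐ[ℚ] k ⊗[ℚ] FinAdele) m,
        Algebra.TensorProduct.includeLeft_apply, Algebra.TensorProduct.tmul_mul_tmul, mul_one]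
    rw [he] at h
    refine ⟨⟨(m : k) * x, mem_of_mem_hat_int h⟩, ?_⟩
    rw [Algebra.smul_def, map_intCast]
    rfl⟩

/-- The image `{σ x | x ∈ I}` of a fractional ideal under an automorphism `σ` of `k`. -/
def conjIdeal (σ : k ≃ₐ[ℚ] k) (I : FractionalIdeal (𝓞 k)⁰ k) : FractionalIdeal (𝓞 k)⁰ k :=
  ⟨{ carrier := σ '' (I : Set k)
     add_mem' := by
      rintro _ _ ⟨x, hx, rfl⟩ ⟨y, hy, rfl⟩
      exact ⟨x + y, add_mem (S := Submodule (𝓞 k) k) hx hy, map_add σ x y⟩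
     zero_mem' := ⟨0, zero_mem (I : Submodule (𝓞 k) k), map_zero σ⟩
     smul_mem' := by
      rintro r _ ⟨x, hx, rfl⟩
      refine ⟨(⟨σ.symm r, r.2.map (σ.symm.toAlgHom.restrictScalars ℤ)⟩ : 𝓞 k) • x,
        Submodule.smul_mem (I : Submodule (𝓞 k) k) _ hx, ?_⟩
      simp [Algebra.smul_def] }, by
    obtain ⟨a, ha, hI⟩ := I.2
    refine ⟨⟨σ a, a.2.map (σ.toAlgHom.restrictScalars ℤ)⟩, mem_nonZeroDivisors_of_ne_zero ?_, ?_⟩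
    · intro h
      have h0 : σ (a : k) = 0 := congrArg (algebraMap (𝓞 k) k) h
      exact nonZeroDivisors.ne_zero ha (by simpa using h0)
    · rintro _ ⟨x, hx, rfl⟩
      obtain ⟨c, hc⟩ := hI x hx
      refine ⟨⟨σ c, c.2.map (σ.toAlgHom.restrictScalars ℤ)⟩, ?_⟩
      have := congrArg σ hc
      rw [Algebra.smul_def, map_mul] at this
      exact this⟩

/-- The action of an automorphism `σ` of `k` on the finite ideles of `k`. -/
def conjIdele (σ : k ≃ₐ[ℚ] k) : (FinAdeleOf k)ˣ →* (FinAdeleOf k)ˣ :=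
  Units.map
    (Algebra.TensorProduct.map (σ : k →ₐ[ℚ] k) (AlgHom.id ℚ FinAdele) :
      FinAdeleOf k →ₐ[ℚ] FinAdeleOf k)

end NumberField

/-! ### Orders in rational quaternion algebras -/

section Quaternion

variable (B : Type*) [Ring B] [Algebra ℚ B]

/-- `B` is ramified at `p`: `p` is prime and `B ⊗ ℚ_p` is a division ring. -/
def IsRamifiedAt (p : ℕ) : Prop :=
  ∃ hp : p.Prime, haveI : Fact p.Prime := ⟨hp⟩
    ∀ x : B ⊗[ℚ] ℚ_[p], x ≠ 0 → IsUnit x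

/-- The rational prime `p` is ramified in the number field `k`. -/
def IsRamifiedInField (k : Type*) [Field k] [NumberField k] (p : ℕ) : Prop :=
  p.Prime ∧ ∃ P : Ideal (𝓞 k), P.IsPrime ∧ Ideal.span {(p : 𝓞 k)} ≤ P ^ 2

/-- The product of the primes that ramify in `B`. -/
def ramProd : ℕ := ∏ᶠ (p : ℕ) (_ : IsRamifiedAt B p), p

/-- The product of the primes that ramify in both `B` and `k`. -/
def commonRamProd (k : Type*) [Field k] [NumberField k] : ℕ :=
  ∏ᶠ (p : ℕ) (_ : IsRamifiedAt B p ∧ IsRamifiedInField k p), p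

variable {B}

/-- An order of `B`: a subring that is a full `ℤ`-lattice. -/
structure IsOrder (L : Submodule ℤ B) : Prop where
  one_mem : (1 : B) ∈ L
  mul_mem : ∀ x ∈ L, ∀ y ∈ L, x * y ∈ L
  fg : L.FG
  span_eq_top : Submodule.span ℚ (L : Set B) = ⊤

/-- An order that is not strictly contained in another order. -/
def IsMaximalOrder (L : Submodule ℤ B) : Prop :=
  IsOrder L ∧ ∀ L' : Submodule ℤ B, IsOrder L' → L ≤ L' → L' = L

variable {k : Type*} [Field k] [NumberField k]

/-- The set of maximal orders `O` of `B` with `i⁻¹(O) = O_k`. -/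
def MaxOrders (i : k →ₐ[ℚ] B) : Set (Submodule ℤ B) :=
  {L | IsMaximalOrder L ∧ ∀ x : k, i x ∈ L ↔ IsIntegral ℤ x}

/-- Finite ideles of `k` inside the units of `B ⊗ 𝔸_f`, through the embedding `i`. -/
def ideleEmb (i : k →ₐ[ℚ] B) : (FinAdeleOf k)ˣ →* (B ⊗[ℚ] FinAdele)ˣ :=
  Units.map
    (Algebra.TensorProduct.map i (AlgHom.id ℚ FinAdele) : FinAdeleOf k →ₐ[ℚ] B ⊗[ℚ] FinAdele)

/-- `b L̂ b⁻¹ ∩ B` for a finite idele `b` of `k`; here `x ∈ b L̂ b⁻¹` is written as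
`b⁻¹ x b ∈ L̂`. -/
def ideleConj (i : k →ₐ[ℚ] B) (b : (FinAdeleOf k)ˣ) (L : Submodule ℤ B) : Submodule ℤ B where
  carrier := {x | (↑(ideleEmb i b)⁻¹ : B ⊗[ℚ] FinAdele) * (x ⊗ₜ[ℚ] (1 : FinAdele)) *
    (↑(ideleEmb i b) : B ⊗[ℚ] FinAdele) ∈ hat L}
  add_mem' := by
    intro x y hx hy
    simp only [Set.mem_ofPred_eq, TensorProduct.add_tmul, mul_add, add_mul] at hx hy ⊢
    exact add_mem hx hy
  zero_mem' := by simp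
  smul_mem' := by
    intro n x hx
    have h := Submodule.smul_mem (hat L) n hx
    simp only [Set.mem_ofPred_eq] at h ⊢
    rwa [← smul_mul_assoc, ← mul_smul_comm, TensorProduct.smul_tmul'] at h

/-- The conditions on a pair `(𝔞, λ)`; the class of `λ` in `𝔡₂⁻¹𝔞/𝔞` is given by a representative
`lam ∈ k`. -/
structure IsAdmissible (B : Type*) [Ring B] [Algebra ℚ B] (κ : ℚ) (d₂ : Ideal (𝓞 k))
    (a : FractionalIdeal (𝓞 k)⁰ k) (lam : k) : Prop where
  /-- `N(𝔞) = κ|Δ|/D` as fractional ideals of `ℚ` -/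
  norm_ideal : FractionalIdeal.absNorm a = |κ| * |(NumberField.discr k : ℚ)| / (ramProd B : ℚ)
  /-- `λ` lies in `𝔡₂⁻¹𝔞` and generates `𝔡₂⁻¹𝔞/𝔞` -/
  generator : FractionalIdeal.spanSingleton (𝓞 k)⁰ lam ⊔ a =
    (d₂ : FractionalIdeal (𝓞 k)⁰ k)⁻¹ * a
  /-- `N(λ) ≡ κ` modulo `N(𝔞)` -/
  norm_congr : ∃ n : ℤ, Algebra.norm ℚ lam - κ = n * FractionalIdeal.absNorm a

/-- `{α + βδ | α ∈ 𝔡₂⁻¹, β ∈ 𝔞⁻¹, α + λβ ∈ O_k}` -/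
def classicalOrder (i : k →ₐ[ℚ] B) (δ : B) (d₂ : Ideal (𝓞 k))
    (a : FractionalIdeal (𝓞 k)⁰ k) (lam : k) : Submodule ℤ B where
  carrier := {x | ∃ α ∈ (d₂ : FractionalIdeal (𝓞 k)⁰ k)⁻¹, ∃ β ∈ a⁻¹,
    IsIntegral ℤ (α + lam * β) ∧ x = i α + i β * δ}
  add_mem' := by
    rintro _ _ ⟨α, hα, β, hβ, h, rfl⟩ ⟨α', hα', β', hβ', h', rfl⟩
    refine ⟨α + α', Submodule.add_mem _ hα hα', β + β', Submodule.add_mem _ hβ hβ', ?_, ?_⟩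
    · have he : α + α' + lam * (β + β') = α + lam * β + (α' + lam * β') := by ring
      rw [he]
      exact h.add h'
    · simp only [map_add, add_mul]; abel
  zero_mem' := ⟨0, Submodule.zero_mem _, 0, Submodule.zero_mem _, by simpa using isIntegral_zero,
    by simp⟩
  smul_mem' := by
    rintro n _ ⟨α, hα, β, hβ, h, rfl⟩
    refine ⟨n • α, zsmul_mem (S := Submodule (𝓞 k) k) hα n, n • β,
      zsmul_mem (S := Submodule (𝓞 k) k) hβ n, ?_, ?_⟩
    · rw [mul_smul_comm, ← smul_add]
      exact h.zsmul n
    · simp only [map_zsmul, smul_mul_assoc, smul_add]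

/-- The fractional ideal `𝔟̄ 𝔟⁻¹ 𝔞`, with `𝔟` the fractional ideal of the idele `b`. -/
def twistIdeal (σ : k ≃ₐ[ℚ] k) (b : (FinAdeleOf k)ˣ) (a : FractionalIdeal (𝓞 k)⁰ k) :
    FractionalIdeal (𝓞 k)⁰ k :=
  conjIdeal σ (ideleIdeal b) * (ideleIdeal b)⁻¹ * a

/-- `lam' ∈ k` represents the class of `b̄ b⁻¹ lam` modulo the completion of `𝔟̄ 𝔟⁻¹ 𝔞`. -/
def IsTwist (σ : k ≃ₐ[ℚ] k) (b : (FinAdeleOf k)ˣ) (a : FractionalIdeal (𝓞 k)⁰ k)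
    (lam lam' : k) : Prop :=
  lam' ⊗ₜ[ℚ] (1 : FinAdele) -
      (↑(conjIdele σ b * b⁻¹) : FinAdeleOf k) * (lam ⊗ₜ[ℚ] (1 : FinAdele)) ∈
    hat ((twistIdeal σ b a : Submodule (𝓞 k) k).restrictScalars ℤ)

end Quaternion

end QuatOrder

end

open QuatOrder

namespace QuatOrder

/-! ### Quadratic fields -/

/-! Write `O_k = ℤ[ω]` and `s = 2ω - t`, a generator of the different. If `L` is an order with `L ∩
k = O_k`, the coordinate `β` gives an exact sequence of `O_k`-modules `0 → O_k → L → I → 0` with `I`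
a fractional ideal. As `I` is invertible the sequence splits, so `L = {α + βδ | β ∈ I, α + λβ ∈
O_k}` with `λ` determined modulo `𝔞 = I⁻¹`. Such a lattice is a ring exactly when `sλ ∈ 𝔞` and `N(λ)
≡ κ` modulo `N(𝔞)` (`QuatData.exists_pair`, `QuatData.mul_mem_pairOrder`), and enlarging the order
means shrinking `𝔞` (`QuatData.pairOrder_le_iff`).

Maximality is read off from the discriminant `|disc · κ| / N(𝔞)` (`QuadBasis.index`): the order is
maximal if and only if this equals `D`. The question is local, and scaling `δ` makes `𝔞` trivial at
a given `p`. If `p` does not divide the index, the reduced norm on the lattice is a quaternary form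
that is nondegenerate mod `p`; it is isotropic by Chevalley-Warning and Hensel, so `B` splits at
`p`. Thus ramified primes divide every index. Conversely, if `p` divides the index and `B` splits at
`p`, or if `p²` divides it, then `𝔞` can be shrunk by a prime above `p` (`exists_refinement`). The
only obstruction is anisotropy of the norm form, analysed separately for inert `p`, for odd ramified
`p` and for ramified `2`. Once the index is `D`, the ideal `s(λ, 𝔞)𝔞⁻¹` is squarefree with the same
prime divisors as `𝔡₁`, hence equals `𝔡₁`; this is the generator condition (`generator_of_index`).
So admissibility amounts to the ring conditions together with index `D` (`isAdmissible_iff`), which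
gives (i) and (ii).

For (iii), `b⁻¹(α + βδ)b = α + (b̄/b)βδ`, so conjugation by an idele multiplies `𝔞` and `λ` by `c =
b̄/b`, and `c c̄ = 1` preserves all norm conditions (`ideleConj_pairOrder`,
`isPreadmissible_twist`). Strong approximation `𝔸_f = ℚ + Ẑ` supplies a representative of the new
class in `k`. For transitivity, two admissible pairs have ideals of equal norm, and Hilbert 90 gives
a local generator `τ̄/τ` of `𝔞'𝔞⁻¹`. Where `k` is unramified this suffices, since there `λ` lies in
`𝔞`. At a ramified prime a further unit `1`, `-1` or, only for `p = 2`, `ω̄/ω` matches the classes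
(`QuadBasis.exists_ratio`). Almost all `τ` can be taken to be `1`, so they glue to an idele
(`exists_twist_eq`). -/

/-- A generator `ω` of the ring of integers of a quadratic field with `ω² = tω - n`. -/
structure QuadBasis {k : Type*} [Field k] [NumberField k] (σ : k ≃ₐ[ℚ] k) where
  ω : k
  t : ℤ
  n : ℤ
  sq : ω ^ 2 = t * ω - n
  conj : σ ω = t - ω
  isIntegral_iff : ∀ x : k, IsIntegral ℤ x ↔ ∃ u v : ℤ, x = u + v * ω
  exists_repr : ∀ x : k, ∃ u v : ℚ, x = u + v * ω
  indep : ∀ u v : ℚ, (u : k) + v * ω = 0 → u = 0 ∧ v = 0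

variable {k : Type*} [Field k] [NumberField k] {σ : k ≃ₐ[ℚ] k}

/-- The vector `1` is primitive in the lattice `O_k`: an integer `g` dividing it has `g²` a unit, by
taking norms. Hence `1` extends to a `ℤ`-basis `1, ω`. As `σ` moves `ω`, it sends it to the other
root of its quadratic equation. -/
theorem exists_quadBasis (hk : Module.finrank ℚ k = 2) (hσ : σ ≠ AlgEquiv.refl) :
    Nonempty (QuadBasis σ) := by
  have hrank : Module.finrank ℤ (𝓞 k) = 2 := by rw [NumberField.RingOfIntegers.rank, hk]
  let e := Module.finBasisOfFinrankEq ℤ (𝓞 k) hrank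
  obtain ⟨a, b, hab⟩ : ∃ a b : ℤ, (1 : 𝓞 k) = a • e 0 + b • e 1 :=
    ⟨e.repr 1 0, e.repr 1 1, by rw [← Fin.sum_univ_two (fun i => e.repr 1 i • e i), e.sum_repr]⟩
  have hcop : IsCoprime a b := by
    rw [Int.isCoprime_iff_gcd_eq_one]
    set g : ℕ := Int.gcd a b with hg
    obtain ⟨a', ha'⟩ : (g : ℤ) ∣ a := Int.gcd_dvd_left ..
    obtain ⟨b', hb'⟩ : (g : ℤ) ∣ b := Int.gcd_dvd_right ..
    have h1 : (1 : 𝓞 k) = (g : ℤ) • (a' • e 0 + b' • e 1) := by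
      rw [hab, ha', hb', mul_smul, mul_smul, smul_add]
    have h2 := congrArg (Algebra.norm ℤ) h1
    have h3 : IsUnit ((g : ℤ) ^ 2) := by
      rw [Algebra.smul_def, map_mul, Algebra.norm_algebraMap, map_one, hrank] at h2
      exact IsUnit.of_mul_eq_one _ h2.symm
    have h4 := (isUnit_pow_iff two_ne_zero).mp h3
    have := Int.isUnit_iff.mp h4
    omega
  obtain ⟨x, y, hxy⟩ := hcop
  -- The matrix with rows `(a, b)` and `(-y, x)` has determinant `xa + yb = 1`, so `1` and `w` form
  -- a basis.
  let w : 𝓞 k := -y • e 0 + x • e 1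
  have hspan : ∀ z : 𝓞 k, ∃ u v : ℤ, (z : k) = u + v * (w : k) := by
    intro z
    have hz : z = e.repr z 0 • e 0 + e.repr z 1 • e 1 := by
      rw [← Fin.sum_univ_two (fun i => e.repr z i • e i), e.sum_repr]
    set c := e.repr z 0
    set d := e.repr z 1
    refine ⟨c * x + d * y, -b * c + a * d, ?_⟩
    have : z = ((c * x + d * y : ℤ) : 𝓞 k) + ((-b * c + a * d : ℤ) : 𝓞 k) * w := by
      simp only [w]
      simp only [zsmul_eq_mul] at hz hab ⊢
      have hxy' : (x : 𝓞 k) * a + y * b = 1 := by exact_mod_cast hxy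
      push_cast
      linear_combination hz - (c * e 0 + d * e 1) * hxy' - (c * x + d * y) * hab
    have h := congrArg (algebraMap (𝓞 k) k) this
    simpa using h
  have hrepr : ∀ z : k, ∃ u v : ℚ, z = u + v * (w : k) := by
    intro z
    have halg : IsAlgebraic ℤ z :=
      (IsFractionRing.isAlgebraic_iff ℤ ℚ k).mpr (Algebra.IsAlgebraic.isAlgebraic z)
    obtain ⟨m, hm, hmz⟩ := halg.exists_integral_multiple
    obtain ⟨u, v, huv⟩ := hspan ⟨m • z, hmz⟩
    refine ⟨u / m, v / m, ?_⟩
    have hm' : (m : k) ≠ 0 := by exact_mod_cast hm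
    have huv' : (m : k) * z = u + v * (w : k) := by simpa [zsmul_eq_mul] using huv
    push_cast
    field_simp
    linear_combination huv'
  have hwq : ∀ q : ℚ, (w : k) ≠ (q : k) := by
    intro q hq
    apply hσ
    ext z
    obtain ⟨u, v, huv⟩ := hrepr z
    rw [huv, hq]
    simp
  have hindep : ∀ u v : ℚ, (u : k) + v * (w : k) = 0 → u = 0 ∧ v = 0 := by
    intro u v h
    have hv : v = 0 := by
      by_contra hv
      apply hwq (-u / v)
      have : (v : k) ≠ 0 := by exact_mod_cast hv
      push_cast
      field_simp
      linear_combination h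
    subst hv
    refine ⟨?_, rfl⟩
    simpa using h
  obtain ⟨n, t, hnt⟩ := hspan (w ^ 2)
  have hsq : (w : k) ^ 2 = t * (w : k) + n := by
    have : (w : k) ^ 2 = n + t * (w : k) := by simpa using hnt
    rw [this, add_comm]
  have hσw : σ (w : k) ≠ w := by
    intro h
    apply hσ
    ext z
    obtain ⟨u, v, huv⟩ := hrepr z
    rw [huv]
    simp [h]
  refine ⟨⟨w, t, -n, by rw [hsq]; push_cast; ring, ?_, ?_, hrepr, hindep⟩⟩
  · have h1 := congrArg σ hsq
    simp only [map_pow, map_add, map_mul, map_intCast] at h1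
    have h2 : (σ (w : k) - w) * (σ (w : k) + w - t) = 0 := by linear_combination h1 - hsq
    rcases mul_eq_zero.mp h2 with h | h
    · exact absurd (sub_eq_zero.mp h) hσw
    · linear_combination h
  · intro z
    refine ⟨fun h => hspan ⟨z, h⟩, ?_⟩
    rintro ⟨u, v, rfl⟩
    exact (isIntegral_algebraMap (x := u)).add ((isIntegral_algebraMap (x := v)).mul w.2)

namespace QuadBasis

/-- The square root `2ω - t` of the discriminant. -/
def s (q : QuadBasis σ) : k := 2 * q.ω - q.t

/-- The discriminant `t² - 4n`. -/
def disc (q : QuadBasis σ) : ℤ := q.t ^ 2 - 4 * q.n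

variable (q : QuadBasis σ)

lemma isIntegral_ω : IsIntegral ℤ q.ω := (q.isIntegral_iff _).mpr ⟨0, 1, by simp⟩

lemma isIntegral_s : IsIntegral ℤ q.s := (q.isIntegral_iff _).mpr ⟨-q.t, 2, by simp [s]; ring⟩

lemma s_sq : q.s ^ 2 = q.disc := by
  simp only [s, disc]; push_cast; linear_combination 4 * q.sq

lemma conj_s : σ q.s = -q.s := by
  simp only [s, map_sub, map_mul, map_ofNat, q.conj, map_intCast]; ring

lemma s_ne_zero : q.s ≠ 0 := by
  intro h
  have := q.indep (-q.t) 2 (by push_cast; simpa [s, add_comm, sub_eq_add_neg] using h)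
  exact two_ne_zero this.2

lemma disc_ne_zero : q.disc ≠ 0 := by
  intro h
  have := q.s_sq
  rw [h] at this
  exact q.s_ne_zero (by simpa using this)

lemma conj_conj (q : QuadBasis σ) (x : k) : σ (σ x) = x := by
  obtain ⟨u, v, rfl⟩ := q.exists_repr x
  simp [q.conj]

lemma repr_unique {u v u' v' : ℚ} (h : (u : k) + v * q.ω = u' + v' * q.ω) : u = u' ∧ v = v' := by
  have := q.indep (u - u') (v - v') (by push_cast; linear_combination h)
  exact ⟨sub_eq_zero.mp this.1, sub_eq_zero.mp this.2⟩

lemma repr_unique_int {u v u' v' : ℤ} (h : (u : k) + v * q.ω = u' + v' * q.ω) :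
    u = u' ∧ v = v' := by
  have := q.repr_unique (u := u) (v := v) (u' := u') (v' := v') (by push_cast; exact h)
  exact_mod_cast this

/-- The `ℚ`-basis `1, ω` of `k`. -/
noncomputable def basis : Module.Basis (Fin 2) ℚ k :=
  Module.Basis.mk (v := ![1, q.ω])
    (by
      rw [LinearIndependent.pair_iff]
      intro u v h
      exact q.indep u v (by simpa [Algebra.smul_def] using h))
    (by
      rintro x -
      obtain ⟨u, v, rfl⟩ := q.exists_repr x
      rw [Matrix.range_cons, Matrix.range_cons, Matrix.range_empty, Set.union_empty]
      refine Submodule.mem_span_pair.mpr ⟨u, v, by simp [Algebra.smul_def]⟩)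

lemma norm_repr (u v : ℚ) :
    Algebra.norm ℚ ((u : k) + v * q.ω) = u ^ 2 + q.t * u * v + q.n * v ^ 2 := by
  have h0 : q.basis 0 = 1 := by simp [basis]
  have h1 : q.basis 1 = q.ω := by simp [basis]
  have hc0 : ∀ a b : ℚ, q.basis.repr ((a : k) + b * q.ω) 0 = a := by
    intro a b
    have : (a : k) + b * q.ω = a • q.basis 0 + b • q.basis 1 := by
      rw [h0, h1]; simp [Algebra.smul_def]
    rw [this]; simp
  have hc1 : ∀ a b : ℚ, q.basis.repr ((a : k) + b * q.ω) 1 = b := by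
    intro a b
    have : (a : k) + b * q.ω = a • q.basis 0 + b • q.basis 1 := by
      rw [h0, h1]; simp [Algebra.smul_def]
    rw [this]; simp
  have e2 : ((u : k) + v * q.ω) * q.ω = ((-(q.n * v) : ℚ) : k) + ((u + q.t * v : ℚ) : k) * q.ω := by
    push_cast; linear_combination v * q.sq
  rw [Algebra.norm_eq_matrix_det q.basis, Matrix.det_fin_two]
  simp only [Algebra.leftMulMatrix_eq_repr_mul, h0, h1, mul_one, e2, hc0, hc1]
  ring

lemma norm_eq (q : QuadBasis σ) (x : k) : ((Algebra.norm ℚ x : ℚ) : k) = x * σ x := by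
  obtain ⟨u, v, rfl⟩ := q.exists_repr x
  rw [q.norm_repr]
  simp only [map_add, map_mul, map_ratCast, q.conj]
  push_cast
  linear_combination v ^ 2 * q.sq

lemma norm_conj (q : QuadBasis σ) (x : k) : Algebra.norm ℚ (σ x) = Algebra.norm ℚ x := by
  have : ((Algebra.norm ℚ (σ x) : ℚ) : k) = (Algebra.norm ℚ x : ℚ) := by
    rw [q.norm_eq, q.norm_eq, q.conj_conj, mul_comm]
  exact_mod_cast this

lemma norm_s : Algebra.norm ℚ q.s = -q.disc := by
  have : ((Algebra.norm ℚ q.s : ℚ) : k) = ((-q.disc : ℚ) : k) := by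
    rw [q.norm_eq, q.conj_s]; push_cast; linear_combination -q.s_sq
  exact_mod_cast this

lemma norm_rat (q : QuadBasis σ) (r : ℚ) : Algebra.norm ℚ (r : k) = r ^ 2 := by
  have := q.norm_repr r 0
  simpa using this

/-- `ω` as an element of the ring of integers. -/
noncomputable def ωInt : 𝓞 k := ⟨q.ω, q.isIntegral_ω⟩

/-- `2ω - t` as an element of the ring of integers. -/
noncomputable def sInt : 𝓞 k := ⟨q.s, q.isIntegral_s⟩

@[simp] lemma coe_ωInt : (q.ωInt : k) = q.ω := rfl
@[simp] lemma coe_sInt : (q.sInt : k) = q.s := rfl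

lemma exists_int_repr (x : 𝓞 k) : ∃ u v : ℤ, x = u + v * q.ωInt := by
  obtain ⟨u, v, h⟩ := (q.isIntegral_iff x).mp x.2
  refine ⟨u, v, NumberField.RingOfIntegers.ext ?_⟩
  simpa using h

-- Since `O_k = ℤ[ω]` is monogenic, the different is generated by the derivative of `X² - tX + n` at
-- `ω`.
open Polynomial in
lemma differentIdeal_eq : differentIdeal ℤ (𝓞 k) = Ideal.span {q.sInt} := by
  have hadj : Algebra.adjoin ℤ {q.ωInt} = ⊤ := by
    rw [eq_top_iff]
    rintro x -
    obtain ⟨u, v, rfl⟩ := q.exists_int_repr x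
    exact add_mem (intCast_mem _ _) (mul_mem (intCast_mem _ _)
      (Algebra.subset_adjoin (Set.mem_singleton _)))
  have hadjK : Algebra.adjoin ℚ {algebraMap (𝓞 k) k q.ωInt} = ⊤ := by
    rw [eq_top_iff]
    rintro x -
    obtain ⟨u, v, rfl⟩ := q.exists_repr x
    refine add_mem ?_ (mul_mem ?_ (Algebra.subset_adjoin (Set.mem_singleton _)))
    · exact (Algebra.adjoin ℚ _).algebraMap_mem u
    · exact (Algebra.adjoin ℚ _).algebraMap_mem v
  have h := conductor_mul_differentIdeal ℤ ℚ k q.ωInt hadjK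
  rw [conductor_eq_top_of_adjoin_eq_top hadj, ← Ideal.one_eq_top, one_mul] at h
  rw [h]
  have hmin : minpoly ℤ q.ωInt = X ^ 2 - C q.t * X + C q.n := by
    have hP : (X ^ 2 - C q.t * X + C q.n : ℤ[X]).Monic := by monicity!
    have hdeg : (X ^ 2 - C q.t * X + C q.n : ℤ[X]).degree = 2 := by compute_degree!
    symm
    refine minpoly.unique' ℤ q.ωInt hP ?_ ?_
    · have : ((q.ωInt ^ 2 - q.t * q.ωInt + q.n : 𝓞 k) : k) = 0 := by
        simp [q.sq]
      have h2 : (q.ωInt ^ 2 - q.t * q.ωInt + q.n : 𝓞 k) = 0 :=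
        NumberField.RingOfIntegers.ext (by simpa using this)
      simpa using h2
    · intro Q hQ
      rw [hdeg] at hQ
      by_cases h0 : Q = 0
      · exact Or.inl h0
      right
      intro hev
      have hd1 : Q.natDegree ≤ 1 := by
        have := (natDegree_lt_iff_degree_lt h0 (n := 2)).mpr (by exact_mod_cast hQ)
        omega
      rw [eq_X_add_C_of_natDegree_le_one hd1] at hev
      have hev' := congrArg (algebraMap (𝓞 k) k) hev
      simp only [map_add, map_mul, aeval_C, aeval_X] at hev'
      have := q.indep (Q.coeff 0) (Q.coeff 1) (by
        push_cast
        simpa [add_comm] using hev')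
      apply h0
      rw [eq_X_add_C_of_natDegree_le_one hd1]
      have h1 : Q.coeff 0 = 0 := by exact_mod_cast this.1
      have h2 : Q.coeff 1 = 0 := by exact_mod_cast this.2
      simp [h1, h2]
  rw [hmin]
  congr 2
  apply NumberField.RingOfIntegers.ext
  simp only [derivative_X_pow, derivative_mul, derivative_C,
    derivative_X, map_sub, map_add, map_mul, aeval_C, aeval_X]
  simp [s]
  exact Or.inl (map_ofNat _ 2)

lemma natAbs_discr (q : QuadBasis σ) : (NumberField.discr k).natAbs = q.disc.natAbs := by
  rw [← NumberField.absNorm_differentIdeal k (𝓞 k), q.differentIdeal_eq,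
    Ideal.absNorm_span_singleton]
  have h : ((Algebra.norm ℤ q.sInt : ℤ) : ℚ) = ((-q.disc : ℤ) : ℚ) := by
    have h1 := Algebra.coe_norm_int q.sInt
    rw [h1, q.coe_sInt, q.norm_s]
    push_cast
    rfl
  have h2 : Algebra.norm ℤ q.sInt = -q.disc := by exact_mod_cast h
  rw [h2, Int.natAbs_neg]

lemma abs_discr (q : QuadBasis σ) : |(NumberField.discr k : ℚ)| = |(q.disc : ℚ)| := by
  have := q.natAbs_discr
  have h := congrArg (fun m : ℕ => (m : ℚ)) this
  simpa [Nat.cast_natAbs] using h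

/-- Translation `ω ↦ ω + c` of the generator. -/
def shift (c : ℤ) : QuadBasis σ where
  ω := q.ω + c
  t := q.t + 2 * c
  n := q.n + c * q.t + c ^ 2
  sq := by push_cast; linear_combination q.sq
  conj := by simp [q.conj]; ring
  isIntegral_iff x := by
    rw [q.isIntegral_iff]
    constructor
    · rintro ⟨u, v, rfl⟩
      exact ⟨u - v * c, v, by push_cast; ring⟩
    · rintro ⟨u, v, rfl⟩
      exact ⟨u + v * c, v, by push_cast; ring⟩
  exists_repr x := by
    obtain ⟨u, v, rfl⟩ := q.exists_repr x
    exact ⟨u - v * c, v, by push_cast; ring⟩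
  indep u v h := by
    have := q.indep (u + v * c) v (by push_cast; linear_combination h)
    obtain ⟨h1, rfl⟩ := this
    exact ⟨by simpa using h1, rfl⟩

@[simp] lemma shift_s (c : ℤ) : (q.shift c).s = q.s := by simp [s, shift]; ring
@[simp] lemma shift_disc (c : ℤ) : (q.shift c).disc = q.disc := by simp [disc, shift]; ring

end QuadBasis

/-! ### Fractional ideals of quadratic fields -/

/-- Fractional ideals of a number field. -/
abbrev FracIdeal (k : Type*) [Field k] [NumberField k] := FractionalIdeal (𝓞 k)⁰ k

/-- The principal fractional ideal generated by an element. -/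
noncomputable abbrev principal {k : Type*} [Field k] [NumberField k] (x : k) : FracIdeal k :=
  FractionalIdeal.spanSingleton (𝓞 k)⁰ x

section General

variable {k : Type*} [Field k] [NumberField k]

/-- An integral element of `k` as an element of the ring of integers. -/
def toInt {x : k} (h : IsIntegral ℤ x) : 𝓞 k := ⟨x, h⟩

lemma mem_one_iff_isIntegral {x : k} : x ∈ (1 : FracIdeal k) ↔ IsIntegral ℤ x := by
  rw [FractionalIdeal.mem_one_iff]
  exact ⟨fun ⟨y, hy⟩ => hy ▸ y.2, fun h => ⟨⟨x, h⟩, rfl⟩⟩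

lemma mem_mul_of_mem {I J : FracIdeal k} {x y : k} (hx : x ∈ I) (hy : y ∈ J) : x * y ∈ I * J :=
  FractionalIdeal.mul_mem_mul hx hy

lemma integral_mul_mem {I : FracIdeal k} {r x : k} (hr : IsIntegral ℤ r) (hx : x ∈ I) :
    r * x ∈ I := by
  have := mem_mul_of_mem (mem_one_iff_isIntegral.mpr hr) hx
  rwa [one_mul] at this

lemma isIntegral_intCast (m : ℤ) : IsIntegral ℤ (m : k) := isIntegral_algebraMap (x := m)

lemma int_mul_mem {I : FracIdeal k} (m : ℤ) {x : k} (hx : x ∈ I) : (m : k) * x ∈ I :=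
  integral_mul_mem (isIntegral_intCast m) hx

lemma frac_add_mem {I : FracIdeal k} {x y : k} (hx : x ∈ I) (hy : y ∈ I) : x + y ∈ I :=
  Submodule.add_mem (I : Submodule (𝓞 k) k) hx hy

lemma frac_sub_mem {I : FracIdeal k} {x y : k} (hx : x ∈ I) (hy : y ∈ I) : x - y ∈ I :=
  Submodule.sub_mem (I : Submodule (𝓞 k) k) hx hy

lemma frac_neg_mem {I : FracIdeal k} {x : k} (hx : x ∈ I) : -x ∈ I :=
  Submodule.neg_mem (I : Submodule (𝓞 k) k) hx

lemma frac_zero_mem (I : FracIdeal k) : (0 : k) ∈ I :=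
  Submodule.zero_mem (I : Submodule (𝓞 k) k)

lemma mem_principal_iff {x y : k} (hy : y ≠ 0) : x ∈ principal y ↔ IsIntegral ℤ (x / y) := by
  rw [FractionalIdeal.mem_spanSingleton]
  constructor
  · rintro ⟨z, rfl⟩
    rw [Algebra.smul_def, mul_div_assoc, div_self hy, mul_one]
    exact z.2
  · intro h
    refine ⟨toInt h, ?_⟩
    rw [Algebra.smul_def]
    exact div_mul_cancel₀ x hy

lemma mem_principal_mul_iff {x y : k} (hy : y ≠ 0) (I : FracIdeal k) :
    x ∈ principal y * I ↔ x / y ∈ I := by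
  rw [FractionalIdeal.mem_singleton_mul]
  constructor
  · rintro ⟨z, hz, rfl⟩; rwa [mul_div_cancel_left₀ _ hy]
  · intro h; exact ⟨_, h, by field_simp⟩

lemma principal_ne_zero {x : k} (hx : x ≠ 0) : principal x ≠ 0 :=
  FractionalIdeal.spanSingleton_ne_zero_iff.mpr hx

lemma mem_inv_iff_isIntegral {I : FracIdeal k} (hI : I ≠ 0) {x : k} :
    x ∈ I⁻¹ ↔ ∀ y ∈ I, IsIntegral ℤ (x * y) := by
  rw [FractionalIdeal.mem_inv_iff hI]
  simp only [mem_one_iff_isIntegral]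

lemma isIntegral_mul_of_mem_inv {I : FracIdeal k} {x y : k} (hx : x ∈ I⁻¹) (hy : y ∈ I) :
    IsIntegral ℤ (y * x) := by
  by_cases hI : I = 0
  · subst hI
    have : y = 0 := FractionalIdeal.mem_zero_iff _ |>.mp hy
    simp [this, isIntegral_zero]
  · rw [mul_comm]; exact (mem_inv_iff_isIntegral hI).mp hx y hy

/-- An element multiplying `I⁻¹` into the integers lies in `I`. -/
lemma mem_of_forall_mem_inv {I : FracIdeal k} (hI : I ≠ 0) {x : k}
    (h : ∀ y ∈ I⁻¹, IsIntegral ℤ (x * y)) : x ∈ I := by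
  have := (mem_inv_iff_isIntegral (inv_ne_zero hI)).mpr h
  rwa [inv_inv] at this

lemma rat_isIntegral_iff {r : ℚ} : IsIntegral ℤ (r : k) ↔ ∃ j : ℤ, r = j := by
  constructor
  · intro h
    have h1 : IsIntegral ℤ r := by
      have := (isIntegral_algHom_iff (Algebra.ofId ℚ k |>.restrictScalars ℤ)
        (algebraMap ℚ k).injective (x := r)).mp (by simpa [Algebra.ofId_apply] using h)
      exact this
    obtain ⟨j, hj⟩ := IsIntegrallyClosed.isIntegral_iff.mp h1
    exact ⟨j, by simpa using hj.symm⟩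
  · rintro ⟨j, rfl⟩
    simpa using isIntegral_intCast j

lemma rat_mem_principal_iff {r m : ℚ} (hm : m ≠ 0) :
    (r : k) ∈ principal (m : k) ↔ ∃ j : ℤ, r = j * m := by
  rw [mem_principal_iff (by exact_mod_cast hm)]
  have : (r : k) / m = ((r / m : ℚ) : k) := by push_cast; rfl
  rw [this, rat_isIntegral_iff]
  constructor
  · rintro ⟨j, hj⟩; exact ⟨j, by rw [← hj]; field_simp⟩
  · rintro ⟨j, hj⟩; exact ⟨j, by rw [hj]; field_simp⟩

lemma absNorm_principal (x : k) :
    FractionalIdeal.absNorm (principal x) = |Algebra.norm ℚ x| :=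
  FractionalIdeal.absNorm_span_singleton (R := 𝓞 k) x

lemma absNorm_pos {I : FracIdeal k} (hI : I ≠ 0) : 0 < FractionalIdeal.absNorm I :=
  lt_of_le_of_ne (FractionalIdeal.absNorm_nonneg I)
    (fun h => hI (FractionalIdeal.absNorm_eq_zero_iff.mp h.symm))

/-- A fractional ideal can be scaled to an integral one prime to a given rational prime. -/
lemma exists_scaling {I : FracIdeal k} (hI : I ≠ 0) {p : ℕ} (hp : p.Prime) :
    ∃ h : k, h ≠ 0 ∧ principal h * I ≤ 1 ∧
      ∃ x y : k, IsIntegral ℤ x ∧ y ∈ principal h * I ∧ 1 = p * x + y := by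
  obtain ⟨a, J, ha, hJ⟩ := I⁻¹.exists_eq_spanSingleton_mul
  have hak : (a : k) ≠ 0 := by exact_mod_cast ha
  have hJ0 : J ≠ 0 := by
    rintro rfl
    exact inv_ne_zero hI (by rw [hJ]; simp)
  have hp0 : (p : 𝓞 k) ≠ 0 := by exact_mod_cast hp.ne_zero
  -- Modulo `pJ` the ideal `J` is generated by one element `b`. With `h = b/a` this reads `pI⁻¹ +
  -- (h) = I⁻¹`, and multiplying by `I` gives `(p) + hI = 1`.
  obtain ⟨b, hb⟩ := IsDedekindDomain.exists_sup_span_eq (I := Ideal.span {(p : 𝓞 k)} * J) (J := J)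
    Ideal.mul_le_right (mul_ne_zero (by simpa using hp0) hJ0)
  have key : principal (p : k) * I⁻¹ + principal ((a : k)⁻¹ * b) = I⁻¹ := by
    have h1 := congrArg (fun K : Ideal (𝓞 k) => principal ((a : k)⁻¹) * (K : FracIdeal k)) hb
    simp only [← hJ] at h1
    rw [FractionalIdeal.coeIdeal_sup, FractionalIdeal.coeIdeal_mul,
      FractionalIdeal.coeIdeal_span_singleton, FractionalIdeal.coeIdeal_span_singleton, mul_add,
      mul_left_comm, FractionalIdeal.spanSingleton_mul_spanSingleton] at h1
    rw [show principal ((a : k)⁻¹) * (J : FracIdeal k) = I⁻¹ from hJ.symm] at h1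
    simpa using h1
  set h : k := (a : k)⁻¹ * b with hh
  have key2 : principal (p : k) + principal h * I = 1 := by
    have := congrArg (fun K => K * I) key
    simpa [add_mul, mul_assoc, inv_mul_cancel₀ hI] using this
  have hone : (1 : k) ∈ principal (p : k) + principal h * I := by
    rw [key2]; exact mem_one_iff_isIntegral.mpr isIntegral_one
  have hpk : (p : k) ≠ 0 := by exact_mod_cast hp.ne_zero
  refine ⟨h, ?_, ?_, ?_⟩
  · intro h0
    rw [h0] at key2
    simp only [FractionalIdeal.spanSingleton_zero, zero_mul, add_zero] at key2
    have h1 : (1 : k) ∈ principal (p : k) := by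
      rw [key2]; exact mem_one_iff_isIntegral.mpr isIntegral_one
    rw [mem_principal_iff hpk] at h1
    have h2 : (1 : k) / p = ((1 / p : ℚ) : k) := by push_cast; rfl
    rw [h2, rat_isIntegral_iff] at h1
    obtain ⟨j, hj⟩ := h1
    have hpq : (p : ℚ) ≠ 0 := by exact_mod_cast hp.ne_zero
    have h3 : (p : ℤ) * j = 1 := by
      field_simp at hj
      exact_mod_cast hj.symm
    have := Int.isUnit_iff.mp (IsUnit.of_mul_eq_one _ h3)
    have := hp.two_le
    omega
  · rw [← key2]
    exact le_add_of_nonneg_left zero_le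
  · obtain ⟨x, hx, y, hy, hxy⟩ := (FractionalIdeal.mem_add _ _ _).mp hone
    refine ⟨x / p, y, (mem_principal_iff hpk).mp hx, hy, ?_⟩
    rw [← hxy]; field_simp

end General

/-! ### Conjugation and norms of fractional ideals -/

section Conj

variable {k : Type*} [Field k] [NumberField k] {σ : k ≃ₐ[ℚ] k}

lemma isIntegral_conj (σ : k ≃ₐ[ℚ] k) {x : k} (hx : IsIntegral ℤ x) : IsIntegral ℤ (σ x) :=
  hx.map (σ.toAlgHom.restrictScalars ℤ)

lemma mem_conjIdeal {I : FracIdeal k} {x : k} : x ∈ conjIdeal σ I ↔ ∃ y ∈ I, σ y = x := Iff.rfl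

lemma conj_mem_conjIdeal {I : FracIdeal k} {x : k} (hx : x ∈ I) : σ x ∈ conjIdeal σ I :=
  ⟨x, hx, rfl⟩

namespace QuadBasis

lemma mem_conjIdeal_iff (q : QuadBasis σ) {I : FracIdeal k} {x : k} :
    x ∈ conjIdeal σ I ↔ σ x ∈ I := by
  rw [mem_conjIdeal]
  constructor
  · rintro ⟨y, hy, rfl⟩; rwa [q.conj_conj]
  · intro h; exact ⟨_, h, q.conj_conj x⟩

lemma conjIdeal_conjIdeal (q : QuadBasis σ) (I : FracIdeal k) : conjIdeal σ (conjIdeal σ I) = I :=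
    by
  ext x
  rw [q.mem_conjIdeal_iff, q.mem_conjIdeal_iff, q.conj_conj]

end QuadBasis

lemma conjIdeal_mono {I J : FracIdeal k} (h : I ≤ J) : conjIdeal σ I ≤ conjIdeal σ J := by
  rintro _ ⟨y, hy, rfl⟩
  exact ⟨y, h hy, rfl⟩

/-- One inclusion is clear on generators; applying it to the conjugate ideals and conjugating back
gives the other. -/
lemma conjIdeal_mul (q : QuadBasis σ) (I J : FracIdeal k) :
    conjIdeal σ (I * J) = conjIdeal σ I * conjIdeal σ J := by
  have key : ∀ I J : FracIdeal k, conjIdeal σ I * conjIdeal σ J ≤ conjIdeal σ (I * J) := by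
    intro I J
    rw [FractionalIdeal.mul_le]
    rintro _ ⟨x, hx, rfl⟩ _ ⟨y, hy, rfl⟩
    exact ⟨x * y, mem_mul_of_mem hx hy, map_mul σ x y⟩
  apply le_antisymm _ (key I J)
  have h := conjIdeal_mono (σ := σ) (key (conjIdeal σ I) (conjIdeal σ J))
  simpa only [q.conjIdeal_conjIdeal] using h

lemma conjIdeal_principal (q : QuadBasis σ) (x : k) :
    conjIdeal σ (principal x) = principal (σ x) := by
  ext y
  rw [q.mem_conjIdeal_iff, FractionalIdeal.mem_spanSingleton, FractionalIdeal.mem_spanSingleton]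
  constructor
  · rintro ⟨z, hz⟩
    refine ⟨toInt (isIntegral_conj σ z.2), ?_⟩
    have := congrArg σ hz
    rw [q.conj_conj, Algebra.smul_def, map_mul] at this
    rw [← this, Algebra.smul_def]; rfl
  · rintro ⟨z, rfl⟩
    refine ⟨toInt (isIntegral_conj σ z.2), ?_⟩
    rw [Algebra.smul_def, Algebra.smul_def, map_mul, q.conj_conj]; rfl

lemma conjIdeal_one (q : QuadBasis σ) : conjIdeal σ (1 : FracIdeal k) = 1 := by
  have := conjIdeal_principal q (1 : k)
  simpa using this

lemma conjIdeal_ne_zero {I : FracIdeal k} (hI : I ≠ 0) : conjIdeal σ I ≠ 0 := by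
  obtain ⟨x, hx, hx0⟩ := FractionalIdeal.exists_ne_zero_mem_isInteger hI
  intro h
  have := conj_mem_conjIdeal (σ := σ) hx0
  rw [h, FractionalIdeal.mem_zero_iff] at this
  exact hx (by simpa using this)

lemma conjIdeal_inv (q : QuadBasis σ) (I : FracIdeal k) :
    conjIdeal σ I⁻¹ = (conjIdeal σ I)⁻¹ := by
  by_cases hI : I = 0
  · subst hI
    have h0 : conjIdeal σ (0 : FracIdeal k) = 0 := by
      have := conjIdeal_principal q (0 : k)
      simpa using this
    simp [h0]
  · apply eq_inv_of_mul_eq_one_left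
    rw [← conjIdeal_mul q, inv_mul_cancel₀ hI, conjIdeal_one q]

lemma conjIdeal_coeIdeal (J : Ideal (𝓞 k)) :
    conjIdeal σ (J : FracIdeal k) =
      ((J.map (NumberField.RingOfIntegers.mapRingEquiv (σ : k ≃+* k)) : Ideal (𝓞 k)) :
        FracIdeal k) := by
  ext x
  rw [mem_conjIdeal]
  constructor
  · rintro ⟨y, hy, rfl⟩
    obtain ⟨z, hz, rfl⟩ := (FractionalIdeal.mem_coeIdeal _).mp hy
    exact (FractionalIdeal.mem_coeIdeal _).mpr ⟨_, Ideal.mem_map_of_mem _ hz, rfl⟩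
  · intro hx
    obtain ⟨z, hz, rfl⟩ := (FractionalIdeal.mem_coeIdeal _).mp hx
    obtain ⟨y, hy, rfl⟩ := (Ideal.mem_map_of_equiv _ _).mp hz
    exact ⟨y, (FractionalIdeal.mem_coeIdeal _).mpr ⟨y, hy, rfl⟩, rfl⟩

lemma absNorm_map_equiv {R : Type*} [CommRing R] [IsDedekindDomain R]
    [Module.Free ℤ R] [Module.Finite ℤ R] (e : R ≃+* R) (J : Ideal R) :
    Ideal.absNorm (J.map e) = Ideal.absNorm J := by
  have := Nat.card_congr (Ideal.quotientEquiv J (J.map e) e rfl).toEquiv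
  exact this.symm

namespace QuadBasis

variable (q : QuadBasis σ)

lemma dvd_of_mem_ideal {P : Ideal (𝓞 k)} (hP : P ≠ ⊤) {p : ℕ} (hp : p.Prime)
    (hpP : (p : 𝓞 k) ∈ P) {u : ℤ} (hu : (u : 𝓞 k) ∈ P) : (p : ℤ) ∣ u := by
  by_contra h
  obtain ⟨a, b, hab⟩ := ((Nat.prime_iff_prime_int.mp hp).coprime_iff_not_dvd).mpr h
  apply hP
  rw [Ideal.eq_top_iff_one]
  have : (1 : 𝓞 k) = a * p + b * u := by exact_mod_cast hab.symm
  rw [this]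
  exact add_mem (P.mul_mem_left _ hpP) (P.mul_mem_left _ hu)

/-- A prime above `p` is generated by `p`, or contains `ω - r` for some integer `r`. -/
lemma prime_above (q : QuadBasis σ) {P : Ideal (𝓞 k)} (hP : P ≠ ⊤) {p : ℕ} (hp : p.Prime)
    (hpP : (p : 𝓞 k) ∈ P) :
    P = Ideal.span {(p : 𝓞 k)} ∨ ∃ r : ℤ, q.ωInt - r ∈ P := by
  by_cases h : P ≤ Ideal.span {(p : 𝓞 k)}
  · left
    exact le_antisymm h ((Ideal.span_singleton_le_iff_mem _).mpr hpP)
  right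
  obtain ⟨x, hx, hxp⟩ := SetLike.not_le_iff_exists.mp h
  obtain ⟨u, v, rfl⟩ := q.exists_int_repr x
  have hv : ¬ (p : ℤ) ∣ v := by
    rintro ⟨v', rfl⟩
    have : (u : 𝓞 k) ∈ P := by
      have h2 := P.sub_mem hx (P.mul_mem_left (v' * q.ωInt) hpP)
      convert h2 using 1
      push_cast; ring
    obtain ⟨u', rfl⟩ := dvd_of_mem_ideal hP hp hpP this
    apply hxp
    rw [Ideal.mem_span_singleton]
    exact ⟨u' + v' * q.ωInt, by push_cast; ring⟩
  obtain ⟨a, b, hab⟩ := ((Nat.prime_iff_prime_int.mp hp).coprime_iff_not_dvd).mpr hv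
  refine ⟨-(b * u), ?_⟩
  have h2 := P.add_mem (P.mul_mem_left (b : 𝓞 k) hx) (P.mul_mem_left (a * q.ωInt) hpP)
  have hab' : (a : 𝓞 k) * p + b * v = 1 := by exact_mod_cast hab
  convert h2 using 1
  push_cast
  linear_combination -q.ωInt * hab'

/-- The norm of `P` divides `N((p)) = p²`; if it equals `p²`, the cofactor of `P` in `(p)` has norm
one. -/
lemma absNorm_prime (q : QuadBasis σ) {P : Ideal (𝓞 k)} (hP : P ≠ ⊤) {p : ℕ} (hp : p.Prime)
    (hpP : (p : 𝓞 k) ∈ P) : P = Ideal.span {(p : 𝓞 k)} ∨ Ideal.absNorm P = p := by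
  have hfin : Module.finrank ℤ (𝓞 k) = 2 := by
    rw [NumberField.RingOfIntegers.rank, Module.finrank_eq_card_basis q.basis, Fintype.card_fin]
  have hle : Ideal.span {(p : 𝓞 k)} ≤ P := (Ideal.span_singleton_le_iff_mem _).mpr hpP
  have hdvd : Ideal.absNorm P ∣ p ^ 2 := by
    have := Ideal.absNorm_dvd_absNorm_of_le hle
    rwa [Ideal.absNorm_span_natCast, hfin] at this
  obtain ⟨j, hj, hjp⟩ := (Nat.dvd_prime_pow hp).mp hdvd
  interval_cases j
  · exact absurd (Ideal.absNorm_eq_one_iff.mp (by simpa using hjp)) hP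
  · right; simpa using hjp
  · left
    obtain ⟨J, hJ⟩ := Ideal.dvd_iff_le.mpr hle
    have h2 := congrArg Ideal.absNorm hJ
    rw [map_mul, Ideal.absNorm_span_natCast, hfin, hjp] at h2
    have h3 : Ideal.absNorm J = 1 := by
      have hpos : 0 < p ^ 2 := pow_pos hp.pos 2
      exact Nat.eq_of_mul_eq_mul_left hpos (by rw [mul_one]; exact h2.symm)
    rw [hJ, Ideal.absNorm_eq_one_iff.mp h3, Ideal.mul_top]

/-- Either `P = (p)`, or `P` has norm `p` and contains some `ω - r`. In the second case `P P̄ ⊆ (p)`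
by computing on generators, and both sides have norm `p²`. -/
lemma prime_mul_conj (q : QuadBasis σ) {P : Ideal (𝓞 k)} (hP : P.IsPrime) (hP0 : P ≠ ⊥) :
    (P : FracIdeal k) * conjIdeal σ P = principal ((Ideal.absNorm P : ℚ) : k) := by
  have hfin : Module.finrank ℤ (𝓞 k) = 2 := by
    rw [NumberField.RingOfIntegers.rank, Module.finrank_eq_card_basis q.basis, Fintype.card_fin]
  have := hP.isMaximal hP0
  obtain ⟨p, hp, j, hpj⟩ : ∃ p : ℕ, p.Prime ∧ ∃ j : ℕ, (p : 𝓞 k) ^ j ∈ P := by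
    obtain ⟨p, j, -, -, hp, h⟩ := Ideal.exists_prime_and_absNorm_eq_pow P
    refine ⟨p, hp, j, ?_⟩
    have := Ideal.absNorm_mem P
    rwa [h, Nat.cast_pow] at this
  have hpP : (p : 𝓞 k) ∈ P := hP.mem_of_pow_mem j hpj
  rcases q.absNorm_prime hP.ne_top hp hpP with h | h
  · have h1 : (P : FracIdeal k) = principal (p : k) := by
      rw [h, FractionalIdeal.coeIdeal_span_singleton]; simp
    rw [h, Ideal.absNorm_span_natCast, hfin, ← h, h1, conjIdeal_principal q,
      FractionalIdeal.spanSingleton_mul_spanSingleton]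
    rw [map_natCast, ← _root_.sq]
    push_cast
    rfl
  · rw [h]
    let Q := P.map (NumberField.RingOfIntegers.mapRingEquiv (σ : k ≃+* k))
    have hne : P ≠ Ideal.span {(p : 𝓞 k)} := by
      intro h2
      rw [h2, Ideal.absNorm_span_natCast, hfin] at h
      have := hp.two_le
      nlinarith
    obtain ⟨r, hr⟩ := (q.prime_above hP.ne_top hp hpP).resolve_left hne
    have hQP : P * Q ≤ Ideal.span {(p : 𝓞 k)} := by
      rw [Ideal.mul_le]
      intro x hx y hy
      obtain ⟨y, hyP, rfl⟩ := (Ideal.mem_map_of_equiv _ _).mp hy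
      have key : ∀ x ∈ P, ∃ u v : ℤ, x = p * u + v * (q.ωInt - r) := by
        intro x hx
        obtain ⟨u, v, rfl⟩ := q.exists_int_repr x
        have h2 : ((u + v * r : ℤ) : 𝓞 k) ∈ P := by
          have h2 := P.sub_mem hx (P.mul_mem_left (v : 𝓞 k) hr)
          convert h2 using 1
          push_cast; ring
        obtain ⟨u', hu'⟩ := dvd_of_mem_ideal hP.ne_top hp hpP h2
        refine ⟨u', v, ?_⟩
        have : (u : 𝓞 k) + v * r = p * u' := by exact_mod_cast hu'
        linear_combination this
      obtain ⟨u, v, rfl⟩ := key x hx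
      obtain ⟨u', v', rfl⟩ := key y hyP
      have hc : NumberField.RingOfIntegers.mapRingEquiv (σ : k ≃+* k) q.ωInt = q.t - q.ωInt := by
        apply NumberField.RingOfIntegers.ext
        rw [NumberField.RingOfIntegers.mapRingEquiv_apply]
        simpa using q.conj
      have hsq : q.ωInt ^ 2 = q.t * q.ωInt - q.n := by
        apply NumberField.RingOfIntegers.ext
        simpa using q.sq
      -- Up to sign this integer is `N(ω - r)`; it lies in `P ∩ ℤ = pℤ`.
      have hn : ((q.t * r - q.n - r ^ 2 : ℤ) : 𝓞 k) ∈ P := by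
        have := P.mul_mem_left (q.ωInt + r - q.t) hr
        convert this using 1
        push_cast
        linear_combination -hsq
      obtain ⟨m, hm⟩ := dvd_of_mem_ideal hP.ne_top hp hpP hn
      have hm' : (q.t : 𝓞 k) * r - q.n - r ^ 2 = p * m := by exact_mod_cast hm
      rw [Ideal.mem_span_singleton]
      refine ⟨u * (p * u' + v' * (q.t - q.ωInt - r)) + v * (q.ωInt - r) * u' - v * v' * m, ?_⟩
      simp only [map_add, map_mul, map_sub, map_natCast, map_intCast, hc]
      linear_combination -v * v' * hsq - v * v' * hm'
    obtain ⟨J, hJ⟩ := Ideal.dvd_iff_le.mpr hQP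
    have h2 := congrArg Ideal.absNorm hJ
    rw [map_mul, map_mul, absNorm_map_equiv, h, Ideal.absNorm_span_natCast, hfin] at h2
    have h3 : Ideal.absNorm J = 1 := by
      have hpos : 0 < p ^ 2 := pow_pos hp.pos 2
      exact Nat.eq_of_mul_eq_mul_left hpos (by rw [mul_one, ← h2]; ring)
    rw [conjIdeal_coeIdeal, ← FractionalIdeal.coeIdeal_mul, hJ, Ideal.absNorm_eq_one_iff.mp h3,
      Ideal.mul_top, FractionalIdeal.coeIdeal_span_singleton]
    simp

lemma mul_conj_of_principal (q : QuadBasis σ) (x : k) :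
    principal x * conjIdeal σ (principal x) =
      principal ((FractionalIdeal.absNorm (principal x) : ℚ) : k) := by
  rw [conjIdeal_principal q, FractionalIdeal.spanSingleton_mul_spanSingleton, ← q.norm_eq,
    absNorm_principal]
  rcases abs_choice (Algebra.norm ℚ x) with h | h <;> rw [h]
  ext y
  rw [FractionalIdeal.mem_spanSingleton, FractionalIdeal.mem_spanSingleton]
  constructor
  · rintro ⟨z, rfl⟩; exact ⟨-z, by push_cast; simp⟩
  · rintro ⟨z, rfl⟩; exact ⟨-z, by push_cast; simp⟩

/-- The product of a fractional ideal with its conjugate is generated by its norm. -/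
theorem mul_conj (q : QuadBasis σ) (I : FracIdeal k) :
    I * conjIdeal σ I = principal ((FractionalIdeal.absNorm I : ℚ) : k) := by
  have hmul : ∀ I J : FracIdeal k,
      I * conjIdeal σ I = principal ((FractionalIdeal.absNorm I : ℚ) : k) →
      J * conjIdeal σ J = principal ((FractionalIdeal.absNorm J : ℚ) : k) →
      I * J * conjIdeal σ (I * J) = principal ((FractionalIdeal.absNorm (I * J) : ℚ) : k) := by
    intro I J hI hJ
    rw [conjIdeal_mul q, mul_mul_mul_comm, hI, hJ,
      FractionalIdeal.spanSingleton_mul_spanSingleton, map_mul, Rat.cast_mul]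
  -- Both sides are multiplicative in the ideal, so it is enough to treat primes, and afterwards
  -- principal fractional ideals.
  have hint : ∀ J : Ideal (𝓞 k), (J : FracIdeal k) * conjIdeal σ J =
      principal ((FractionalIdeal.absNorm (J : FracIdeal k) : ℚ) : k) := by
    intro J
    induction J using UniqueFactorizationMonoid.induction_on_prime with
    | h₁ => simp
    | h₂ u hu =>
      rw [Ideal.isUnit_iff.mp hu]
      simp [conjIdeal_one q]
    | h₃ a P ha hP ih =>
      rw [FractionalIdeal.coeIdeal_mul]
      refine hmul _ _ ?_ ih
      rw [FractionalIdeal.coeIdeal_absNorm]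
      exact q.prime_mul_conj (Ideal.isPrime_of_prime hP) hP.ne_zero
  obtain ⟨a, J, ha, rfl⟩ := I.exists_eq_spanSingleton_mul
  exact hmul _ _ (q.mul_conj_of_principal _) (hint J)

lemma absNorm_conj (q : QuadBasis σ) (I : FracIdeal k) :
    FractionalIdeal.absNorm (conjIdeal σ I) = FractionalIdeal.absNorm I := by
  have h1 := q.mul_conj I
  have h2 := q.mul_conj (conjIdeal σ I)
  rw [q.conjIdeal_conjIdeal, mul_comm, h1] at h2
  have h3 := congrArg FractionalIdeal.absNorm h2
  rw [absNorm_principal, absNorm_principal, q.norm_rat, q.norm_rat, abs_pow, abs_pow,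
    abs_of_nonneg (FractionalIdeal.absNorm_nonneg _),
    abs_of_nonneg (FractionalIdeal.absNorm_nonneg _)] at h3
  exact ((sq_eq_sq₀ (FractionalIdeal.absNorm_nonneg _) (FractionalIdeal.absNorm_nonneg _)).mp
    h3).symm

end QuadBasis

end Conj

/-! ### Orders in `k + kδ` described by pairs -/

/-- A presentation `B = k + kδ` of a quaternion algebra. -/
structure QuatData {k : Type*} [Field k] [NumberField k] (σ : k ≃ₐ[ℚ] k)
    (B : Type*) [Ring B] [Algebra ℚ B] where
  q : QuadBasis σ
  i : k →ₐ[ℚ] B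
  δ : B
  κ : ℚ
  κ_ne : κ ≠ 0
  δ_sq : δ ^ 2 = algebraMap ℚ B κ
  δ_comm : ∀ x : k, δ * i x = i (σ x) * δ
  finrank_eq : Module.finrank ℚ B = 4

lemma exists_int_mul_isIntegral {k : Type*} [Field k] [NumberField k] (x : k) :
    ∃ m : ℤ, m ≠ 0 ∧ IsIntegral ℤ ((m : k) * x) := by
  have halg : IsAlgebraic ℤ x :=
    (IsFractionRing.isAlgebraic_iff ℤ ℚ k).mpr (Algebra.IsAlgebraic.isAlgebraic x)
  obtain ⟨m, hm, h⟩ := halg.exists_integral_multiple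
  exact ⟨m, hm, by simpa [zsmul_eq_mul] using h⟩

lemma exists_int_mul_mem {k : Type*} [Field k] [NumberField k] {I : FracIdeal k} (hI : I ≠ 0)
    (x : k) : ∃ m : ℤ, m ≠ 0 ∧ (m : k) * x ∈ I := by
  obtain ⟨y, hy, hyI⟩ := FractionalIdeal.exists_ne_zero_mem_isInteger hI
  have hy' : (y : k) ≠ 0 := by exact_mod_cast hy
  obtain ⟨m, hm, h⟩ := exists_int_mul_isIntegral (x / y)
  refine ⟨m, hm, ?_⟩
  have := integral_mul_mem h hyI
  convert this using 1
  field_simp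

namespace QuadBasis

variable {k : Type*} [Field k] [NumberField k] {σ : k ≃ₐ[ℚ] k} (q : QuadBasis σ)

lemma sub_conj {x : k} (hx : IsIntegral ℤ x) : ∃ v : ℤ, x - σ x = v * q.s := by
  obtain ⟨u, v, rfl⟩ := (q.isIntegral_iff x).mp hx
  refine ⟨v, ?_⟩
  simp only [map_add, map_mul, map_intCast, q.conj, s]; ring

/-- This is the integrality of the trace on the inverse different `s⁻¹O_k`: for `y = sx` one has `y
- ȳ = s(x + x̄)`, because `s̄ = -s`. -/
lemma trace_of_mul_s {x : k} (hx : IsIntegral ℤ (q.s * x)) : ∃ v : ℤ, x + σ x = v := by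
  obtain ⟨v, hv⟩ := q.sub_conj hx
  refine ⟨v, ?_⟩
  rw [map_mul, q.conj_s] at hv
  have h0 := q.s_ne_zero
  apply mul_left_cancel₀ h0
  linear_combination hv

/-- The conditions on a pair for the associated lattice to be an order. -/
structure IsPreadmissible (κ : ℚ) (a : FracIdeal k) (lam : k) : Prop where
  ne_zero : a ≠ 0
  s_mul_mem : q.s * lam ∈ a
  norm_congr : ∃ n : ℤ, Algebra.norm ℚ lam - κ = n * FractionalIdeal.absNorm a

end QuadBasis

namespace QuatData

variable {k : Type*} [Field k] [NumberField k] {σ : k ≃ₐ[ℚ] k}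
  {B : Type*} [Ring B] [Algebra ℚ B] (Q : QuatData σ B)

lemma nontrivial (Q : QuatData σ B) : Nontrivial B :=
  Module.nontrivial_of_finrank_pos (R := ℚ) (by rw [Q.finrank_eq]; norm_num)

lemma i_injective : Function.Injective Q.i := by
  have := Q.nontrivial
  exact Q.i.toRingHom.injective

lemma δ_mul_δ : Q.δ * Q.δ = Q.i (Q.κ : k) := by
  rw [← sq, Q.δ_sq]
  have := Q.i.commutes Q.κ
  simpa using this.symm

/-- The map `(α, β) ↦ α + βδ`. -/
noncomputable def ofPair : k × k →ₗ[ℚ] B :=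
  Q.i.toLinearMap ∘ₗ LinearMap.fst ℚ k k +
    (LinearMap.mulRight ℚ Q.δ) ∘ₗ Q.i.toLinearMap ∘ₗ LinearMap.snd ℚ k k

lemma ofPair_apply (a b : k) : Q.ofPair (a, b) = Q.i a + Q.i b * Q.δ := rfl

lemma finrank_k (Q : QuatData σ B) : Module.finrank ℚ k = 2 := by
  rw [Module.finrank_eq_card_basis Q.q.basis, Fintype.card_fin]

/-- A relation `a + bδ = 0` with `b ≠ 0` would put `δ` in `k`. Then `δ` both commutes and
anticommutes with `s ≠ 0`, so `δ = 0`, against `δ² = κ ≠ 0`. -/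
lemma ofPair_injective : Function.Injective Q.ofPair := by
  rw [injective_iff_map_eq_zero]
  rintro ⟨a, b⟩ h
  rw [ofPair_apply] at h
  have := Q.nontrivial
  have hb : b = 0 := by
    by_contra hb
    have h1 : Q.δ = Q.i (-a / b) := by
      have h2 : Q.i (b⁻¹) * (Q.i a + Q.i b * Q.δ) = 0 := by rw [h, mul_zero]
      rw [mul_add, ← mul_assoc, ← map_mul, ← map_mul, inv_mul_cancel₀ hb, map_one, one_mul] at h2
      rw [eq_neg_of_add_eq_zero_right h2, ← map_neg]
      congr 1
      field_simp
    have h3 := Q.δ_comm Q.q.s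
    rw [Q.q.conj_s, h1, ← map_mul, ← map_mul] at h3
    have h4 := Q.i_injective h3
    have h5 : -a / b = 0 := by
      have h0 := Q.q.s_ne_zero
      have : 2 * Q.q.s * (-a / b) = 0 := by linear_combination h4
      rcases mul_eq_zero.mp this with h | h
      · exact absurd h (mul_ne_zero two_ne_zero h0)
      · exact h
    have h6 := Q.δ_mul_δ
    rw [h1, h5, map_zero, zero_mul] at h6
    have h7 := Q.i_injective (h6.symm.trans (map_zero Q.i).symm)
    exact Q.κ_ne (by exact_mod_cast h7)
  subst hb
  rw [map_zero, zero_mul, add_zero] at h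
  have := Q.i_injective (h.trans (map_zero Q.i).symm)
  rw [this]; rfl

/-- The `ℚ`-linear isomorphism `k × k ≃ B`. -/
noncomputable def equiv : (k × k) ≃ₗ[ℚ] B :=
  LinearEquiv.ofBijective Q.ofPair ⟨Q.ofPair_injective, by
    have : FiniteDimensional ℚ B :=
      Module.finite_of_finrank_pos (by rw [Q.finrank_eq]; norm_num)
    rw [← LinearMap.range_eq_top]
    apply Submodule.eq_top_of_finrank_eq
    rw [LinearMap.finrank_range_of_inj Q.ofPair_injective, Module.finrank_prod, Q.finrank_k,
      Q.finrank_eq]⟩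

/-- The coordinate `α` of `α + βδ`. -/
noncomputable def fst : B →ₗ[ℚ] k := LinearMap.fst ℚ k k ∘ₗ Q.equiv.symm.toLinearMap

/-- The coordinate `β` of `α + βδ`. -/
noncomputable def snd : B →ₗ[ℚ] k := LinearMap.snd ℚ k k ∘ₗ Q.equiv.symm.toLinearMap

lemma equiv_symm_mk (a b : k) : Q.equiv.symm (Q.i a + Q.i b * Q.δ) = (a, b) := by
  rw [LinearEquiv.symm_apply_eq]; rfl

@[simp] lemma fst_mk (a b : k) : Q.fst (Q.i a + Q.i b * Q.δ) = a := by
  simp [fst, equiv_symm_mk]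

@[simp] lemma snd_mk (a b : k) : Q.snd (Q.i a + Q.i b * Q.δ) = b := by
  simp [snd, equiv_symm_mk]

lemma eta (x : B) : Q.i (Q.fst x) + Q.i (Q.snd x) * Q.δ = x :=
  Q.equiv.apply_symm_apply x

@[simp] lemma fst_i (a : k) : Q.fst (Q.i a) = a := by
  have := Q.fst_mk a 0
  simpa using this

@[simp] lemma snd_i (a : k) : Q.snd (Q.i a) = 0 := by
  have := Q.snd_mk a 0
  simpa using this

lemma mk_mul_mk (a b c d : k) : (Q.i a + Q.i b * Q.δ) * (Q.i c + Q.i d * Q.δ) =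
    Q.i (a * c + b * σ d * Q.κ) + Q.i (a * d + b * σ c) * Q.δ := by
  have h1 : Q.i b * Q.δ * Q.i c = Q.i (b * σ c) * Q.δ := by
    rw [mul_assoc, Q.δ_comm, ← mul_assoc, ← map_mul]
  have h2 : Q.i b * Q.δ * (Q.i d * Q.δ) = Q.i (b * σ d * Q.κ) := by
    rw [← mul_assoc, mul_assoc (Q.i b), Q.δ_comm, ← mul_assoc, mul_assoc, Q.δ_mul_δ, ← map_mul,
      ← map_mul]
  rw [mul_add, add_mul, add_mul, h1, h2, ← mul_assoc, ← map_mul, ← map_mul, map_add Q.i (a * c),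
    map_add Q.i (a * d), add_mul]
  abel

lemma fst_mul (x y : B) :
    Q.fst (x * y) = Q.fst x * Q.fst y + Q.snd x * σ (Q.snd y) * Q.κ := by
  conv_lhs => rw [← Q.eta x, ← Q.eta y, mk_mul_mk, fst_mk]

lemma snd_mul (x y : B) : Q.snd (x * y) = Q.fst x * Q.snd y + Q.snd x * σ (Q.fst y) := by
  conv_lhs => rw [← Q.eta x, ← Q.eta y, mk_mul_mk, snd_mk]

/-- The lattice `{α + βδ | β ∈ 𝔞⁻¹, α + λβ ∈ O_k}`. -/
noncomputable def pairOrder (a : FracIdeal k) (lam : k) : Submodule ℤ B where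
  carrier := {x | Q.snd x ∈ a⁻¹ ∧ IsIntegral ℤ (Q.fst x + lam * Q.snd x)}
  add_mem' := by
    rintro x y ⟨h1, h2⟩ ⟨h3, h4⟩
    refine ⟨by rw [map_add]; exact frac_add_mem h1 h3, ?_⟩
    rw [map_add, map_add, mul_add, add_add_add_comm]
    exact h2.add h4
  zero_mem' := ⟨by rw [map_zero]; exact frac_zero_mem _, by simpa using isIntegral_zero⟩
  smul_mem' := by
    rintro m x ⟨h1, h2⟩
    refine ⟨?_, ?_⟩
    · rw [map_zsmul, zsmul_eq_mul]; exact int_mul_mem m h1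
    · rw [map_zsmul, map_zsmul, mul_smul_comm, ← smul_add]; exact h2.zsmul m

lemma mem_pairOrder {a : FracIdeal k} {lam : k} {x : B} :
    x ∈ Q.pairOrder a lam ↔ Q.snd x ∈ a⁻¹ ∧ IsIntegral ℤ (Q.fst x + lam * Q.snd x) := Iff.rfl

lemma section_mem_pairOrder {a : FracIdeal k} (lam : k) {b : k} (hb : b ∈ a⁻¹) :
    Q.i (-lam * b) + Q.i b * Q.δ ∈ Q.pairOrder a lam := by
  rw [mem_pairOrder, snd_mk, fst_mk]
  exact ⟨hb, by rw [neg_mul, neg_add_cancel]; exact isIntegral_zero⟩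

lemma i_mem_pairOrder {a : FracIdeal k} {lam x : k} :
    Q.i x ∈ Q.pairOrder a lam ↔ IsIntegral ℤ x := by
  rw [mem_pairOrder, snd_i, fst_i, mul_zero, add_zero]
  exact and_iff_right (frac_zero_mem _)

/-- The condition `α ∈ 𝔡₂⁻¹` is redundant: `α` is the difference of `α + λβ ∈ O_k` and `λβ ∈
𝔡₂⁻¹𝔞𝔞⁻¹`. -/
lemma classicalOrder_eq {d₂ : Ideal (𝓞 k)} {a : FracIdeal k} {lam : k}
    (h : lam ∈ (d₂ : FracIdeal k)⁻¹ * a) (hd : d₂ ≠ 0) :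
    classicalOrder Q.i Q.δ d₂ a lam = Q.pairOrder a lam := by
  ext x
  rw [mem_pairOrder]
  constructor
  · rintro ⟨α, hα, β, hβ, hint, rfl⟩
    rw [fst_mk, snd_mk]; exact ⟨hβ, hint⟩
  · rintro ⟨h1, h2⟩
    refine ⟨Q.fst x, ?_, Q.snd x, h1, h2, (Q.eta x).symm⟩
    have hd' : (1 : FracIdeal k) ≤ (d₂ : FracIdeal k)⁻¹ := by
      rw [← inv_one]
      exact FractionalIdeal.inv_anti_mono (by simpa using hd) one_ne_zero
        FractionalIdeal.coeIdeal_le_one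
    have h3 : lam * Q.snd x ∈ (d₂ : FracIdeal k)⁻¹ := by
      have := mem_mul_of_mem h h1
      by_cases ha : a = 0
      · subst ha
        rw [mul_zero, zero_mul] at this
        rw [(FractionalIdeal.mem_zero_iff _).mp this]
        exact frac_zero_mem _
      · rwa [mul_assoc, mul_inv_cancel₀ ha, mul_one] at this
    have := frac_sub_mem (hd' (mem_one_iff_isIntegral.mpr h2)) h3
    rwa [add_sub_cancel_right] at this

/-- The conditions on a pair for `pairOrder` to be an order. -/
abbrev IsPreadmissible (a : FracIdeal k) (lam : k) : Prop := Q.q.IsPreadmissible Q.κ a lam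

lemma isIntegral_mul_conj (q : QuadBasis σ) {a : FracIdeal k} (ha : a ≠ 0) {b c : k}
    (hb : b ∈ a⁻¹) (hc : c ∈ a⁻¹) :
    IsIntegral ℤ (b * σ c * ((FractionalIdeal.absNorm a : ℚ) : k)) := by
  have h1 : b * σ c ∈ a⁻¹ * conjIdeal σ a⁻¹ := mem_mul_of_mem hb (conj_mem_conjIdeal hc)
  have hpos := (absNorm_pos ha).ne'
  rw [q.mul_conj, map_inv₀, mem_principal_iff (by exact_mod_cast inv_ne_zero hpos)] at h1
  convert h1 using 1
  push_cast
  rw [div_inv_eq_mul]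

variable {Q}

/-- Write the factors as `(c - λb) + bδ` and `(d - λb') + b'δ` with `c, d` integral. The new
`β`-coordinate is `cb' + d̄b - Tr(λb')b`, and `Tr(λb')` is an integer because `sλb'` is integral.
The new value of `α + λβ` is `cd - λb(d - d̄) - bb̄'(N(λ) - κ)`; here `d - d̄` is an integer
multiple of `s`, and `bb̄'N(𝔞)` is integral because `𝔞⁻¹` times its conjugate is generated by
`N(𝔞)⁻¹`. -/
lemma mul_mem_pairOrder {a : FracIdeal k} {lam : k} (h : Q.IsPreadmissible a lam) {x y : B}
    (hx : x ∈ Q.pairOrder a lam) (hy : y ∈ Q.pairOrder a lam) : x * y ∈ Q.pairOrder a lam := by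
  obtain ⟨hx1, hx2⟩ := hx
  obtain ⟨hy1, hy2⟩ := hy
  obtain ⟨m, hm⟩ := h.norm_congr
  obtain ⟨c, hc⟩ : ∃ c, c = Q.fst x + lam * Q.snd x := ⟨_, rfl⟩
  obtain ⟨d, hd⟩ : ∃ d, d = Q.fst y + lam * Q.snd y := ⟨_, rfl⟩
  rw [← hc] at hx2
  rw [← hd] at hy2
  set b := Q.snd x
  set b' := Q.snd y
  have hfx : Q.fst x = c - lam * b := by rw [hc]; ring
  have hfy : Q.fst y = d - lam * b' := by rw [hd]; ring
  have hI1 : IsIntegral ℤ (Q.q.s * lam * b) := isIntegral_mul_of_mem_inv hx1 h.s_mul_mem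
  have hI2 : IsIntegral ℤ (Q.q.s * (lam * b')) := by
    rw [← mul_assoc]; exact isIntegral_mul_of_mem_inv hy1 h.s_mul_mem
  rw [mem_pairOrder, fst_mul, snd_mul, hfx, hfy]
  constructor
  · obtain ⟨v, hv⟩ := Q.q.trace_of_mul_s hI2
    have : (c - lam * b) * b' + b * σ (d - lam * b') = c * b' + σ d * b - v * b := by
      rw [map_sub]; linear_combination -b * hv
    rw [this]
    exact frac_sub_mem (frac_add_mem (integral_mul_mem hx2 hy1)
      (integral_mul_mem (isIntegral_conj σ hy2) hx1)) (int_mul_mem v hx1)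
  · obtain ⟨v, hv⟩ := Q.q.sub_conj hy2
    have hn : (Algebra.norm ℚ lam : k) - Q.κ = m * ((FractionalIdeal.absNorm a : ℚ) : k) := by
      exact_mod_cast congrArg (fun r : ℚ => (r : k)) hm
    rw [Q.q.norm_eq] at hn
    have : (c - lam * b) * (d - lam * b') + b * σ b' * Q.κ +
        lam * ((c - lam * b) * b' + b * σ (d - lam * b')) =
        c * d - v * (Q.q.s * lam * b) - m * (b * σ b' * ((FractionalIdeal.absNorm a : ℚ) : k)) := by
      rw [map_sub, map_mul]
      linear_combination -lam * b * hv - b * σ b' * hn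
    rw [this]
    exact ((hx2.mul hy2).sub ((isIntegral_intCast v).mul hI1)).sub
      ((isIntegral_intCast m).mul (isIntegral_mul_conj Q.q h.ne_zero hx1 hy1))

variable (Q)

lemma exists_int_smul_mem {a : FracIdeal k} (ha : a ≠ 0) (lam : k) (x : B) :
    ∃ m : ℤ, m ≠ 0 ∧ m • x ∈ Q.pairOrder a lam := by
  obtain ⟨m, hm, h1⟩ := exists_int_mul_mem (inv_ne_zero ha) (Q.snd x)
  obtain ⟨m', hm', h2⟩ := exists_int_mul_isIntegral (Q.fst x + lam * Q.snd x)
  refine ⟨m * m', mul_ne_zero hm hm', ?_, ?_⟩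
  · rw [map_zsmul, zsmul_eq_mul]
    have := int_mul_mem m' h1
    convert this using 1
    push_cast; ring
  · rw [map_zsmul, map_zsmul, mul_smul_comm, ← smul_add, mul_smul]
    refine IsIntegral.zsmul ?_ m
    rw [zsmul_eq_mul]; exact h2

lemma fg_restrictScalars (I : FracIdeal k) :
    ((I : Submodule (𝓞 k) k).restrictScalars ℤ).FG := by
  have h : (I : Submodule (𝓞 k) k).FG := FractionalIdeal.fg_of_isNoetherianRing le_rfl I
  exact Submodule.FG.restrictScalars h

lemma fg_pairOrder (a : FracIdeal k) (lam : k) : (Q.pairOrder a lam).FG := by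
  let g : k →ₗ[ℤ] B := (Q.ofPair ∘ₗ ((LinearMap.mulLeft ℚ
    (-lam)).prod LinearMap.id)).restrictScalars ℤ
  have hg : ∀ b, g b = Q.i (-lam * b) + Q.i b * Q.δ := fun b => rfl
  have : Q.pairOrder a lam =
      (((1 : FracIdeal k) : Submodule (𝓞 k) k).restrictScalars ℤ).map
        (Q.i.toLinearMap.restrictScalars ℤ) ⊔
      (((a⁻¹ : FracIdeal k) : Submodule (𝓞 k) k).restrictScalars ℤ).map g := by
    apply le_antisymm
    · rintro x ⟨h1, h2⟩
      refine Submodule.mem_sup.mpr ⟨_, ⟨_, mem_one_iff_isIntegral.mpr h2, rfl⟩, _,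
        ⟨_, h1, rfl⟩, ?_⟩
      conv_rhs => rw [← Q.eta x]
      rw [hg]
      change Q.i _ + _ = _
      rw [← add_assoc, ← map_add]
      congr 2
      ring
    · refine sup_le ?_ ?_
      · rintro _ ⟨x, hx, rfl⟩
        exact Q.i_mem_pairOrder.mpr (mem_one_iff_isIntegral.mp hx)
      · rintro _ ⟨x, hx, rfl⟩
        exact Q.section_mem_pairOrder lam hx
  rw [this]
  exact ((fg_restrictScalars _).map _).sup ((fg_restrictScalars _).map _)

variable {Q}

lemma isOrder_pairOrder {a : FracIdeal k} {lam : k} (h : Q.IsPreadmissible a lam) :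
    IsOrder (Q.pairOrder a lam) where
  one_mem := by
    rw [← map_one Q.i, i_mem_pairOrder]; exact isIntegral_one
  mul_mem _ hx _ hy := mul_mem_pairOrder h hx hy
  fg := Q.fg_pairOrder a lam
  span_eq_top := by
    rw [eq_top_iff]
    rintro x -
    obtain ⟨m, hm, hx⟩ := Q.exists_int_smul_mem h.ne_zero lam x
    have hm' : (m : ℚ) ≠ 0 := by exact_mod_cast hm
    have := Submodule.smul_mem (Submodule.span ℚ (Q.pairOrder a lam : Set B)) ((m : ℚ)⁻¹)
      (Submodule.subset_span hx)
    rwa [← Int.cast_smul_eq_zsmul ℚ, smul_smul, inv_mul_cancel₀ hm', one_smul] at this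

variable (Q)

/-- Every order meeting `k` in its ring of integers comes from a pair. -/
theorem exists_pair {L : Submodule ℤ B} (hL : IsOrder L)
    (hk : ∀ x : k, Q.i x ∈ L ↔ IsIntegral ℤ x) :
    ∃ (a : FracIdeal k) (lam : k), Q.IsPreadmissible a lam ∧ L = Q.pairOrder a lam := by
  let I₀ : Submodule (𝓞 k) k :=
    { carrier := Q.snd '' L
      add_mem' := by
        rintro _ _ ⟨x, hx, rfl⟩ ⟨y, hy, rfl⟩
        exact ⟨x + y, L.add_mem hx hy, map_add _ _ _⟩
      zero_mem' := ⟨0, L.zero_mem, map_zero _⟩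
      smul_mem' := by
        rintro r _ ⟨x, hx, rfl⟩
        refine ⟨Q.i r * x, hL.mul_mem _ ((hk r).mpr r.2) _ hx, ?_⟩
        rw [snd_mul, fst_i, snd_i, zero_mul, add_zero, Algebra.smul_def] }
  have hfg : I₀.FG := by
    obtain ⟨S, hS⟩ := hL.fg
    classical
    refine ⟨S.image Q.snd, le_antisymm ?_ ?_⟩
    · rw [Submodule.span_le]
      intro x hx
      obtain ⟨y, hy, rfl⟩ := Finset.mem_image.mp (Finset.mem_coe.mp hx)
      exact ⟨y, hS ▸ Submodule.subset_span hy, rfl⟩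
    · rintro _ ⟨x, hx, rfl⟩
      have hx' : x ∈ Submodule.span ℤ (S : Set B) := hS ▸ hx
      refine Submodule.span_induction (p := fun x _ => Q.snd x ∈ Submodule.span (𝓞 k) _)
        ?_ ?_ ?_ ?_ hx'
      · intro y hy
        exact Submodule.subset_span (Finset.mem_coe.mpr (Finset.mem_image_of_mem _ hy))
      · rw [map_zero]; exact Submodule.zero_mem _
      · intro x y _ _ h1 h2; rw [map_add]; exact Submodule.add_mem _ h1 h2
      · intro m x _ h1; rw [map_zsmul]; exact zsmul_mem h1 m
  let I : FracIdeal k := ⟨I₀, FractionalIdeal.isFractional_of_fg hfg⟩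
  have hmem : ∀ b, b ∈ I ↔ ∃ x ∈ L, Q.snd x = b := fun b => Iff.rfl
  have hI : I ≠ 0 := by
    intro h0
    have h1 : ∀ x ∈ Submodule.span ℚ (L : Set B), Q.snd x = 0 := by
      intro x hx
      refine Submodule.span_induction ?_ ?_ ?_ ?_ hx
      · intro y hy
        have : Q.snd y ∈ I := ⟨y, hy, rfl⟩
        rwa [h0, FractionalIdeal.mem_zero_iff] at this
      · exact map_zero _
      · intro x y _ _ hx hy; rw [map_add, hx, hy, add_zero]
      · intro c x _ hx; rw [map_smul, hx, smul_zero]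
    have h2 := h1 Q.δ (by rw [hL.span_eq_top]; trivial)
    have h3 := Q.snd_mk 0 1
    rw [map_zero, map_one, one_mul, zero_add, h2] at h3
    exact zero_ne_one h3
  -- The splitting of `L → I`. For `w = xy` with `x` the second coordinate of some `X ∈ L` and `y ∈
  -- I⁻¹`, multiplying `X` by the integer `by` lifts `wb`. Summing such products reaches `w = 1`,
  -- because `I` is invertible.
  have hsec : ∀ w ∈ I * I⁻¹, ∃ μ : k, ∀ b ∈ I, Q.i (μ * b) + Q.i (w * b) * Q.δ ∈ L := by
    intro w hw
    refine FractionalIdeal.mul_induction_on hw ?_ ?_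
    · rintro x ⟨X, hX, rfl⟩ y hy
      refine ⟨y * Q.fst X, fun b hb => ?_⟩
      have hint : IsIntegral ℤ (b * y) := isIntegral_mul_of_mem_inv hy hb
      have := hL.mul_mem _ ((hk _).mpr hint) _ hX
      convert this using 1
      conv_rhs => rw [← Q.eta X]
      rw [mul_add, ← mul_assoc, ← map_mul, ← map_mul]
      rw [show y * Q.fst X * b = b * y * Q.fst X by ring,
        show Q.snd X * y * b = b * y * Q.snd X by ring]
    · rintro x y ⟨μ, hμ⟩ ⟨ν, hν⟩
      refine ⟨μ + ν, fun b hb => ?_⟩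
      have := L.add_mem (hμ b hb) (hν b hb)
      convert this using 1
      rw [add_mul, add_mul, map_add, map_add, add_mul]
      abel
  obtain ⟨μ, hμ⟩ := hsec 1 (by
    rw [mul_inv_cancel₀ hI]; exact mem_one_iff_isIntegral.mpr isIntegral_one)
  have hsec' : ∀ b ∈ I, Q.i (μ * b) + Q.i b * Q.δ ∈ L := by simpa using hμ
  have hchar : ∀ x, x ∈ L ↔ Q.snd x ∈ I ∧ IsIntegral ℤ (Q.fst x + -μ * Q.snd x) := by
    intro x
    have hdecomp : x = Q.i (Q.fst x + -μ * Q.snd x) +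
        (Q.i (μ * Q.snd x) + Q.i (Q.snd x) * Q.δ) := by
      conv_lhs => rw [← Q.eta x]
      rw [← add_assoc, ← map_add]
      congr 2
      ring
    constructor
    · intro hx
      refine ⟨⟨x, hx, rfl⟩, (hk _).mp ?_⟩
      have := L.sub_mem hx (hsec' _ ⟨x, hx, rfl⟩)
      convert this using 1
      rw [eq_sub_iff_add_eq]
      exact hdecomp.symm
    · rintro ⟨h1, h2⟩
      rw [hdecomp]
      exact L.add_mem ((hk _).mpr h2) (hsec' _ h1)
  refine ⟨I⁻¹, -μ, ⟨inv_ne_zero hI, ?_, ?_⟩, ?_⟩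
  -- Multiply the lift `μb + bδ` on the right by `ω`: the result has `α - μβ = sμb`.
  · apply mem_of_forall_mem_inv (inv_ne_zero hI)
    rw [inv_inv]
    intro b hb
    have h1 := hL.mul_mem _ (hsec' b hb) _ ((hk _).mpr Q.q.isIntegral_ω)
    have h2 := ((hchar _).mp h1).2
    rw [fst_mul, snd_mul, fst_mk, snd_mk, fst_i, snd_i, Q.q.conj] at h2
    convert h2.neg using 1
    simp only [QuadBasis.s, map_zero]
    ring
  -- The product of the lifts of `b` and `c` has `α - μβ = b c̄ (κ - N(μ))`, and the products `b c̄`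
  -- generate `I Ī = (N(I))`.
  · have hw : ∀ w ∈ I * conjIdeal σ I,
        IsIntegral ℤ (w * (((Q.κ - Algebra.norm ℚ (-μ) : ℚ) : ℚ) : k)) := by
      intro w hw
      refine FractionalIdeal.mul_induction_on hw ?_ ?_
      · rintro b hb _ ⟨c, hc, rfl⟩
        have h1 := ((hchar _).mp (hL.mul_mem _ (hsec' b hb) _ (hsec' c hc))).2
        rw [fst_mul, snd_mul, fst_mk, snd_mk, fst_mk, snd_mk] at h1
        convert h1 using 1
        push_cast
        rw [Q.q.norm_eq, map_mul, map_neg]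
        ring
      · intro x y hx hy
        rw [add_mul]; exact hx.add hy
    have hpos := (absNorm_pos hI).ne'
    have h1 := hw _ (by rw [Q.q.mul_conj]; exact FractionalIdeal.mem_spanSingleton_self _ _)
    rw [← Rat.cast_mul, rat_isIntegral_iff] at h1
    obtain ⟨j, hj⟩ := h1
    refine ⟨-j, ?_⟩
    rw [map_inv₀]
    push_cast
    rw [← hj]
    field_simp
    ring
  · ext x
    rw [hchar, mem_pairOrder, inv_inv]

/-- Inclusion need only be tested on the elements `-λb + bδ` with `b ∈ 𝔞⁻¹`, as both lattices
contain `O_k`. Note the reversal: a larger order has a smaller ideal. -/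
lemma pairOrder_le_iff {a a' : FracIdeal k} {lam lam' : k} (ha : a ≠ 0) (ha' : a' ≠ 0) :
    Q.pairOrder a lam ≤ Q.pairOrder a' lam' ↔ a' ≤ a ∧ lam' - lam ∈ a := by
  constructor
  · intro h
    have h1 : ∀ b ∈ a⁻¹, b ∈ a'⁻¹ ∧ IsIntegral ℤ ((lam' - lam) * b) := by
      intro b hb
      have := h (Q.section_mem_pairOrder lam hb)
      rw [mem_pairOrder, fst_mk, snd_mk] at this
      refine ⟨this.1, ?_⟩
      convert this.2 using 1
      ring
    refine ⟨?_, mem_of_forall_mem_inv ha fun b hb => (h1 b hb).2⟩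
    have := FractionalIdeal.inv_anti_mono (inv_ne_zero ha) (inv_ne_zero ha')
      (show a⁻¹ ≤ a'⁻¹ from fun b hb => (h1 b hb).1)
    rwa [inv_inv, inv_inv] at this
  · rintro ⟨h1, h2⟩ x ⟨h3, h4⟩
    refine ⟨FractionalIdeal.inv_anti_mono ha' ha h1 h3, ?_⟩
    have e : Q.fst x + lam' * Q.snd x =
        Q.fst x + lam * Q.snd x + (lam' - lam) * Q.snd x := by ring
    change IsIntegral ℤ (Q.fst x + lam' * Q.snd x)
    rw [e]
    exact h4.add (isIntegral_mul_of_mem_inv h3 h2)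

/-- Replacing `δ` by `hδ`. -/
@[simps]
noncomputable def scale (h : k) (hh : h ≠ 0) : QuatData σ B where
  q := Q.q
  i := Q.i
  δ := Q.i h * Q.δ
  κ := Algebra.norm ℚ h * Q.κ
  κ_ne := mul_ne_zero (by simpa [Algebra.norm_eq_zero_iff] using hh) Q.κ_ne
  δ_sq := by
    have := Q.mk_mul_mk 0 h 0 h
    simp only [map_zero, zero_add, zero_mul, mul_zero, add_zero] at this
    rw [sq, this, ← Q.q.norm_eq, ← Rat.cast_mul]
    have := Q.i.commutes (Algebra.norm ℚ h * Q.κ)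
    simpa using this
  δ_comm x := by
    rw [mul_assoc, Q.δ_comm, ← mul_assoc, ← mul_assoc, ← map_mul, ← map_mul, mul_comm]
  finrank_eq := Q.finrank_eq

lemma scale_coords (h : k) (hh : h ≠ 0) (x : B) :
    (Q.scale h hh).fst x = Q.fst x ∧ (Q.scale h hh).snd x = Q.snd x / h := by
  have h1 : x = (Q.scale h hh).i (Q.fst x) + (Q.scale h hh).i (Q.snd x / h) * (Q.scale h hh).δ := by
    conv_lhs => rw [← Q.eta x]
    rw [scale_i, scale_δ, ← mul_assoc, ← map_mul, div_mul_cancel₀ _ hh]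
  constructor
  · conv_lhs => rw [h1, fst_mk]
  · conv_lhs => rw [h1, snd_mk]

/-- This gives (iv), and it also allows `𝔞` to be made trivial at a chosen prime without changing
the order. -/
lemma scale_pairOrder (h : k) (hh : h ≠ 0) (a : FracIdeal k) (lam : k) :
    (Q.scale h hh).pairOrder (principal h * a) (h * lam) = Q.pairOrder a lam := by
  ext x
  obtain ⟨h1, h2⟩ := Q.scale_coords h hh x
  rw [mem_pairOrder, mem_pairOrder, h1, h2, mul_inv, FractionalIdeal.spanSingleton_inv,
    mem_principal_mul_iff (inv_ne_zero hh)]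
  have e1 : Q.snd x / h / h⁻¹ = Q.snd x := by field_simp
  have e2 : h * lam * (Q.snd x / h) = lam * Q.snd x := by field_simp
  rw [e1, e2]

end QuatData

/-! ### Scaling a pair and changing its representative -/

namespace QuadBasis

variable {k : Type*} [Field k] [NumberField k] {σ : k ≃ₐ[ℚ] k} {q : QuadBasis σ}

lemma IsPreadmissible.scale {κ : ℚ} {a : FracIdeal k} {lam : k} (hp : q.IsPreadmissible κ a lam)
    {h : k} (hh : h ≠ 0) :
    q.IsPreadmissible (Algebra.norm ℚ h * κ) (principal h * a) (h * lam) where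
  ne_zero := mul_ne_zero (principal_ne_zero hh) hp.ne_zero
  s_mul_mem := by
    rw [mem_principal_mul_iff hh]
    have : q.s * (h * lam) / h = q.s * lam := by field_simp
    rw [this]; exact hp.s_mul_mem
  norm_congr := by
    obtain ⟨n, hn⟩ := hp.norm_congr
    rw [map_mul, map_mul, absNorm_principal, ← mul_sub, hn]
    rcases abs_choice (Algebra.norm ℚ h) with h1 | h1 <;> rw [h1]
    · exact ⟨n, by ring⟩
    · exact ⟨-n, by push_cast; ring⟩

lemma IsPreadmissible.of_scale {κ : ℚ} {a : FracIdeal k} {lam h : k} (hh : h ≠ 0)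
    (hp : q.IsPreadmissible (Algebra.norm ℚ h * κ) a lam) :
    q.IsPreadmissible κ (principal h⁻¹ * a) (h⁻¹ * lam) := by
  have := hp.scale (inv_ne_zero hh)
  rwa [← mul_assoc, ← map_mul, inv_mul_cancel₀ hh, map_one, one_mul] at this

/-- The conditions depend only on the class of the second component. -/
lemma IsPreadmissible.congr {κ : ℚ} {a : FracIdeal k} {lam lam' : k}
    (hp : q.IsPreadmissible κ a lam) (h : lam' - lam ∈ a) : q.IsPreadmissible κ a lam' where
  ne_zero := hp.ne_zero
  s_mul_mem := by
    have := frac_add_mem hp.s_mul_mem (integral_mul_mem q.isIntegral_s h)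
    rwa [← mul_add, add_sub_cancel] at this
  norm_congr := by
    obtain ⟨n, hn⟩ := hp.norm_congr
    obtain ⟨g, hg⟩ : ∃ g, g = lam' - lam := ⟨_, rfl⟩
    rw [← hg] at h
    have hpos := (absNorm_pos hp.ne_zero).ne'
    have hposk : ((FractionalIdeal.absNorm a : ℚ) : k) ≠ 0 := by exact_mod_cast hpos
    -- `N(λ + g) - N(λ) = Tr(λḡ) + N(g)`. Since `sλḡ` and `gḡ` both lie in `𝔞𝔞̄ = (N(𝔞))`, both
    -- terms are multiples of `N(𝔞)`.
    have h1 : q.s * lam * σ g ∈ a * conjIdeal σ a :=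
      mem_mul_of_mem hp.s_mul_mem (conj_mem_conjIdeal h)
    have h2 : g * σ g ∈ a * conjIdeal σ a := mem_mul_of_mem h (conj_mem_conjIdeal h)
    rw [q.mul_conj, mem_principal_iff hposk] at h1
    rw [q.mul_conj, ← q.norm_eq, rat_mem_principal_iff hpos] at h2
    obtain ⟨m, hm⟩ := h2
    obtain ⟨v, hv⟩ := q.trace_of_mul_s
      (x := lam * σ g / ((FractionalIdeal.absNorm a : ℚ) : k)) (by
        convert h1 using 1; ring)
    refine ⟨n + v + m, ?_⟩
    have key : ((Algebra.norm ℚ lam' : ℚ) : k) = (Algebra.norm ℚ lam : ℚ) +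
        v * ((FractionalIdeal.absNorm a : ℚ) : k) + (Algebra.norm ℚ g : ℚ) := by
      have hl : lam' = lam + g := by rw [hg]; ring
      rw [hl, q.norm_eq, q.norm_eq, q.norm_eq, ← hv, map_div₀, map_mul, q.conj_conj, map_add,
        map_ratCast]
      field_simp
      ring
    have key' : Algebra.norm ℚ lam' = Algebra.norm ℚ lam + v * FractionalIdeal.absNorm a +
        Algebra.norm ℚ g := by exact_mod_cast key
    rw [key', hm]
    push_cast
    linear_combination hn

end QuadBasis

/-! ### Extension of scalars -/

section BaseChange

variable {V : Type*} [AddCommGroup V] [Module ℚ V] {ι : Type*}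
  (F : Type*) [CommRing F] [Algebra ℚ F]

/-- Coordinates on `V ⊗ F` with respect to a basis of `V`. -/
noncomputable def coordT (b : Module.Basis ι ℚ V) (j : ι) : V ⊗[ℚ] F →ₗ[ℚ] F :=
  (TensorProduct.lid ℚ F).toLinearMap ∘ₗ LinearMap.rTensor F (b.coord j)

variable {F}

@[simp] lemma coordT_tmul (b : Module.Basis ι ℚ V) (j : ι) (x : V) (f : F) :
    coordT F b j (x ⊗ₜ f) = b.repr x j • f := by
  simp [coordT]

lemma sum_coordT [Fintype ι] (b : Module.Basis ι ℚ V) (y : V ⊗[ℚ] F) :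
    ∑ j, b j ⊗ₜ[ℚ] coordT F b j y = y := by
  induction y using TensorProduct.induction_on with
  | zero => simp
  | tmul x f =>
    simp only [coordT_tmul, TensorProduct.tmul_smul, TensorProduct.smul_tmul']
    rw [← TensorProduct.sum_tmul, b.sum_repr]
  | add x y hx hy =>
    simp only [map_add, TensorProduct.tmul_add, Finset.sum_add_distrib, hx, hy]

end BaseChange

section Conj

variable {k : Type*} [Field k] [NumberField k] (σ : k ≃ₐ[ℚ] k)
  (F : Type*) [CommRing F] [Algebra ℚ F]

/-- The extension of an automorphism of `k` to `k ⊗ F`. -/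
noncomputable def conjT : k ⊗[ℚ] F →ₐ[ℚ] k ⊗[ℚ] F :=
  Algebra.TensorProduct.map (σ : k →ₐ[ℚ] k) (AlgHom.id ℚ F)

variable {σ F}

@[simp] lemma conjT_tmul (x : k) (f : F) : conjT σ F (x ⊗ₜ f) = σ x ⊗ₜ f := by
  simp [conjT]

lemma conjT_conjT (q : QuadBasis σ) (y : k ⊗[ℚ] F) : conjT σ F (conjT σ F y) = y := by
  induction y using TensorProduct.induction_on with
  | zero => simp
  | tmul x f => simp [q.conj_conj]
  | add x y hx hy => simp [hx, hy]

/-- The element of `k ⊗ F` with coordinates `x, y` in the basis `1, ω`. -/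
noncomputable def QuadBasis.elt (q : QuadBasis σ) (x y : F) : k ⊗[ℚ] F :=
  1 ⊗ₜ x + q.ω ⊗ₜ y

lemma QuadBasis.basis_zero (q : QuadBasis σ) : q.basis 0 = 1 := by simp [basis]

lemma QuadBasis.basis_one (q : QuadBasis σ) : q.basis 1 = q.ω := by simp [basis]

lemma QuadBasis.exists_elt (q : QuadBasis σ) (y : k ⊗[ℚ] F) : ∃ a b : F, y = q.elt a b := by
  refine ⟨coordT F q.basis 0 y, coordT F q.basis 1 y, ?_⟩
  conv_lhs => rw [← sum_coordT q.basis y]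
  rw [Fin.sum_univ_two, q.basis_zero, q.basis_one, elt]

lemma QuadBasis.elt_eq_zero (q : QuadBasis σ) {a b : F} (h : q.elt a b = 0) : a = 0 ∧ b = 0 := by
  rw [elt, ← q.basis_zero, ← q.basis_one] at h
  have h0 := congrArg (coordT F q.basis 0) h
  have h1 := congrArg (coordT F q.basis 1) h
  simp only [map_add, coordT_tmul, Module.Basis.repr_self, map_zero] at h0 h1
  simpa using And.intro h0 h1

lemma QuadBasis.elt_mul_conj (q : QuadBasis σ) (a b : F) :
    q.elt a b * conjT σ F (q.elt a b) = (1 : k) ⊗ₜ[ℚ] (a ^ 2 + q.t * a * b + q.n * b ^ 2) := by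
  have e1 : q.ω * (q.t - q.ω) = (q.n : k) := by linear_combination -q.sq
  have ht : (q.t : k) = ((q.t : ℚ) : k) := by simp
  have hn : (q.n : k) = ((q.n : ℚ) : k) := by simp
  have hone : ∀ (r : ℚ) (f : F), (r : k) ⊗ₜ[ℚ] f = (1 : k) ⊗ₜ[ℚ] (algebraMap ℚ F r * f) := by
    intro r f
    have h1 : (r : k) = r • (1 : k) := by simp [Algebra.smul_def]
    have h2 : algebraMap ℚ F r * f = r • f := by rw [Algebra.smul_def]
    rw [h1, h2, TensorProduct.smul_tmul]
  simp only [elt, map_add, conjT_tmul, map_one, q.conj, add_mul, mul_add,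
    Algebra.TensorProduct.tmul_mul_tmul, one_mul, mul_one, e1]
  rw [TensorProduct.sub_tmul, hn, ht, hone, hone, map_intCast, map_intCast, mul_comm b a]
  have h3 : q.ω ⊗ₜ[ℚ] (a * b) = q.ω ⊗ₜ[ℚ] (a * b) := rfl
  rw [show a ^ 2 + q.t * a * b + q.n * b ^ 2 = a * a + q.t * (a * b) + q.n * (b * b) by ring,
    TensorProduct.tmul_add, TensorProduct.tmul_add]
  abel

end Conj

namespace QuatData

variable {k : Type*} [Field k] [NumberField k] {σ : k ≃ₐ[ℚ] k}
  {B : Type*} [Ring B] [Algebra ℚ B] (Q : QuatData σ B)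
  (F : Type*) [CommRing F] [Algebra ℚ F]

/-- The extension of the embedding `k → B`. -/
noncomputable def iT : k ⊗[ℚ] F →ₐ[ℚ] B ⊗[ℚ] F :=
  Algebra.TensorProduct.map Q.i (AlgHom.id ℚ F)

/-- The first coordinate on `B ⊗ F`. -/
noncomputable def fstT : B ⊗[ℚ] F →ₗ[ℚ] k ⊗[ℚ] F := Q.fst.rTensor F

/-- The second coordinate on `B ⊗ F`. -/
noncomputable def sndT : B ⊗[ℚ] F →ₗ[ℚ] k ⊗[ℚ] F := Q.snd.rTensor F

/-- The element `δ ⊗ 1`. -/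
noncomputable def δT : B ⊗[ℚ] F := Q.δ ⊗ₜ 1

variable {F}

@[simp] lemma iT_tmul (x : k) (f : F) : Q.iT F (x ⊗ₜ f) = Q.i x ⊗ₜ f := by simp [iT]
@[simp] lemma fstT_tmul (x : B) (f : F) : Q.fstT F (x ⊗ₜ f) = Q.fst x ⊗ₜ f := by simp [fstT]
@[simp] lemma sndT_tmul (x : B) (f : F) : Q.sndT F (x ⊗ₜ f) = Q.snd x ⊗ₜ f := by simp [sndT]

lemma iT_mul_δT (x : k) (f : F) : Q.iT F (x ⊗ₜ f) * Q.δT F = (Q.i x * Q.δ) ⊗ₜ f := by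
  simp [δT]

lemma δT_comm (y : k ⊗[ℚ] F) : Q.δT F * Q.iT F y = Q.iT F (conjT σ F y) * Q.δT F := by
  induction y using TensorProduct.induction_on with
  | zero => simp
  | tmul x f => simp [δT, Q.δ_comm]
  | add x y hx hy => simp only [map_add, mul_add, add_mul, hx, hy]

lemma δT_mul_δT : Q.δT F * Q.δT F = Q.iT F ((Q.κ : k) ⊗ₜ 1) := by
  simp [δT, Q.δ_mul_δ]

lemma etaT (y : B ⊗[ℚ] F) : Q.iT F (Q.fstT F y) + Q.iT F (Q.sndT F y) * Q.δT F = y := by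
  induction y using TensorProduct.induction_on with
  | zero => simp
  | tmul x f =>
    rw [fstT_tmul, sndT_tmul, iT_mul_δT, iT_tmul, ← TensorProduct.add_tmul, Q.eta]
  | add x y hx hy =>
    conv_rhs => rw [← hx, ← hy]
    simp only [map_add, add_mul]; abel

lemma fstT_mkT (a b : k ⊗[ℚ] F) : Q.fstT F (Q.iT F a + Q.iT F b * Q.δT F) = a := by
  have h1 : Q.fstT F (Q.iT F a) = a := by
    induction a using TensorProduct.induction_on with
    | zero => simp
    | tmul x f => simp
    | add x y hx hy => simp [hx, hy]
  have h2 : Q.fstT F (Q.iT F b * Q.δT F) = 0 := by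
    induction b using TensorProduct.induction_on with
    | zero => simp
    | tmul x f =>
      have := Q.fst_mk 0 x
      rw [map_zero, zero_add] at this
      rw [iT_mul_δT, fstT_tmul, this, TensorProduct.zero_tmul]
    | add x y hx hy => simp [add_mul, hx, hy]
  rw [map_add, h1, h2, add_zero]

lemma sndT_mkT (a b : k ⊗[ℚ] F) : Q.sndT F (Q.iT F a + Q.iT F b * Q.δT F) = b := by
  have h1 : Q.sndT F (Q.iT F a) = 0 := by
    induction a using TensorProduct.induction_on with
    | zero => simp
    | tmul x f => simp
    | add x y hx hy => simp [hx, hy]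
  have h2 : Q.sndT F (Q.iT F b * Q.δT F) = b := by
    induction b using TensorProduct.induction_on with
    | zero => simp
    | tmul x f =>
      have := Q.snd_mk 0 x
      rw [map_zero, zero_add] at this
      rw [iT_mul_δT, sndT_tmul, this]
    | add x y hx hy => simp [add_mul, hx, hy]
  rw [map_add, h1, h2, zero_add]

lemma mkT_mul_mkT (a b c d : k ⊗[ℚ] F) :
    (Q.iT F a + Q.iT F b * Q.δT F) * (Q.iT F c + Q.iT F d * Q.δT F) =
      Q.iT F (a * c + b * conjT σ F d * ((Q.κ : k) ⊗ₜ 1)) +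
        Q.iT F (a * d + b * conjT σ F c) * Q.δT F := by
  have h1 : Q.iT F b * Q.δT F * Q.iT F c = Q.iT F (b * conjT σ F c) * Q.δT F := by
    rw [mul_assoc, Q.δT_comm, ← mul_assoc, ← map_mul]
  have h2 : Q.iT F b * Q.δT F * (Q.iT F d * Q.δT F) =
      Q.iT F (b * conjT σ F d * ((Q.κ : k) ⊗ₜ 1)) := by
    rw [← mul_assoc, mul_assoc (Q.iT F b), Q.δT_comm, ← mul_assoc, mul_assoc, Q.δT_mul_δT,
      ← map_mul, ← map_mul]
  rw [mul_add, add_mul, add_mul, h1, h2, ← mul_assoc, ← map_mul, ← map_mul,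
    map_add (Q.iT F) (a * c), map_add (Q.iT F) (a * d), add_mul]
  abel

end QuatData

/-! ### A criterion for `B ⊗ F` to be a division ring -/

namespace QuatData

variable {k : Type*} [Field k] [NumberField k] {σ : k ≃ₐ[ℚ] k}
  {B : Type*} [Ring B] [Algebra ℚ B] (Q : QuatData σ B)
  {F : Type*} [Field F] [Algebra ℚ F]

/-- The norm form of the quadratic field. -/
def _root_.QuatOrder.normForm {R : Type*} [CommRing R] (t n : ℤ) (x y : R) : R :=
  x ^ 2 + t * x * y + n * y ^ 2

lemma kappa_tmul (f : F) : ((Q.κ : k) ⊗ₜ[ℚ] f : k ⊗[ℚ] F) = 1 ⊗ₜ (algebraMap ℚ F Q.κ * f) := by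
  have h1 : (Q.κ : k) = Q.κ • (1 : k) := by simp [Algebra.smul_def]
  rw [h1, TensorProduct.smul_tmul, Algebra.smul_def]

/-- The second factor is the quaternion conjugate of the first, so the product is the reduced norm
`N(a, b) - κN(c, d)`. -/
lemma mkT_mul_conj (a b c d : F) :
    (Q.iT F (Q.q.elt a b) + Q.iT F (Q.q.elt c d) * Q.δT F) *
      (Q.iT F (conjT σ F (Q.q.elt a b)) + Q.iT F (-(Q.q.elt c d)) * Q.δT F) =
    Q.iT F (1 ⊗ₜ (normForm Q.q.t Q.q.n a b -
      algebraMap ℚ F Q.κ * normForm Q.q.t Q.q.n c d)) := by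
  rw [mkT_mul_mkT, map_neg, mul_neg, neg_mul, ← sub_eq_add_neg, Q.q.elt_mul_conj,
    Q.q.elt_mul_conj, Q.kappa_tmul, Algebra.TensorProduct.tmul_mul_tmul, conjT_conjT Q.q,
    mul_one, mul_one, mul_neg, mul_comm (Q.q.elt a b), neg_add_cancel, map_zero, zero_mul,
    add_zero, ← TensorProduct.tmul_sub]
  congr 2
  simp only [normForm]; ring

lemma conj_mul_mkT (a b c d : F) :
    (Q.iT F (conjT σ F (Q.q.elt a b)) + Q.iT F (-(Q.q.elt c d)) * Q.δT F) *
      (Q.iT F (Q.q.elt a b) + Q.iT F (Q.q.elt c d) * Q.δT F) =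
    Q.iT F (1 ⊗ₜ (normForm Q.q.t Q.q.n a b -
      algebraMap ℚ F Q.κ * normForm Q.q.t Q.q.n c d)) := by
  rw [mkT_mul_mkT, mul_comm (conjT σ F (Q.q.elt a b)) (Q.q.elt a b), neg_mul, neg_mul,
    ← sub_eq_add_neg, Q.q.elt_mul_conj,
    Q.q.elt_mul_conj, Q.kappa_tmul, Algebra.TensorProduct.tmul_mul_tmul,
    mul_one, mul_one, neg_mul, mul_comm (conjT σ F _), add_neg_cancel, map_zero, zero_mul,
    add_zero, ← TensorProduct.tmul_sub]
  congr 2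
  simp only [normForm]; ring

/-- A nontrivial zero of the reduced norm gives two nonzero elements, an element and its conjugate,
with product zero. -/
lemma not_division {a b c d : F} (h : normForm Q.q.t Q.q.n a b =
    algebraMap ℚ F Q.κ * normForm Q.q.t Q.q.n c d)
    (h0 : ¬ (a = 0 ∧ b = 0 ∧ c = 0 ∧ d = 0)) : ¬ ∀ x : B ⊗[ℚ] F, x ≠ 0 → IsUnit x := by
  intro H
  have hmul := Q.mkT_mul_conj a b c d
  rw [h, sub_self, TensorProduct.tmul_zero, map_zero] at hmul
  set X := Q.iT F (Q.q.elt a b) + Q.iT F (Q.q.elt c d) * Q.δT F with hX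
  by_cases hX0 : X = 0
  · have h1 := congrArg (Q.fstT F) hX0
    have h2 := congrArg (Q.sndT F) hX0
    rw [hX, fstT_mkT, map_zero] at h1
    rw [hX, sndT_mkT, map_zero] at h2
    obtain ⟨ha, hb⟩ := Q.q.elt_eq_zero h1
    obtain ⟨hc, hd⟩ := Q.q.elt_eq_zero h2
    exact h0 ⟨ha, hb, hc, hd⟩
  · have hY := (H X hX0).mul_right_eq_zero.mp hmul
    have h1 := congrArg (Q.fstT F) hY
    have h2 := congrArg (Q.sndT F) hY
    rw [fstT_mkT, map_zero] at h1
    rw [sndT_mkT, map_zero, neg_eq_zero] at h2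
    have h3 := congrArg (conjT σ F) h1
    rw [conjT_conjT Q.q, map_zero] at h3
    obtain ⟨ha, hb⟩ := Q.q.elt_eq_zero h3
    obtain ⟨hc, hd⟩ := Q.q.elt_eq_zero h2
    exact h0 ⟨ha, hb, hc, hd⟩

/-- When the reduced norm is anisotropic, the conjugate divided by the norm is a two-sided inverse.
-/
lemma division (h : ∀ a b c d : F, normForm Q.q.t Q.q.n a b =
    algebraMap ℚ F Q.κ * normForm Q.q.t Q.q.n c d → a = 0 ∧ b = 0 ∧ c = 0 ∧ d = 0) :
    ∀ x : B ⊗[ℚ] F, x ≠ 0 → IsUnit x := by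
  intro x hx
  obtain ⟨a, b, hab⟩ := Q.q.exists_elt (Q.fstT F x)
  obtain ⟨c, d, hcd⟩ := Q.q.exists_elt (Q.sndT F x)
  have hx' := Q.etaT x
  rw [hab, hcd] at hx'
  have h1 := Q.mkT_mul_conj a b c d
  have h2 := Q.conj_mul_mkT a b c d
  rw [hx'] at h1 h2
  set r := normForm Q.q.t Q.q.n a b - algebraMap ℚ F Q.κ * normForm Q.q.t Q.q.n c d with hr
  have hr0 : r ≠ 0 := by
    intro h0
    obtain ⟨rfl, rfl, rfl, rfl⟩ := h a b c d (sub_eq_zero.mp h0)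
    apply hx
    rw [← hx']
    simp [QuadBasis.elt]
  set Y := Q.iT F (conjT σ F (Q.q.elt a b)) + Q.iT F (-(Q.q.elt c d)) * Q.δT F
  have hinv : Q.iT F (1 ⊗ₜ r) * Q.iT F (1 ⊗ₜ r⁻¹) = 1 := by
    rw [← map_mul, Algebra.TensorProduct.tmul_mul_tmul, mul_one, mul_inv_cancel₀ hr0]
    exact map_one _
  have hinv' : Q.iT F (1 ⊗ₜ r⁻¹) * Q.iT F (1 ⊗ₜ r) = 1 := by
    rw [← map_mul, mul_comm, map_mul, hinv]
  have hleft : (Q.iT F (1 ⊗ₜ r⁻¹) * Y) * x = 1 := by rw [mul_assoc, h2, hinv']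
  have hright : x * (Y * Q.iT F (1 ⊗ₜ r⁻¹)) = 1 := by rw [← mul_assoc, h1, hinv]
  have heq : Q.iT F (1 ⊗ₜ r⁻¹) * Y = Y * Q.iT F (1 ⊗ₜ r⁻¹) := left_inv_eq_right_inv hleft hright
  exact ⟨⟨x, _, hright, heq ▸ hleft⟩, rfl⟩

end QuatData

/-! ### Binary and quaternary forms over the `p`-adic integers -/

section Forms

/-- The norm form of the lattice attached to a pair, in coordinates. -/
def pairForm {R : Type*} [CommRing R] (t n u v C : ℤ) (c₀ c₁ b₀ b₁ : R) : R :=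
  c₀ ^ 2 + t * c₀ * c₁ + n * c₁ ^ 2 - v * c₀ * b₀ - (u + t * v) * c₀ * b₁ + u * c₁ * b₀
    - n * v * c₁ * b₁ + C * (b₀ ^ 2 + t * b₀ * b₁ + n * b₁ ^ 2)

open MvPolynomial in
lemma exists_quadratic_zero {K : Type*} [Field K] [Fintype K] {ι : Type*} [Fintype ι]
    (hι : 2 < Fintype.card ι) (M : ι → ι → K) :
    ∃ x : ι → K, x ≠ 0 ∧ ∑ i, ∑ j, M i j * x i * x j = 0 := by
  classical
  obtain ⟨p, hp⟩ := CharP.exists K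
  let f : MvPolynomial ι K := ∑ i, ∑ j, C (M i j) * X i * X j
  have hf : f.totalDegree < Fintype.card ι := by
    refine lt_of_le_of_lt ?_ hι
    refine totalDegree_finsetSum_le fun i _ => totalDegree_finsetSum_le fun j _ => ?_
    refine (totalDegree_mul _ _).trans ?_
    refine (add_le_add_left (totalDegree_mul _ _) _).trans ?_
    simp
  have heval : ∀ x, eval x f = ∑ i, ∑ j, M i j * x i * x j := by
    intro x; simp [f]
  have hdvd := char_dvd_card_solutions p hf
  have hp1 : p ≠ 1 := CharP.char_ne_one K p
  by_contra hcon
  push Not at hcon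
  have hsub : Subsingleton { x : ι → K // eval x f = 0 } := by
    refine ⟨fun x y => Subtype.ext ?_⟩
    have h0 : ∀ z : { x : ι → K // eval x f = 0 }, z.1 = 0 := by
      intro z
      by_contra hz
      exact hcon z.1 hz (by rw [← heval]; exact z.2)
    rw [h0 x, h0 y]
  have hne : Nonempty { x : ι → K // eval x f = 0 } := ⟨⟨0, by rw [heval]; simp⟩⟩
  have hcard : Fintype.card { x : ι → K // eval x f = 0 } = 1 :=
    le_antisymm (Fintype.card_le_one_iff_subsingleton.mpr hsub) (Fintype.card_pos)
  rw [hcard] at hdvd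
  exact hp1 (Nat.dvd_one.mp hdvd)

variable {p : ℕ} [hp : Fact p.Prime]

-- Hensel's lemma at `0`, where the polynomial takes the small value `c` and has the unit `D` as
-- derivative. It moves one coordinate of a zero mod `p` to an exact zero.
open Polynomial in
lemma exists_quadratic_root (A D c : ℤ_[p]) (hc : ‖c‖ < 1) (hD : ‖D‖ = 1) :
    ∃ T : ℤ_[p], A * T ^ 2 + D * T + c = 0 ∧ ‖T‖ < 1 := by
  let f : ℤ_[p][X] := Polynomial.C A * X ^ 2 + Polynomial.C D * X + Polynomial.C c
  have h0 : f.aeval (0 : ℤ_[p]) = c := by simp [f]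
  have h1 : f.derivative.aeval (0 : ℤ_[p]) = D := by simp [f]
  obtain ⟨z, hz, hz1, -⟩ := hensels_lemma (F := f) (a := (0 : ℤ_[p])) (by
    rw [h0, h1, hD]; simpa using hc)
  refine ⟨z, by simpa [f] using hz, ?_⟩
  rwa [h1, hD, sub_zero] at hz1

/-- A quaternary form attached to a pair whose discriminant is a unit is isotropic. -/
theorem exists_pairForm_zero {t n u v C : ℤ}
    (h : ¬ (p : ℤ) ∣ u ^ 2 + t * u * v + n * v ^ 2 + (t ^ 2 - 4 * n) * C) :
    ∃ c₀ c₁ b₀ b₁ : ℤ_[p], ¬ (c₀ = 0 ∧ c₁ = 0 ∧ b₀ = 0 ∧ b₁ = 0) ∧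
      pairForm t n u v C c₀ c₁ b₀ b₁ = 0 := by
  -- Upper triangular coefficient matrix of the form modulo `p`.
  let M : Fin 4 → Fin 4 → ZMod p := ![![1, t, -v, -(u + t * v)], ![0, n, u, -(n * v)],
    ![0, 0, C, C * t], ![0, 0, 0, C * n]]
  obtain ⟨x, hx0, hx⟩ := exists_quadratic_zero (by simp) M
  have hx' : pairForm t n u v C (x 0) (x 1) (x 2) (x 3) = 0 := by
    rw [← hx]
    simp only [Fin.sum_univ_four, M, pairForm, Matrix.cons_val]
    ring
  have hsurj : ∀ z : ZMod p, ∃ y : ℤ_[p], PadicInt.toZMod y = z := fun z => by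
    obtain ⟨m, rfl⟩ := ZMod.intCast_surjective z
    exact ⟨m, by simp⟩
  have hker : ∀ y : ℤ_[p], PadicInt.toZMod y = 0 ↔ ‖y‖ < 1 := by
    intro y
    rw [← RingHom.mem_ker, PadicInt.ker_toZMod, PadicInt.maximalIdeal_eq_span_p,
      Ideal.mem_span_singleton, PadicInt.norm_lt_one_iff_dvd]
  have hunit : ∀ y : ℤ_[p], PadicInt.toZMod y ≠ 0 → ‖y‖ = 1 := by
    intro y hy
    rw [Ne, hker] at hy
    exact le_antisymm (PadicInt.norm_le_one y) (not_lt.mp hy)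
  choose L hL using hsurj
  obtain ⟨c₀, hc₀⟩ : ∃ c, c = L (x 0) := ⟨_, rfl⟩
  obtain ⟨c₁, hc₁⟩ : ∃ c, c = L (x 1) := ⟨_, rfl⟩
  obtain ⟨b₀, hb₀⟩ : ∃ c, c = L (x 2) := ⟨_, rfl⟩
  obtain ⟨b₁, hb₁⟩ : ∃ c, c = L (x 3) := ⟨_, rfl⟩
  have e0 : PadicInt.toZMod c₀ = x 0 := by rw [hc₀, hL]
  have e1 : PadicInt.toZMod c₁ = x 1 := by rw [hc₁, hL]
  have e2 : PadicInt.toZMod b₀ = x 2 := by rw [hb₀, hL]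
  have e3 : PadicInt.toZMod b₁ = x 3 := by rw [hb₁, hL]
  have hQ : ‖pairForm t n u v C c₀ c₁ b₀ b₁‖ < 1 := by
    rw [← hker]
    simp only [pairForm, map_add, map_sub, map_mul, map_pow, map_intCast, e0, e1, e2, e3]
    exact hx'
  have hne : ∀ d₀ d₁ a₀ a₁ : ℤ_[p], PadicInt.toZMod d₀ = x 0 → PadicInt.toZMod d₁ = x 1 →
      PadicInt.toZMod a₀ = x 2 → PadicInt.toZMod a₁ = x 3 →
      ¬ (d₀ = 0 ∧ d₁ = 0 ∧ a₀ = 0 ∧ a₁ = 0) := by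
    rintro d₀ d₁ a₀ a₁ h0 h1 h2 h3 ⟨rfl, rfl, rfl, rfl⟩
    apply hx0
    rw [map_zero] at h0 h1 h2 h3
    funext i
    fin_cases i
    · exact h0.symm
    · exact h1.symm
    · exact h2.symm
    · exact h3.symm
  -- If some partial derivative is nonzero at the zero found mod `p`, Hensel's lemma in that
  -- variable lifts it; the four cases follow in turn.
  by_cases hD0 : PadicInt.toZMod (2 * c₀ + t * c₁ - v * b₀ - (u + t * v) * b₁ : ℤ_[p]) = 0
  swap
  · obtain ⟨T, hT, hT1⟩ := exists_quadratic_root 1 _ _ hQ (hunit _ hD0)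
    refine ⟨c₀ + T, c₁, b₀, b₁, hne _ _ _ _ ?_ e1 e2 e3, ?_⟩
    · rw [map_add, (hker T).mpr hT1, add_zero, e0]
    · rw [← hT]; simp only [pairForm]; ring
  by_cases hD1 : PadicInt.toZMod (t * c₀ + 2 * n * c₁ + u * b₀ - n * v * b₁ : ℤ_[p]) = 0
  swap
  · obtain ⟨T, hT, hT1⟩ := exists_quadratic_root n _ _ hQ (hunit _ hD1)
    refine ⟨c₀, c₁ + T, b₀, b₁, hne _ _ _ _ e0 ?_ e2 e3, ?_⟩
    · rw [map_add, (hker T).mpr hT1, add_zero, e1]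
    · rw [← hT]; simp only [pairForm]; ring
  by_cases hD2 : PadicInt.toZMod (-v * c₀ + u * c₁ + C * (2 * b₀ + t * b₁) : ℤ_[p]) = 0
  swap
  · obtain ⟨T, hT, hT1⟩ := exists_quadratic_root C _ _ hQ (hunit _ hD2)
    refine ⟨c₀, c₁, b₀ + T, b₁, hne _ _ _ _ e0 e1 ?_ e3, ?_⟩
    · rw [map_add, (hker T).mpr hT1, add_zero, e2]
    · rw [← hT]; simp only [pairForm]; ring
  by_cases hD3 : PadicInt.toZMod
      (-(u + t * v) * c₀ - n * v * c₁ + C * (t * b₀ + 2 * n * b₁) : ℤ_[p]) = 0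
  swap
  · obtain ⟨T, hT, hT1⟩ := exists_quadratic_root (C * n) _ _ hQ (hunit _ hD3)
    refine ⟨c₀, c₁, b₀, b₁ + T, hne _ _ _ _ e0 e1 e2 ?_, ?_⟩
    · rw [map_add, (hker T).mpr hT1, add_zero, e3]
    · rw [← hT]; simp only [pairForm]; ring
  -- All partial derivatives vanish. Suitable linear combinations of them equal the discriminant
  -- times each coordinate, so the zero would be trivial.
  exfalso
  simp only [map_add, map_sub, map_mul, map_neg, map_intCast, map_ofNat, e0, e1, e2, e3]
    at hD0 hD1 hD2 hD3
  have hκ : (u ^ 2 + t * u * v + n * v ^ 2 + (t ^ 2 - 4 * n) * C : ZMod p) ≠ 0 := by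
    intro h0
    apply h
    rw [← ZMod.intCast_zmod_eq_zero_iff_dvd]
    push_cast
    exact h0
  have hz2 : x 2 = 0 := by
    refine (mul_eq_zero.mp ?_).resolve_left hκ
    linear_combination t * hD3 - 2 * n * hD2 + (u + t * v) * hD1 - n * v * hD0
  have hz3 : x 3 = 0 := by
    refine (mul_eq_zero.mp ?_).resolve_left hκ
    linear_combination t * hD2 - 2 * hD3 - u * hD0 - v * hD1
  have hz0 : x 0 = 0 := by
    refine (mul_eq_zero.mp ?_).resolve_left hκ
    linear_combination -u * hD3 - n * v * hD2 + C * (t * hD1 - 2 * n * hD0)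
  have hz1 : x 1 = 0 := by
    refine (mul_eq_zero.mp ?_).resolve_left hκ
    linear_combination u * hD2 - v * hD3 + t * v * hD2 + C * (t * hD0 - 2 * hD1)
  apply hx0
  funext i
  fin_cases i
  · exact hz0
  · exact hz1
  · exact hz2
  · exact hz3

lemma exists_int_approx (x : ℤ_[p]) (m : ℕ) : ∃ X : ℤ, ∃ y : ℤ_[p], x = X + p ^ m * y := by
  have := PadicInt.appr_spec m x
  rw [Ideal.mem_span_singleton] at this
  obtain ⟨y, hy⟩ := this
  exact ⟨x.appr m, y, by push_cast; linear_combination hy⟩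

/-- If `p² ∣ N(x, y)` only for `p ∣ x, y`, an integral value of the norm form is only attained at
integral arguments. -/
lemma norm_le_one_of_normForm {t n : ℤ}
    (H : ∀ x y : ℤ_[p], (p : ℤ_[p]) ^ 2 ∣ normForm t n x y → (p : ℤ_[p]) ∣ x ∧ (p : ℤ_[p]) ∣ y)
    {x y : ℚ_[p]} (h : ‖normForm t n x y‖ ≤ 1) : ‖x‖ ≤ 1 ∧ ‖y‖ ≤ 1 := by
  have hp0 : (p : ℚ_[p]) ≠ 0 := by exact_mod_cast hp.out.ne_zero
  -- Clear denominators by `p^m` and descend on `m`. While `m > 0`, the norm of the cleared pair is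
  -- divisible by `p²`, so `H` permits one division by `p`.
  have key : ∀ m : ℕ, ∀ X Y : ℤ_[p], (X : ℚ_[p]) = p ^ m * x → (Y : ℚ_[p]) = p ^ m * y →
      ‖x‖ ≤ 1 ∧ ‖y‖ ≤ 1 := by
    intro m
    induction m with
    | zero =>
      intro X Y hX hY
      rw [pow_zero, one_mul] at hX hY
      rw [← hX, ← hY]
      exact ⟨X.2, Y.2⟩
    | succ m ih =>
      intro X Y hX hY
      have hdvd : (p : ℤ_[p]) ^ 2 ∣ normForm t n X Y := by
        obtain ⟨Z, hZ⟩ : ∃ Z : ℤ_[p], (Z : ℚ_[p]) = normForm t n x y := ⟨⟨_, h⟩, rfl⟩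
        refine ⟨p ^ (2 * m) * Z, ?_⟩
        apply Subtype.ext
        simp only [normForm] at hZ ⊢
        push_cast
        rw [hX, hY, hZ]
        ring
      obtain ⟨⟨X', hX'⟩, ⟨Y', hY'⟩⟩ := H X Y hdvd
      refine ih X' Y' ?_ ?_
      · rw [hX'] at hX
        push_cast at hX
        apply mul_left_cancel₀ hp0
        rw [hX]; ring
      · rw [hY'] at hY
        push_cast at hY
        apply mul_left_cancel₀ hp0
        rw [hY]; ring
  have hex : ∀ z : ℚ_[p], ∃ m : ℕ, ∀ m' ≥ m, ‖(p : ℚ_[p]) ^ m' * z‖ ≤ 1 := by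
    intro z
    have hp1 : (1 : ℝ) < p := by exact_mod_cast hp.out.one_lt
    obtain ⟨m, hm⟩ := pow_unbounded_of_one_lt ‖z‖ hp1
    refine ⟨m, fun m' hm' => ?_⟩
    rw [norm_mul, norm_pow, Padic.norm_p, inv_pow]
    have h1 : (p : ℝ) ^ m ≤ (p : ℝ) ^ m' := pow_le_pow_right₀ hp1.le hm'
    rw [inv_mul_le_iff₀ (by positivity), mul_one]
    linarith
  obtain ⟨m₁, h₁⟩ := hex x
  obtain ⟨m₂, h₂⟩ := hex y
  exact key (max m₁ m₂) ⟨_, h₁ _ (le_max_left _ _)⟩ ⟨_, h₂ _ (le_max_right _ _)⟩ rfl rfl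

/-- All multiples of a zero are zeros, hence have integral coordinates; an element all of whose
multiples are integral vanishes. -/
lemma eq_zero_of_normForm {t n : ℤ}
    (H : ∀ x y : ℤ_[p], (p : ℤ_[p]) ^ 2 ∣ normForm t n x y → (p : ℤ_[p]) ∣ x ∧ (p : ℤ_[p]) ∣ y)
    {x y : ℚ_[p]} (h : normForm t n x y = 0) : x = 0 ∧ y = 0 := by
  have key : ∀ z : ℚ_[p], ‖z * x‖ ≤ 1 ∧ ‖z * y‖ ≤ 1 := by
    intro z
    apply norm_le_one_of_normForm H
    have : normForm t n (z * x) (z * y) = z ^ 2 * normForm t n x y := by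
      simp only [normForm]; ring
    rw [this, h, mul_zero, norm_zero]
    exact zero_le_one
  have hp1 : (1 : ℝ) < p := by exact_mod_cast hp.out.one_lt
  have hp0 : (p : ℚ_[p]) ≠ 0 := by exact_mod_cast hp.out.ne_zero
  have key2 : ∀ w : ℚ_[p], (∀ z : ℚ_[p], ‖z * w‖ ≤ 1) → w = 0 := by
    intro w hw
    by_contra hw0
    have h1 := hw ((p : ℚ_[p])⁻¹ * w⁻¹)
    rw [mul_assoc, inv_mul_cancel₀ hw0, mul_one, norm_inv, Padic.norm_p, inv_inv] at h1
    linarith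
  exact ⟨key2 x fun z => (key z).1, key2 y fun z => (key z).2⟩

/-- If `κ` is not a value of the norm form on integral arguments, the form `N - κN` is
anisotropic. -/
lemma anisotropic_of_not_norm {t n κ : ℤ}
    (H : ∀ x y : ℤ_[p], (p : ℤ_[p]) ^ 2 ∣ normForm t n x y → (p : ℤ_[p]) ∣ x ∧ (p : ℤ_[p]) ∣ y)
    (hκ : ∀ x y : ℤ_[p], normForm t n x y ≠ κ) {a b c d : ℚ_[p]}
    (h : normForm t n a b = κ * normForm t n c d) : a = 0 ∧ b = 0 ∧ c = 0 ∧ d = 0 := by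
  by_cases h0 : normForm t n c d = 0
  · rw [h0, mul_zero] at h
    obtain ⟨hc, hd⟩ := eq_zero_of_normForm H h0
    obtain ⟨ha, hb⟩ := eq_zero_of_normForm H h
    exact ⟨ha, hb, hc, hd⟩
  · exfalso
    set N := normForm t n c d with hN
    have h1 : normForm t n ((a * (c + t * d) + n * b * d) / N) ((b * c - a * d) / N) = κ := by
      -- Multiplicativity of the norm: the arguments are the coordinates of `(a + bω)` times the
      -- conjugate of `c + dω`. Dividing by `N` exhibits `κ` as the norm of the quotient, whose
      -- coordinates are then integral.
      have : normForm t n (a * (c + t * d) + n * b * d) (b * c - a * d) =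
          normForm t n a b * N := by
        rw [hN]; simp only [normForm]; ring
      have h2 : normForm t n ((a * (c + t * d) + n * b * d) / N) ((b * c - a * d) / N) =
          normForm t n (a * (c + t * d) + n * b * d) (b * c - a * d) / N ^ 2 := by
        simp only [normForm]; field_simp
      rw [h2, this, h]; field_simp
    obtain ⟨hx, hy⟩ := norm_le_one_of_normForm H (by
      rw [h1, ← PadicInt.coe_intCast]; exact (κ : ℤ_[p]).2)
    obtain ⟨X, hX⟩ : ∃ X : ℤ_[p], (X : ℚ_[p]) = (a * (c + t * d) + n * b * d) / N :=
      ⟨⟨_, hx⟩, rfl⟩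
    obtain ⟨Y, hY⟩ : ∃ Y : ℤ_[p], (Y : ℚ_[p]) = (b * c - a * d) / N := ⟨⟨_, hy⟩, rfl⟩
    apply hκ X Y
    apply Subtype.ext
    simp only [normForm] at h1 ⊢
    push_cast
    rw [hX, hY, h1]

lemma int_dvd_iff (a : ℤ) : (p : ℤ_[p]) ∣ a ↔ (p : ℤ) ∣ a := by
  simpa using PadicInt.pow_p_dvd_int_iff 1 a

/-- The inert case. -/
lemma anisotropic_of_inert {t n κ : ℤ}
    (H : ∀ x y : ℤ, (p : ℤ) ∣ normForm t n x y → (p : ℤ) ∣ x ∧ (p : ℤ) ∣ y)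
    (hκ : (p : ℤ) ∣ κ) (hκ2 : ¬ (p : ℤ) ^ 2 ∣ κ) {a b c d : ℚ_[p]}
    (h : normForm t n a b = κ * normForm t n c d) : a = 0 ∧ b = 0 ∧ c = 0 ∧ d = 0 := by
  have H0 : ∀ x y : ℤ_[p], (p : ℤ_[p]) ∣ normForm t n x y →
      (p : ℤ_[p]) ∣ x ∧ (p : ℤ_[p]) ∣ y := by
    intro x y hxy
    obtain ⟨X, x', rfl⟩ := exists_int_approx x 1
    obtain ⟨Y, y', rfl⟩ := exists_int_approx y 1
    rw [pow_one] at hxy ⊢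
    have h1 : (p : ℤ_[p]) ∣ ((normForm t n X Y : ℤ) : ℤ_[p]) := by
      obtain ⟨z, hz⟩ := hxy
      refine ⟨z - (2 * X * x' + p * x' ^ 2 + t * (X * y' + x' * Y + p * x' * y') +
        n * (2 * Y * y' + p * y' ^ 2)), ?_⟩
      simp only [normForm] at hz ⊢
      push_cast
      linear_combination hz
    obtain ⟨hX, hY⟩ := H X Y ((int_dvd_iff _).mp h1)
    exact ⟨dvd_add ((int_dvd_iff _).mpr hX) (dvd_mul_right _ _),
      dvd_add ((int_dvd_iff _).mpr hY) (dvd_mul_right _ _)⟩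
  refine anisotropic_of_not_norm (fun x y hxy => H0 x y ((dvd_pow_self _ two_ne_zero).trans hxy))
    (fun x y hxy => ?_) h
  -- A norm divisible by `p` has both arguments divisible by `p`, so it is divisible by `p²`; `κ` is
  -- not.
  obtain ⟨⟨x', rfl⟩, ⟨y', rfl⟩⟩ := H0 x y (by rw [hxy]; exact (int_dvd_iff _).mpr hκ)
  apply hκ2
  rw [← PadicInt.pow_p_dvd_int_iff, ← hxy]
  exact ⟨normForm t n x' y', by simp only [normForm]; ring⟩

/-- The norm form at a ramified prime, for an Eisenstein generator. -/
lemma dvd_of_normForm_eisenstein {t n : ℤ} (ht : (p : ℤ) ∣ t) (hn : (p : ℤ) ∣ n)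
    (hn2 : ¬ (p : ℤ) ^ 2 ∣ n) (x y : ℤ_[p]) (h : (p : ℤ_[p]) ^ 2 ∣ normForm t n x y) :
    (p : ℤ_[p]) ∣ x ∧ (p : ℤ_[p]) ∣ y := by
  obtain ⟨t', rfl⟩ := ht
  obtain ⟨n', rfl⟩ := hn
  have hprime : Prime (p : ℤ_[p]) := PadicInt.prime_p
  have hx : (p : ℤ_[p]) ∣ x := by
    apply hprime.dvd_of_dvd_pow (n := 2)
    obtain ⟨z, hz⟩ := h
    refine ⟨p * z - t' * x * y - n' * y ^ 2, ?_⟩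
    simp only [normForm] at hz
    push_cast at hz
    linear_combination hz
  refine ⟨hx, ?_⟩
  obtain ⟨x', rfl⟩ := hx
  have h1 : (p : ℤ_[p]) ∣ (n' : ℤ_[p]) * y ^ 2 := by
    obtain ⟨z, hz⟩ := h
    refine ⟨z - x' ^ 2 - t' * x' * y, ?_⟩
    apply mul_left_cancel₀ hprime.ne_zero
    simp only [normForm] at hz
    push_cast at hz
    linear_combination hz
  rcases hprime.dvd_or_dvd h1 with h2 | h2
  · exfalso
    rw [int_dvd_iff] at h2
    obtain ⟨m, rfl⟩ := h2
    exact hn2 ⟨m, by ring⟩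
  · exact hprime.dvd_of_dvd_pow h2

variable {t n u v C : ℤ}

/-- The odd ramified case. -/
lemma not_norm_of_odd (hp2 : p ≠ 2) (ht : (p : ℤ) ∣ t) (hn : (p : ℤ) ∣ n)
    (hn2 : ¬ (p : ℤ) ^ 2 ∣ n) (hu : (p : ℤ) ∣ u)
    (hirr : ∀ g : ℤ, ¬ (p : ℤ) ∣ g ^ 2 + v * g + C) :
    ¬ (p : ℤ) ^ 2 ∣ u ^ 2 + t * u * v + n * v ^ 2 + (t ^ 2 - 4 * n) * C ∧
    ∀ x y : ℤ_[p], normForm t n x y ≠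
      ((u ^ 2 + t * u * v + n * v ^ 2 + (t ^ 2 - 4 * n) * C : ℤ) : ℤ_[p]) := by
  obtain ⟨t', rfl⟩ := ht
  obtain ⟨n', rfl⟩ := hn
  obtain ⟨u', rfl⟩ := hu
  have hpZ : Prime (p : ℤ) := Nat.prime_iff_prime_int.mp hp.out
  have hprime : Prime (p : ℤ_[p]) := PadicInt.prime_p
  have hn' : ¬ (p : ℤ) ∣ n' := by
    rintro ⟨m, rfl⟩
    exact hn2 ⟨m, by ring⟩
  -- Completing the square: `b` inverts `2` modulo `p`, so if `Y² ≡ v² - 4C` then `(Y - v)/2` would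
  -- be a root of `g² + vg + C`.
  have hsq : ∀ Y : ℤ, ¬ (p : ℤ) ∣ Y ^ 2 - v ^ 2 + 4 * C := by
    intro Y hY
    have h2 : IsCoprime (p : ℤ) 2 := by
      rw [Int.isCoprime_iff_gcd_eq_one]
      have := (Nat.coprime_primes hp.out Nat.prime_two).mpr hp2
      exact_mod_cast this
    obtain ⟨a, b, hab⟩ := h2
    apply hirr (b * (Y - v))
    have h4 : (p : ℤ) ∣ 4 * ((b * (Y - v)) ^ 2 + v * (b * (Y - v)) + C) := by
      have e : 4 * ((b * (Y - v)) ^ 2 + v * (b * (Y - v)) + C) =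
          (Y ^ 2 - v ^ 2 + 4 * C) + p * (p * a ^ 2 * (Y - v) ^ 2 - 2 * a * (Y - v) ^ 2
            - 2 * v * (Y - v) * a) := by
        have hb : b * 2 = 1 - a * p := by linarith
        have : 4 * ((b * (Y - v)) ^ 2 + v * (b * (Y - v)) + C) =
          (b * 2) ^ 2 * (Y - v) ^ 2 + 2 * v * (b * 2) * (Y - v) + 4 * C := by ring
        rw [this, hb]; ring
      rw [e]
      exact dvd_add hY (dvd_mul_right _ _)
    rcases hpZ.dvd_or_dvd h4 with h5 | h5
    · exfalso
      have h6 : (p : ℤ) ∣ 2 := by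
        rw [show (4 : ℤ) = 2 * 2 by norm_num] at h5
        exact (hpZ.dvd_or_dvd h5).elim id id
      have h7 : p ∣ 2 := by exact_mod_cast h6
      exact hp2 ((Nat.prime_dvd_prime_iff_eq hp.out Nat.prime_two).mp h7)
    · exact h5
  constructor
  · rintro ⟨m, hm⟩
    -- Modulo `p²` the discriminant is `pn'(v² - 4C)`.
    have h1 : (p : ℤ) ∣ n' * (0 ^ 2 - v ^ 2 + 4 * C) := by
      refine ⟨u' ^ 2 + t' * u' * v + t' ^ 2 * C - m, ?_⟩
      apply mul_left_cancel₀ hpZ.ne_zero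
      linear_combination -hm
    rcases hpZ.dvd_or_dvd h1 with h2 | h2
    · exact hn' h2
    · exact hsq 0 h2
  · intro x y hxy
    have hx : (p : ℤ_[p]) ∣ x := by
      apply hprime.dvd_of_dvd_pow (n := 2)
      refine ⟨p * u' ^ 2 + p * t' * u' * v + n' * v ^ 2 + (p * t' ^ 2 - 4 * n') * C - t' * x * y
        - n' * y ^ 2, ?_⟩
      simp only [normForm] at hxy
      push_cast at hxy
      linear_combination hxy
    obtain ⟨x', rfl⟩ := hx
    obtain ⟨Y, y', rfl⟩ := exists_int_approx y 1
    have h1 : (p : ℤ_[p]) ∣ ((n' * (Y ^ 2 - v ^ 2 + 4 * C) : ℤ) : ℤ_[p]) := by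
      refine ⟨u' ^ 2 + t' * u' * v + t' ^ 2 * C - x' ^ 2 - t' * x' * (Y + p ^ 1 * y')
        - n' * (2 * Y * y' + p * y' ^ 2), ?_⟩
      apply mul_left_cancel₀ hprime.ne_zero
      simp only [normForm] at hxy
      push_cast at hxy ⊢
      linear_combination hxy
    rw [int_dvd_iff] at h1
    rcases hpZ.dvd_or_dvd h1 with h2 | h2
    · exact hn' h2
    · exact hsq Y h2

end Forms

/-- Odd squares agree modulo `8` and `n` is even, so `n(v² - Y²)` is divisible by `16` and drops
out. After dividing the rest by `4`, with `u = 2u'`, `X = 2X'`, `t = 2t'`, the question becomes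
whether `u'² + t'u'v + (t'² - n)C - X'² - t'X'Y` is divisible by `4`. It is odd if `t'` is odd. If
`t'` is even, it is odd when `u'` and `X'` differ in parity and `2` modulo `4` when they agree. -/
lemma int_not_norm_two {t n u v C X Y : ℤ} (ht : (2 : ℤ) ∣ t) (hn : (2 : ℤ) ∣ n)
    (hn2 : ¬ (2 : ℤ) ^ 2 ∣ n) (hu : (2 : ℤ) ∣ u) (hv : ¬ (2 : ℤ) ∣ v) (hC : ¬ (2 : ℤ) ∣ C)
    (hX : (2 : ℤ) ∣ X) (hY : ¬ (2 : ℤ) ∣ Y) :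
    ¬ (2 : ℤ) ^ 4 ∣ u ^ 2 + t * u * v + n * v ^ 2 + (t ^ 2 - 4 * n) * C -
      (X ^ 2 + t * X * Y + n * Y ^ 2) := by
  obtain ⟨t', rfl⟩ := ht
  obtain ⟨u', rfl⟩ := hu
  obtain ⟨X', rfl⟩ := hX
  obtain ⟨n', rfl⟩ : ∃ n', n = 4 * n' + 2 := ⟨n / 4, by omega⟩
  obtain ⟨v', rfl⟩ : ∃ v', v = 2 * v' + 1 := ⟨v / 2, by omega⟩
  obtain ⟨C', rfl⟩ : ∃ C', C = 2 * C' + 1 := ⟨C / 2, by omega⟩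
  obtain ⟨Y', rfl⟩ : ∃ Y', Y = 2 * Y' + 1 := ⟨Y / 2, by omega⟩
  rintro ⟨m, hm⟩
  obtain ⟨w, hw⟩ : ∃ w, v' * (v' + 1) = 2 * w := by
    obtain ⟨w, hw⟩ := Int.even_mul_succ_self v'; exact ⟨w, by rw [hw]; ring⟩
  obtain ⟨w', hw'⟩ : ∃ w', Y' * (Y' + 1) = 2 * w' := by
    obtain ⟨w, hw⟩ := Int.even_mul_succ_self Y'; exact ⟨w, by rw [hw]; ring⟩
  have hm' : u' ^ 2 + t' * u' * (2 * v' + 1) + (t' ^ 2 - (4 * n' + 2)) * (2 * C' + 1) -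
      (X' ^ 2 + t' * X' * (2 * Y' + 1)) = 4 * (m - (2 * n' + 1) * (w - w')) := by
    apply mul_left_cancel₀ (four_ne_zero (α := ℤ))
    linear_combination hm - 4 * (4 * n' + 2) * hw + 4 * (4 * n' + 2) * hw'
  obtain ⟨a, ha⟩ : ∃ a, u' * (u' + 1) = 2 * a := by
    obtain ⟨w, hw⟩ := Int.even_mul_succ_self u'; exact ⟨w, by rw [hw]; ring⟩
  obtain ⟨b, hb⟩ : ∃ b, X' * (X' + 1) = 2 * b := by
    obtain ⟨w, hw⟩ := Int.even_mul_succ_self X'; exact ⟨w, by rw [hw]; ring⟩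
  obtain ⟨r, hr | hr⟩ := Int.even_or_odd' t'
  · subst hr
    obtain ⟨d, hd⟩ : ∃ d, u' - X' = 2 * d := by
      refine ⟨a - b + r * (u' * (2 * v' + 1) - X' * (2 * Y' + 1)) +
        (2 * r ^ 2 - 2 * n' - 1) * (2 * C' + 1) - 2 * (m - (2 * n' + 1) * (w - w')), ?_⟩
      linear_combination ha - hb - hm'
    obtain rfl : u' = X' + 2 * d := by linarith
    have : (2 : ℤ) ∣ 1 := by
      refine ⟨d * X' + d ^ 2 + r * (d + v' * (X' + 2 * d) - Y' * X') +
        (r ^ 2 - n') * (2 * C' + 1) - C' - (m - (2 * n' + 1) * (w - w')), ?_⟩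
      apply mul_left_cancel₀ (two_ne_zero (α := ℤ))
      linear_combination -hm'
    omega
  · subst hr
    have : (2 : ℤ) ∣ 1 := by
      refine ⟨2 * (m - (2 * n' + 1) * (w - w')) - (a + v' * u' + r * u' * (2 * v' + 1) +
        (2 * r ^ 2 + 2 * r - 2 * n' - 1) * (2 * C' + 1) + C' - b - Y' * X' -
        r * X' * (2 * Y' + 1)), ?_⟩
      linear_combination hm' - ha + hb
    omega

/-- The ramified case at `2`. -/
lemma not_norm_of_two [Fact (Nat.Prime 2)] {t n u v C : ℤ} (ht : (2 : ℤ) ∣ t) (hn : (2 : ℤ) ∣ n)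
    (hn2 : ¬ (2 : ℤ) ^ 2 ∣ n) (hu : (2 : ℤ) ∣ u)
    (hirr : ∀ g : ℤ, ¬ (2 : ℤ) ∣ g ^ 2 + v * g + C) :
    ¬ (2 : ℤ) ^ 2 ∣ u ^ 2 + t * u * v + n * v ^ 2 + (t ^ 2 - 4 * n) * C ∧
    ∀ x y : ℤ_[2], normForm t n x y ≠
      ((u ^ 2 + t * u * v + n * v ^ 2 + (t ^ 2 - 4 * n) * C : ℤ) : ℤ_[2]) := by
  -- The only quadratic without a root modulo `2` is `g² + g + 1`, so `C` and `v` are odd.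
  have hC : ¬ (2 : ℤ) ∣ C := by simpa using hirr 0
  have hv : ¬ (2 : ℤ) ∣ v := by
    have := hirr 1
    intro hv
    apply this
    omega
  have h4 : ¬ (2 : ℤ) ^ 2 ∣ u ^ 2 + t * u * v + n * v ^ 2 + (t ^ 2 - 4 * n) * C := by
    intro h
    apply hn2
    obtain ⟨t', rfl⟩ := ht
    obtain ⟨u', rfl⟩ := hu
    obtain ⟨v', rfl⟩ : ∃ v', v = 2 * v' + 1 := ⟨v / 2, by omega⟩
    obtain ⟨m, hm⟩ := h
    exact ⟨m - u' ^ 2 - t' * u' * (2 * v' + 1) - n * (v' ^ 2 + v') - (t' ^ 2 - n) * C,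
      by linear_combination hm⟩
  refine ⟨h4, fun x y hxy => ?_⟩
  have hprime : Prime ((2 : ℕ) : ℤ_[2]) := PadicInt.prime_p
  -- The obstruction is visible modulo `16`, hence the approximation to order `2⁴`.
  obtain ⟨X, x', rfl⟩ := exists_int_approx x 4
  obtain ⟨Y, y', rfl⟩ := exists_int_approx y 4
  have h16 : (2 : ℤ) ^ 4 ∣ u ^ 2 + t * u * v + n * v ^ 2 + (t ^ 2 - 4 * n) * C -
      (X ^ 2 + t * X * Y + n * Y ^ 2) := by
    have := (PadicInt.pow_p_dvd_int_iff (p := 2) 4 (u ^ 2 + t * u * v + n * v ^ 2 +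
      (t ^ 2 - 4 * n) * C - (X ^ 2 + t * X * Y + n * Y ^ 2))).mp ?_
    · exact_mod_cast this
    · refine ⟨2 * X * x' + 2 ^ 4 * x' ^ 2 + t * (X * y' + x' * Y + 2 ^ 4 * x' * y') +
        n * (2 * Y * y' + 2 ^ 4 * y' ^ 2), ?_⟩
      simp only [normForm] at hxy
      push_cast at hxy ⊢
      linear_combination -hxy
  have hX : (2 : ℤ) ∣ X := by
    apply Int.prime_two.dvd_of_dvd_pow (n := 2)
    obtain ⟨m, hm⟩ := h16
    obtain ⟨t', rfl⟩ := ht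
    obtain ⟨n', rfl⟩ := hn
    obtain ⟨u', rfl⟩ := hu
    refine ⟨2 * u' ^ 2 + 2 * t' * u' * v + n' * v ^ 2 + (2 * t' ^ 2 - 4 * n') * C - 2 ^ 3 * m -
      t' * X * Y - n' * Y ^ 2, ?_⟩
    linear_combination -hm
  have hY : ¬ (2 : ℤ) ∣ Y := by
    rintro ⟨Y', rfl⟩
    apply h4
    obtain ⟨X', rfl⟩ := hX
    obtain ⟨m, hm⟩ := h16
    exact ⟨4 * m + X' ^ 2 + t * X' * Y' + n * Y' ^ 2, by linear_combination hm⟩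
  exact int_not_norm_two ht hn hn2 hu hv hC hX hY h16

/-- At an Eisenstein prime where `X² + vX + C` has no root, the discriminant has valuation one and
the associated form is anisotropic. -/
theorem anisotropic_of_eisenstein {p : ℕ} [hp : Fact p.Prime] {t n u v C : ℤ}
    (ht : (p : ℤ) ∣ t) (hn : (p : ℤ) ∣ n) (hn2 : ¬ (p : ℤ) ^ 2 ∣ n) (hu : (p : ℤ) ∣ u)
    (hirr : ∀ g : ℤ, ¬ (p : ℤ) ∣ g ^ 2 + v * g + C) :
    ¬ (p : ℤ) ^ 2 ∣ u ^ 2 + t * u * v + n * v ^ 2 + (t ^ 2 - 4 * n) * C ∧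
    ∀ a b c d : ℚ_[p], normForm t n a b =
      ((u ^ 2 + t * u * v + n * v ^ 2 + (t ^ 2 - 4 * n) * C : ℤ) : ℚ_[p]) * normForm t n c d →
      a = 0 ∧ b = 0 ∧ c = 0 ∧ d = 0 := by
  have key : ¬ (p : ℤ) ^ 2 ∣ u ^ 2 + t * u * v + n * v ^ 2 + (t ^ 2 - 4 * n) * C ∧
    ∀ x y : ℤ_[p], normForm t n x y ≠
      ((u ^ 2 + t * u * v + n * v ^ 2 + (t ^ 2 - 4 * n) * C : ℤ) : ℤ_[p]) := by
    by_cases h2 : p = 2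
    · subst h2
      exact not_norm_of_two (by exact_mod_cast ht) (by exact_mod_cast hn) (by exact_mod_cast hn2)
        (by exact_mod_cast hu) (by exact_mod_cast hirr)
    · exact not_norm_of_odd h2 ht hn hn2 hu hirr
  refine ⟨key.1, fun a b c d h => ?_⟩
  exact anisotropic_of_not_norm (dvd_of_normForm_eisenstein ht hn hn2) key.2 h

/-! ### Local analysis of pairs -/

namespace QuadBasis

variable {k : Type*} [Field k] [NumberField k] {σ : k ≃ₐ[ℚ] k} (q : QuadBasis σ)

lemma norm_repr_int (u v : ℤ) :
    Algebra.norm ℚ ((u : k) + v * q.ω) = (normForm q.t q.n u v : ℤ) := by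
  have := q.norm_repr u v
  push_cast at this
  rw [this]
  simp [normForm]

lemma disc_mul_norm {lam : k} {u v : ℤ} (h : q.s * lam = u + v * q.ω) :
    (q.disc : ℚ) * Algebra.norm ℚ lam = -(normForm q.t q.n u v : ℤ) := by
  rw [← q.norm_repr_int, ← h, map_mul, q.norm_s]; ring

lemma trace_eq {lam : k} {u v : ℤ} (h : q.s * lam = u + v * q.ω) : lam + σ lam = v := by
  have h1 := congrArg σ h
  simp only [map_mul, q.conj_s, map_add, map_intCast, q.conj] at h1
  apply mul_left_cancel₀ q.s_ne_zero
  simp only [s] at h h1 ⊢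
  linear_combination h - h1

lemma norm_add_int {lam : k} {u v : ℤ} (h : q.s * lam = u + v * q.ω) (m : ℤ) :
    Algebra.norm ℚ (lam + m) = Algebra.norm ℚ lam + v * m + m ^ 2 := by
  have : ((Algebra.norm ℚ (lam + m) : ℚ) : k) =
      ((Algebra.norm ℚ lam + v * m + m ^ 2 : ℚ) : k) := by
    push_cast
    rw [q.norm_eq, q.norm_eq, map_add, map_intCast, ← q.trace_eq h]
    ring
  exact_mod_cast this

lemma ωInt_sq : q.ωInt ^ 2 = q.t * q.ωInt - q.n := by
  apply NumberField.RingOfIntegers.ext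
  simpa using q.sq

lemma repr_unique_ωInt {u v u' v' : ℤ} (h : (u : 𝓞 k) + v * q.ωInt = u' + v' * q.ωInt) :
    u = u' ∧ v = v' := by
  have := congrArg (algebraMap (𝓞 k) k) h
  exact q.repr_unique_int (by simpa using this)

lemma dvd_of_natCast_dvd {p : ℕ} {u v : ℤ} (h : (p : 𝓞 k) ∣ u + v * q.ωInt) :
    (p : ℤ) ∣ u ∧ (p : ℤ) ∣ v := by
  obtain ⟨x, hx⟩ := h
  obtain ⟨a, b, rfl⟩ := q.exists_int_repr x
  obtain ⟨h1, h2⟩ := q.repr_unique_ωInt (u := u) (v := v) (u' := p * a) (v' := p * b) (by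
    rw [hx]; push_cast; ring)
  exact ⟨⟨a, h1⟩, ⟨b, h2⟩⟩

/-- If `(p)` is prime and divides `(x + yω)(x + yt - yω)`, it divides one of the factors, and `p`
can then be read off from the coordinates. -/
lemma dvd_of_dvd_normForm {p : ℕ} (hP : (Ideal.span {(p : 𝓞 k)}).IsPrime) (x y : ℤ)
    (h : (p : ℤ) ∣ normForm q.t q.n x y) : (p : ℤ) ∣ x ∧ (p : ℤ) ∣ y := by
  obtain ⟨z, hz⟩ := h
  have h1 : ((x : 𝓞 k) + y * q.ωInt) * (((x + y * q.t : ℤ) : 𝓞 k) + ((-y : ℤ) : 𝓞 k) * q.ωInt) ∈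
      Ideal.span {(p : 𝓞 k)} := by
    rw [Ideal.mem_span_singleton]
    refine ⟨z, ?_⟩
    have hz' := congrArg (Int.cast : ℤ → 𝓞 k) hz
    simp only [normForm] at hz'
    push_cast at hz' ⊢
    rw [← hz']
    linear_combination -(y : 𝓞 k) ^ 2 * q.ωInt_sq
  rcases hP.mem_or_mem h1 with h2 | h2
  · exact q.dvd_of_natCast_dvd (Ideal.mem_span_singleton.mp h2)
  · obtain ⟨h3, h4⟩ := q.dvd_of_natCast_dvd (Ideal.mem_span_singleton.mp h2)
    have h5 : (p : ℤ) ∣ y := by simpa using h4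
    exact ⟨by simpa using dvd_sub h3 (h5.mul_right q.t), h5⟩

-- Otherwise `ω/p` would be a root of a monic integral quadratic, yet `ω/p` is not in `O_k = ℤ +
-- ℤω`. So at a ramified prime a generator with `p ∣ t, n` is automatically Eisenstein.
open Polynomial in
lemma not_sq_dvd_n {p : ℕ} (hp : p.Prime) (ht : (p : ℤ) ∣ q.t) : ¬ (p : ℤ) ^ 2 ∣ q.n := by
  rintro ⟨n', hn'⟩
  obtain ⟨t', ht'⟩ := ht
  have hpk : (p : k) ≠ 0 := by exact_mod_cast hp.ne_zero
  have hint : IsIntegral ℤ (q.ω / p) := by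
    refine ⟨X ^ 2 - (C t' : ℤ[X]) * X + (C n' : ℤ[X]), by monicity!, ?_⟩
    have hsq := q.sq
    rw [ht', hn'] at hsq
    push_cast at hsq
    simp only [eval₂_add, eval₂_sub, eval₂_mul, eval₂_pow, eval₂_X]
    rw [eval₂_C, eval₂_C, eq_intCast, eq_intCast]
    field_simp
    linear_combination hsq
  obtain ⟨u, v, huv⟩ := (q.isIntegral_iff _).mp hint
  rw [div_eq_iff hpk] at huv
  obtain ⟨-, h2⟩ := q.repr_unique_int (u := 0) (v := 1) (u' := p * u) (v' := p * v) (by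
    push_cast; linear_combination huv)
  have := Int.isUnit_iff.mp (IsUnit.of_mul_eq_one _ h2.symm)
  have := hp.two_le
  omega

/-- As `p` divides the discriminant, `X² - tX + n` has a double root modulo `p`, and the shift moves
it to `0`. For odd `p` the root is `t/2`; for `p = 2` it is `0` or `1` according to the parity of
`n`. -/
lemma exists_eisenstein_shift {p : ℕ} (hp : p.Prime) (hd : (p : ℤ) ∣ q.disc) :
    ∃ c : ℤ, (p : ℤ) ∣ (q.shift c).t ∧ (p : ℤ) ∣ (q.shift c).n := by
  simp only [shift, disc] at hd ⊢
  have hpZ : Prime (p : ℤ) := Nat.prime_iff_prime_int.mp hp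
  by_cases h2 : p = 2
  · subst h2
    have ht : (2 : ℤ) ∣ q.t := by
      apply Int.prime_two.dvd_of_dvd_pow (n := 2)
      obtain ⟨m, hm⟩ := hd
      exact ⟨m + 2 * q.n, by push_cast at hm; linear_combination hm⟩
    obtain ⟨t', ht'⟩ := ht
    by_cases hn : (2 : ℤ) ∣ q.n
    · exact ⟨0, ⟨t', by rw [ht']; push_cast; ring⟩, by simpa using hn⟩
    · refine ⟨1, ⟨t' + 1, by rw [ht']; push_cast; ring⟩, ?_⟩
      rw [ht']
      push_cast
      omega
  · have hcop : IsCoprime (p : ℤ) 2 := by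
      rw [Int.isCoprime_iff_gcd_eq_one]
      have := (Nat.coprime_primes hp Nat.prime_two).mpr h2
      exact_mod_cast this
    obtain ⟨a, b, hab⟩ := hcop
    have h1 : (p : ℤ) ∣ q.t + 2 * (-b * q.t) := ⟨a * q.t, by linear_combination -q.t * hab⟩
    refine ⟨-b * q.t, h1, ?_⟩
    have h4 : (p : ℤ) ∣ 2 * (2 * (q.n + -b * q.t * q.t + (-b * q.t) ^ 2)) := by
      have : 2 * (2 * (q.n + -b * q.t * q.t + (-b * q.t) ^ 2)) =
        (q.t + 2 * (-b * q.t)) ^ 2 - (q.t ^ 2 - 4 * q.n) := by ring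
      rw [this]
      exact dvd_sub (h1.pow two_ne_zero) hd
    have hcop : IsCoprime (p : ℤ) 2 := ⟨a, b, hab⟩
    exact hcop.dvd_of_dvd_mul_left (hcop.dvd_of_dvd_mul_left h4)

lemma IsPreadmissible.shift {q : QuadBasis σ} {κ : ℚ} {a : FracIdeal k} {lam : k} (c : ℤ) :
    (q.shift c).IsPreadmissible κ a lam ↔ q.IsPreadmissible κ a lam := by
  constructor
  · rintro ⟨h1, h2, h3⟩; exact ⟨h1, by rwa [shift_s] at h2, h3⟩
  · rintro ⟨h1, h2, h3⟩; exact ⟨h1, by rwa [shift_s], h3⟩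

end QuadBasis

namespace QuatData

variable {k : Type*} [Field k] [NumberField k] {σ : k ≃ₐ[ℚ] k}
  {B : Type*} [Ring B] [Algebra ℚ B] (Q : QuatData σ B)

/-- Changing the generator of the ring of integers. -/
@[simps]
noncomputable def shift (c : ℤ) : QuatData σ B where
  q := Q.q.shift c
  i := Q.i
  δ := Q.δ
  κ := Q.κ
  κ_ne := Q.κ_ne
  δ_sq := Q.δ_sq
  δ_comm := Q.δ_comm
  finrank_eq := Q.finrank_eq

/-- The arguments on the left are the coordinates of `s(a + bω)`, and `N(s) = -disc`. -/
lemma mul_s_normForm {R : Type*} [CommRing R] (t n : ℤ) (a b : R) :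
    normForm t n (-t * a - 2 * n * b) (2 * a + t * b) =
      -((t ^ 2 - 4 * n : ℤ) : R) * normForm t n a b := by
  simp only [normForm]; push_cast; ring

lemma mul_s_eq_zero {F : Type*} [Field F] {t n : ℤ} (hd : ((t ^ 2 - 4 * n : ℤ) : F) ≠ 0) {a b : F}
    (h1 : -t * a - 2 * n * b = 0) (h2 : 2 * a + t * b = 0) : a = 0 ∧ b = 0 := by
  push_cast at hd
  constructor
  · refine (mul_eq_zero.mp ?_).resolve_left hd
    linear_combination -t * h1 - 2 * n * h2
  · refine (mul_eq_zero.mp ?_).resolve_left hd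
    linear_combination t * h2 + 2 * h1

/-- Here `κ' = N(s)κ`, so replacing `δ` by `sδ` leaves the algebra unchanged. Multiplying `a + bω`
by `s` turns a zero for `κ` into one for the integer `κ'`. -/
lemma isRamifiedAt_of_anisotropic {p : ℕ} [hp : Fact p.Prime] {κ' : ℤ}
    (hκ' : (κ' : ℚ) = -Q.q.disc * Q.κ)
    (h : ∀ a b c d : ℚ_[p], normForm Q.q.t Q.q.n a b = (κ' : ℚ_[p]) * normForm Q.q.t Q.q.n c d →
      a = 0 ∧ b = 0 ∧ c = 0 ∧ d = 0) : IsRamifiedAt B p := by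
  refine ⟨hp.out, Q.division fun a b c d habcd => ?_⟩
  have hκF : (κ' : ℚ_[p]) = -(Q.q.disc : ℚ_[p]) * algebraMap ℚ ℚ_[p] Q.κ := by
    have := congrArg (algebraMap ℚ ℚ_[p]) hκ'
    simpa using this
  have hd : ((Q.q.t ^ 2 - 4 * Q.q.n : ℤ) : ℚ_[p]) ≠ 0 := by exact_mod_cast Q.q.disc_ne_zero
  obtain ⟨h1, h2, h3, h4⟩ := h _ _ c d (show normForm Q.q.t Q.q.n
      (-Q.q.t * a - 2 * Q.q.n * b) (2 * a + Q.q.t * b) = _ by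
    rw [mul_s_normForm, habcd, hκF, QuadBasis.disc]; ring)
  obtain ⟨ha, hb⟩ := mul_s_eq_zero hd h1 h2
  exact ⟨ha, hb, h3, h4⟩

/-- If `B` is ramified at `p`, the discriminant of the order attached to a pair is divisible
by `p`. -/
lemma dvd_of_isRamifiedAt {p : ℕ} {u v C κ' : ℤ}
    (hκ' : (κ' : ℚ) = -Q.q.disc * Q.κ)
    (hC : κ' = normForm Q.q.t Q.q.n u v + Q.q.disc * C) (hram : IsRamifiedAt B p) :
    (p : ℤ) ∣ κ' := by
  obtain ⟨hp, hdiv⟩ := hram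
  have hpf : Fact p.Prime := ⟨hp⟩
  by_contra hcon
  have hκF : (κ' : ℚ_[p]) = -(Q.q.disc : ℚ_[p]) * algebraMap ℚ ℚ_[p] Q.κ := by
    have := congrArg (algebraMap ℚ ℚ_[p]) hκ'
    simpa using this
  have hd : ((Q.q.t ^ 2 - 4 * Q.q.n : ℤ) : ℚ_[p]) ≠ 0 := by exact_mod_cast Q.q.disc_ne_zero
  rw [hC] at hcon
  obtain ⟨c₀, c₁, b₀, b₁, hne, hz⟩ := exists_pairForm_zero (p := p) hcon
  have hz' : pairForm Q.q.t Q.q.n u v C (c₀ : ℚ_[p]) c₁ b₀ b₁ = 0 := by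
    have := congrArg (fun y : ℤ_[p] => (y : ℚ_[p])) hz
    simp only [pairForm] at this ⊢
    push_cast at this
    exact this
  set t := Q.q.t
  set n := Q.q.n
  -- The zero of `pairForm` is a lattice element `(c - λb) + bδ` of reduced norm zero. The witnesses
  -- are the coordinates of `s(c - λb) = sc - (u + vω)b` and of `sb`, which avoids dividing by `s`.
  refine Q.not_division (F := ℚ_[p])
    (a := -t * c₀ - 2 * n * c₁ - (u * b₀ - n * v * b₁))
    (b := 2 * c₀ + t * c₁ - (u * b₁ + v * b₀ + t * v * b₁))
    (c := -t * b₀ - 2 * n * b₁) (d := 2 * b₀ + t * b₁) ?_ ?_ hdiv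
  · rw [mul_s_normForm]
    have hC' : (κ' : ℚ_[p]) = normForm t n u v + Q.q.disc * C := by
      rw [hC]; simp [normForm, t, n]
    have h1 : -((t ^ 2 - 4 * n : ℤ) : ℚ_[p]) * normForm t n (b₀ : ℚ_[p]) b₁ *
        algebraMap ℚ ℚ_[p] Q.κ = κ' * normForm t n (b₀ : ℚ_[p]) b₁ := by
      rw [hκF, QuadBasis.disc]; ring
    rw [mul_comm (algebraMap ℚ ℚ_[p] Q.κ), h1, hC', QuadBasis.disc]
    simp only [normForm, pairForm] at hz' ⊢
    push_cast
    linear_combination -(t ^ 2 - 4 * n : ℚ_[p]) * hz'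
  · rintro ⟨h1, h2, h3, h4⟩
    obtain ⟨hb0, hb1⟩ := mul_s_eq_zero hd h3 h4
    rw [hb0, hb1] at h1 h2
    obtain ⟨hc0, hc1⟩ := mul_s_eq_zero hd (a := (c₀ : ℚ_[p])) (b := (c₁ : ℚ_[p]))
      (by linear_combination h1) (by linear_combination h2)
    exact hne ⟨Subtype.ext hc0, Subtype.ext hc1, Subtype.ext hb0, Subtype.ext hb1⟩

end QuatData

/-! ### Enlarging an order at a prime -/

section Enlarge

variable {k : Type*} [Field k] [NumberField k] {σ : k ≃ₐ[ℚ] k}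
  {B : Type*} [Ring B] [Algebra ℚ B] (Q : QuatData σ B)

lemma coe_mem_coeIdeal {P : Ideal (𝓞 k)} {x : 𝓞 k} : (x : k) ∈ (P : FracIdeal k) ↔ x ∈ P := by
  rw [FractionalIdeal.mem_coeIdeal]
  constructor
  · rintro ⟨y, hy, hxy⟩
    rwa [← NumberField.RingOfIntegers.ext hxy]
  · intro h; exact ⟨x, h, rfl⟩

/-- From `M ∈ 𝔞` it follows that `M² ∈ 𝔞𝔞̄ = (N(𝔞))`, so `N(𝔞)` divides `M²`. -/
lemma absNorm_of_le_one {a : FracIdeal k} (ha : a ≤ 1) (ha0 : a ≠ 0) (q : QuadBasis σ) {p : ℕ}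
    (hp : p.Prime) {M : ℤ} (hM : (M : k) ∈ a) (hpM : ¬ (p : ℤ) ∣ M) :
    ∃ m : ℤ, FractionalIdeal.absNorm a = m ∧ ¬ (p : ℤ) ∣ m := by
  obtain ⟨J, rfl⟩ := FractionalIdeal.le_one_iff_exists_coeIdeal.mp ha
  refine ⟨Ideal.absNorm J, by rw [FractionalIdeal.coeIdeal_absNorm]; simp, fun hdvd => ?_⟩
  have h1 : (((M ^ 2 : ℤ) : ℚ) : k) ∈ (J : FracIdeal k) * conjIdeal σ J := by
    have := mem_mul_of_mem hM (conj_mem_conjIdeal (σ := σ) hM)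
    rw [map_intCast] at this
    convert this using 1
    push_cast; ring
  rw [q.mul_conj, rat_mem_principal_iff (absNorm_pos ha0).ne',
    FractionalIdeal.coeIdeal_absNorm] at h1
  obtain ⟨j, hj⟩ := h1
  have h2 : M ^ 2 = j * Ideal.absNorm J := by exact_mod_cast hj
  have hpZ : Prime (p : ℤ) := Nat.prime_iff_prime_int.mp hp
  exact hpM (hpZ.dvd_of_dvd_pow (h2 ▸ hdvd.mul_left j))

/-- The ideals `𝔞` and `P` are coprime, so their intersection is their product: write `1 = xp + yM`
and multiply by `w`. -/
lemma mem_mul_coeIdeal {a : FracIdeal k} {P : Ideal (𝓞 k)} {p : ℕ} (hp : p.Prime)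
    (hpP : (p : 𝓞 k) ∈ P) {M : ℤ} (hM : (M : k) ∈ a) (hpM : ¬ (p : ℤ) ∣ M) {w : k} (hw : w ∈ a)
    (hwP : w ∈ (P : FracIdeal k)) : w ∈ a * (P : FracIdeal k) := by
  obtain ⟨x, y, hxy⟩ := ((Nat.prime_iff_prime_int.mp hp).coprime_iff_not_dvd).mpr hpM
  have hpk : (p : k) ∈ (P : FracIdeal k) := by
    have := coe_mem_coeIdeal.mpr hpP
    simpa using this
  have h1 := int_mul_mem x (mem_mul_of_mem hw hpk)
  have h2 := int_mul_mem y (mem_mul_of_mem hM hwP)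
  have hxy' : (x : k) * p + y * M = 1 := by exact_mod_cast hxy
  have := frac_add_mem h1 h2
  convert this using 1
  linear_combination -w * hxy'

/-- A criterion for a pair to be refined at a prime ideal. -/
lemma isPreadmissible_mul {q : QuadBasis σ} {κ : ℚ} {a : FracIdeal k} {lam lam' : k}
    (h : q.IsPreadmissible κ a lam) (ha : a ≤ 1) {p : ℕ} (hp : p.Prime) {M : ℤ}
    (hM : (M : k) ∈ a) (hpM : ¬ (p : ℤ) ∣ M) {P : Ideal (𝓞 k)} (hP0 : P ≠ ⊥)
    (hpP : (p : 𝓞 k) ∈ P) {r : ℕ} (hNP : Ideal.absNorm P = p ^ r) (hlam : lam' - lam ∈ a)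
    (hP : q.s * lam' ∈ (P : FracIdeal k)) {C d : ℤ} (hd : ¬ (p : ℤ) ∣ d)
    (hC : d * (Algebra.norm ℚ lam' - κ) = C) (hrC : (p : ℤ) ^ r ∣ C) :
    q.IsPreadmissible κ (a * P) lam' := by
  have h' := h.congr hlam
  refine ⟨mul_ne_zero h.ne_zero (by simpa using hP0),
    mem_mul_coeIdeal hp hpP hM hpM h'.s_mul_mem hP, ?_⟩
  obtain ⟨m, hm, hpm⟩ := absNorm_of_le_one ha h.ne_zero q hp hM hpM
  obtain ⟨n, hn⟩ := h'.norm_congr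
  rw [map_mul, hm, FractionalIdeal.coeIdeal_absNorm, hNP]
  rw [hm] at hn
  rw [hn] at hC
  have hC' : d * (n * m) = C := by exact_mod_cast hC
  have hpZ : Prime (p : ℤ) := Nat.prime_iff_prime_int.mp hp
  have h1 : (p : ℤ) ^ r ∣ n := by
    rw [← hC'] at hrC
    have c1 : IsCoprime ((p : ℤ) ^ r) d := ((hpZ.coprime_iff_not_dvd).mpr hd).pow_left
    have c2 : IsCoprime ((p : ℤ) ^ r) m := ((hpZ.coprime_iff_not_dvd).mpr hpm).pow_left
    exact c2.dvd_of_dvd_mul_right (c1.dvd_of_dvd_mul_left hrC)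
  obtain ⟨n', rfl⟩ := h1
  exact ⟨n', by rw [hn]; push_cast; ring⟩

/-- A pair whose discriminant is too divisible by `p` can be refined (normalized case). -/
theorem exists_refinement_of_le_one {a : FracIdeal k} {lam : k}
    (h : Q.IsPreadmissible a lam) (ha : a ≤ 1) {p : ℕ} (hp : p.Prime) {M : ℤ}
    (hM : (M : k) ∈ a) (hpM : ¬ (p : ℤ) ∣ M) {κ' : ℤ} (hκ' : (κ' : ℚ) = -Q.q.disc * Q.κ)
    (h1 : (p : ℤ) ∣ κ') (h2 : IsRamifiedAt B p → (p : ℤ) ^ 2 ∣ κ') :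
    ∃ (a' : FracIdeal k) (lam' : k), Q.IsPreadmissible a' lam' ∧ a' ≤ a ∧ a' ≠ a ∧
      lam' - lam ∈ a := by
  have hpf : Fact p.Prime := ⟨hp⟩
  have hpZ : Prime (p : ℤ) := Nat.prime_iff_prime_int.mp hp
  have hfin : Module.finrank ℤ (𝓞 k) = 2 := by
    rw [NumberField.RingOfIntegers.rank, Q.finrank_k]
  obtain ⟨P, hPmax, hpP⟩ : ∃ P : Ideal (𝓞 k), P.IsMaximal ∧ (p : 𝓞 k) ∈ P := by
    have hne : Ideal.span {(p : 𝓞 k)} ≠ ⊤ := by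
      intro htop
      have := Ideal.absNorm_span_natCast (S := 𝓞 k) p
      rw [htop, Ideal.absNorm_top, hfin] at this
      have := hp.two_le
      nlinarith
    obtain ⟨P, hP, hle⟩ := Ideal.exists_le_maximal _ hne
    exact ⟨P, hP, hle (Ideal.mem_span_singleton_self _)⟩
  have hP0 : P ≠ ⊥ := by
    rintro rfl
    have : (p : 𝓞 k) = 0 := hpP
    exact hp.ne_zero (by exact_mod_cast this)
  have hstrict : ∀ {lam' : k}, Q.IsPreadmissible (a * P) lam' → lam' - lam ∈ a →
      ∃ (a' : FracIdeal k) (lam' : k), Q.IsPreadmissible a' lam' ∧ a' ≤ a ∧ a' ≠ a ∧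
        lam' - lam ∈ a := by
    intro lam' hpre hl
    refine ⟨a * P, lam', hpre, ?_, ?_, hl⟩
    · calc a * P ≤ a * 1 := mul_le_mul_right FractionalIdeal.coeIdeal_le_one a
        _ = a := mul_one a
    · intro heq
      have h3 : (P : FracIdeal k) = 1 := by
        apply mul_left_cancel₀ h.ne_zero
        rw [heq, mul_one]
      apply hPmax.ne_top
      refine FractionalIdeal.coeIdeal_injective (K := k) ?_
      change (P : FracIdeal k) = ((⊤ : Ideal (𝓞 k)) : FracIdeal k)
      rw [h3, FractionalIdeal.coeIdeal_top]
  have hzint : IsIntegral ℤ (Q.q.s * lam) := mem_one_iff_isIntegral.mp (ha h.s_mul_mem)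
  -- At a ramified prime work with an Eisenstein generator, for which `P = (p, ω)` has norm `p`.
  -- Elsewhere `disc` is invertible modulo `p`.
  by_cases hdisc : (p : ℤ) ∣ Q.q.disc
  · obtain ⟨c, hct, hcn⟩ := Q.q.exists_eisenstein_shift hp hdisc
    obtain ⟨q, hq⟩ : ∃ q, q = Q.q.shift c := ⟨_, rfl⟩
    rw [← hq] at hct hcn
    have hqs : q.s = Q.q.s := by rw [hq, QuadBasis.shift_s]
    have hqd : q.disc = Q.q.disc := by rw [hq, QuadBasis.shift_disc]
    have hn2 := q.not_sq_dvd_n hp hct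
    have hωP : q.ωInt ∈ P := by
      apply hPmax.isPrime.mem_of_pow_mem 2
      obtain ⟨t', ht'⟩ := hct
      obtain ⟨n', hn'⟩ := hcn
      rw [q.ωInt_sq, ht', hn']
      have := P.mul_mem_left (t' * q.ωInt - n') hpP
      convert this using 1
      push_cast; ring
    have hNP : Ideal.absNorm P = p ^ 1 := by
      rw [pow_one]
      refine (q.absNorm_prime hPmax.ne_top hp hpP).resolve_left fun hPp => ?_
      rw [hPp, Ideal.mem_span_singleton] at hωP
      have := (q.dvd_of_natCast_dvd (u := 0) (v := 1) (by simpa using hωP)).2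
      exact hpZ.not_isUnit (isUnit_of_dvd_one this)
    obtain ⟨u, v, huv⟩ := (q.isIntegral_iff _).mp hzint
    obtain ⟨n₀, hn₀⟩ := h.norm_congr
    obtain ⟨m, hm, hpm⟩ := absNorm_of_le_one ha h.ne_zero q hp hM hpM
    rw [hm] at hn₀
    obtain ⟨C, hC⟩ : ∃ C : ℤ, C = n₀ * m := ⟨_, rfl⟩
    have hnC : Algebra.norm ℚ lam - Q.κ = C := by rw [hn₀, hC]; push_cast; ring
    have hdn := q.disc_mul_norm (lam := lam) (u := u) (v := v) (by rw [hqs, huv])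
    have hκC : κ' = normForm q.t q.n u v + q.disc * C := by
      have : (κ' : ℚ) = ((normForm q.t q.n u v + q.disc * C : ℤ) : ℚ) := by
        rw [hκ', ← hqd]
        push_cast
        rw [← hnC]
        linear_combination -hdn
      exact_mod_cast this
    have hqdisc : (p : ℤ) ∣ q.disc := by rwa [hqd]
    have hu : (p : ℤ) ∣ u := by
      apply hpZ.dvd_of_dvd_pow (n := 2)
      have : u ^ 2 = κ' - q.disc * C - q.t * (u * v) - q.n * v ^ 2 := by
        rw [hκC]; simp only [normForm]; push_cast; ring
      rw [this]
      exact ((h1.sub (hqdisc.mul_right _)).sub (hct.mul_right _)).sub (hcn.mul_right _)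
    by_cases hroot : ∃ g : ℤ, (p : ℤ) ∣ g ^ 2 + v * g + C
    · obtain ⟨g, hg⟩ := hroot
      obtain ⟨x, y, hxy⟩ := (hpZ.coprime_iff_not_dvd).mpr hpM
      -- Replacing `λ` by `λ + e` changes `C = N(λ) - κ` into `e² + ve + C`. As `yM ≡ 1` modulo `p`,
      -- this `e` lies in `𝔞` and is congruent to the root `g`.
      obtain ⟨e, he⟩ : ∃ e : ℤ, e = y * g * M := ⟨_, rfl⟩
      have hea : (e : k) ∈ a := by
        rw [he]; push_cast
        have := int_mul_mem (y * g) hM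
        push_cast at this
        exact this
      have hep : (p : ℤ) ∣ e ^ 2 + v * e + C := by
        have : e ^ 2 + v * e + C = (g ^ 2 + v * g + C) + p * (-x * g * (e + g + v)) := by
          have he' : e = g - x * p * g := by rw [he]; linear_combination g * hxy
          linear_combination (e + g + v) * he'
        rw [this]
        exact dvd_add hg (dvd_mul_right _ _)
      refine hstrict (lam' := lam + e) ?_ (by simpa using hea)
      refine isPreadmissible_mul h ha hp hM hpM hP0 hpP hNP (by simpa using hea) ?_
        (C := e ^ 2 + v * e + C) (d := 1) (fun hd => hpZ.not_isUnit (isUnit_of_dvd_one hd)) ?_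
        (by rwa [pow_one])
      · have : Q.q.s * (lam + e) =
            ((u + v * q.ωInt + (2 * q.ωInt - q.t) * e : 𝓞 k) : k) := by
          rw [mul_add, huv, ← hqs]
          simp [QuadBasis.s]
          exact Or.inl (Or.inl (map_ofNat _ 2).symm)
        rw [this]
        refine coe_mem_coeIdeal.mpr ?_
        have hI : ∀ m : ℤ, (p : ℤ) ∣ m → (m : 𝓞 k) ∈ P := by
          rintro _ ⟨m, rfl⟩
          push_cast
          exact P.mul_mem_right _ hpP
        exact P.add_mem (P.add_mem (hI u hu) (P.mul_mem_left _ hωP))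
          (P.mul_mem_right _ (P.sub_mem (P.mul_mem_left _ hωP) (hI _ hct)))
      · rw [q.norm_add_int (by rw [hqs, huv])]
        push_cast
        linear_combination hnC
    -- With no root modulo `p`, the norm form is anisotropic and `p²` does not divide `κ'`; so `B`
    -- ramifies at `p` and `h2` is contradicted.
    · exfalso
      push Not at hroot
      have key := anisotropic_of_eisenstein hct hcn hn2 hu hroot
      have hκ'' : κ' = u ^ 2 + q.t * u * v + q.n * v ^ 2 + (q.t ^ 2 - 4 * q.n) * C := by
        rw [hκC]; simp [normForm, QuadBasis.disc]
      rw [← hκ''] at key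
      refine key.1 (h2 ?_)
      refine (Q.shift c).isRamifiedAt_of_anisotropic (p := p) (κ' := κ') ?_ ?_
      · rw [QuatData.shift_q, QuadBasis.shift_disc, QuatData.shift_κ, hκ']
      · rw [QuatData.shift_q, ← hq]; exact key.2
  · obtain ⟨u, v, huv⟩ := (Q.q.isIntegral_iff _).mp hzint
    have hdn := Q.q.disc_mul_norm huv
    obtain ⟨f, e, hef⟩ := (hpZ.coprime_iff_not_dvd).mpr hdisc
    -- Away from the discriminant `λ` can be made divisible by `p`: since `1 - pf = e·disc = e s²`,
    -- the change `pfλ - λ = -s·e·sλ` lies in `𝔞`. After this only the divisibility of `κ'` matters.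
    have hl : ((p * f : ℤ) : k) * lam - lam ∈ a := by
      have h3 := integral_mul_mem (Q.q.isIntegral_s.neg) (int_mul_mem e h.s_mul_mem)
      convert h3 using 1
      have hef' : (f : k) * p + e * Q.q.disc = 1 := by exact_mod_cast hef
      push_cast
      rw [← Q.q.s_sq] at hef'
      linear_combination lam * hef'
    -- At an inert prime `P` has norm `p²`, so `p² ∣ κ'` is needed. If it failed, the norm form
    -- would be anisotropic, `B` ramified, and `h2` would give `p² ∣ κ'` after all.
    obtain ⟨r, hr, hrκ⟩ : ∃ r : ℕ, Ideal.absNorm P = p ^ r ∧ (p : ℤ) ^ r ∣ κ' ∧ r ≤ 2 := by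
      rcases Q.q.absNorm_prime hPmax.ne_top hp hpP with hPp | hPp
      · refine ⟨2, by rw [hPp, Ideal.absNorm_span_natCast, hfin], ?_, le_rfl⟩
        by_contra hcon
        refine hcon (h2 ?_)
        refine Q.isRamifiedAt_of_anisotropic hκ' fun a b c d => ?_
        exact anisotropic_of_inert
          (Q.q.dvd_of_dvd_normForm (by rw [← hPp]; exact hPmax.isPrime)) h1 hcon
      · exact ⟨1, by rw [hPp, pow_one], by rwa [pow_one], by norm_num⟩
    refine hstrict (lam' := ((p * f : ℤ) : k) * lam) ?_ hl
    refine isPreadmissible_mul h ha hp hM hpM hP0 hpP hr hl ?_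
      (C := κ' - p ^ 2 * f ^ 2 * normForm Q.q.t Q.q.n u v) (d := Q.q.disc) hdisc ?_ ?_
    · have hpk : (p : k) ∈ (P : FracIdeal k) := by
        have := coe_mem_coeIdeal.mpr hpP
        simpa using this
      have := integral_mul_mem ((isIntegral_intCast (k := k) f).mul hzint) hpk
      convert this using 1
      push_cast; ring
    · rw [map_mul, show (((p * f : ℤ) : k)) = (((p * f : ℤ) : ℚ) : k) by push_cast; rfl,
        Q.q.norm_rat]
      push_cast
      rw [hκ']
      linear_combination (p : ℚ) ^ 2 * f ^ 2 * hdn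
    · refine dvd_sub hrκ.1 ?_
      exact ((pow_dvd_pow _ hrκ.2).mul_right _).mul_right _

end Enlarge

/-! ### The discriminant of a pair -/

lemma _root_.Rat.eq_one_of_padicValRat_eq_zero {x : ℚ} (hx : 0 < x)
    (h : ∀ p : ℕ, p.Prime → padicValRat p x = 0) : x = 1 := by
  have h1 : x.den = 1 := by
    by_contra hne
    obtain ⟨p, hp, hpd⟩ := Nat.exists_prime_and_dvd hne
    have hpn : ¬ p ∣ x.num.natAbs := fun hpn =>
      hp.one_lt.ne' (Nat.dvd_one.mp (x.reduced ▸ Nat.dvd_gcd hpn hpd))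
    have := Fact.mk hp
    have h2 := h p hp
    rw [padicValRat_def, padicValInt, padicValNat.eq_zero_of_not_dvd hpn] at h2
    have := one_le_padicValNat_of_dvd x.den_ne_zero hpd
    omega
  have h2 : x.num.natAbs = 1 := by
    by_contra hne
    obtain ⟨p, hp, hpd⟩ := Nat.exists_prime_and_dvd hne
    have := Fact.mk hp
    have h2 := h p hp
    rw [padicValRat_def, padicValInt, h1, padicValNat_one_right] at h2
    have := one_le_padicValNat_of_dvd (by simpa using hx.ne') hpd
    omega
  have h3 : x.num = 1 := by
    have := Rat.num_pos.mpr hx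
    omega
  rw [← Rat.num_div_den x, h1, h3]; norm_num

namespace QuadBasis

variable {k : Type*} [Field k] [NumberField k] {σ : k ≃ₐ[ℚ] k} (q : QuadBasis σ)

/-- `exists_scaling` provides an element `y = 1 - px` of `hI`; its norm is an integer congruent to
`1` modulo `p` and still in `hI`. That norm is the witness. -/
lemma exists_scaling_int (q : QuadBasis σ) {I : FracIdeal k} (hI : I ≠ 0) {p : ℕ} (hp : p.Prime) :
    ∃ h : k, h ≠ 0 ∧ principal h * I ≤ 1 ∧
      ∃ M : ℤ, (M : k) ∈ principal h * I ∧ ¬ (p : ℤ) ∣ M := by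
  obtain ⟨h, hh, hle, x, y, hx, hy, hxy⟩ := exists_scaling hI hp
  refine ⟨h, hh, hle, ?_⟩
  obtain ⟨u, v, rfl⟩ := (q.isIntegral_iff x).mp hx
  refine ⟨1 - p * (2 * u + v * q.t - p * normForm q.t q.n u v), ?_, ?_⟩
  · have hyi : IsIntegral ℤ (σ y) := isIntegral_conj σ (mem_one_iff_isIntegral.mp (hle hy))
    have := integral_mul_mem hyi hy
    convert this using 1
    have hy' : y = 1 - p * (u + v * q.ω) := by linear_combination -hxy
    rw [hy']
    simp only [map_sub, map_one, map_mul, map_natCast, map_add, map_intCast, q.conj, normForm]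
    push_cast
    linear_combination (p : k) ^ 2 * v ^ 2 * q.sq
  · intro hdvd
    have : (p : ℤ) ∣ 1 := by
      have := dvd_add hdvd
        (Dvd.intro (2 * u + v * q.t - p * normForm q.t q.n u v) rfl : (p : ℤ) ∣ p * _)
      simpa using this
    exact (Nat.prime_iff_prime_int.mp hp).not_isUnit (isUnit_of_dvd_one this)

/-- The absolute value of the discriminant of the lattice attached to a pair. -/
noncomputable def index (κ : ℚ) (a : FracIdeal k) : ℚ :=
  |(q.disc : ℚ) * κ| / FractionalIdeal.absNorm a

lemma index_pos {κ : ℚ} (hκ : κ ≠ 0) {a : FracIdeal k} (ha : a ≠ 0) : 0 < q.index κ a := by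
  refine div_pos (abs_pos.mpr (mul_ne_zero ?_ hκ)) (absNorm_pos ha)
  exact_mod_cast q.disc_ne_zero

lemma index_scale (κ : ℚ) (a : FracIdeal k) {h : k} (hh : h ≠ 0) :
    q.index (Algebra.norm ℚ h * κ) (principal h * a) = q.index κ a := by
  have h0 : |Algebra.norm ℚ h| ≠ 0 := by simpa [Algebra.norm_eq_zero_iff] using hh
  rw [index, index, map_mul, absNorm_principal, mul_left_comm, abs_mul, mul_div_mul_left _ _ h0]

lemma ωInt_mem {p : ℕ} (ht : (p : ℤ) ∣ q.t) (hn : (p : ℤ) ∣ q.n) {P : Ideal (𝓞 k)}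
    (hP : P.IsPrime) (hpP : (p : 𝓞 k) ∈ P) : q.ωInt ∈ P := by
  apply hP.mem_of_pow_mem 2
  obtain ⟨t', ht'⟩ := ht
  obtain ⟨n', hn'⟩ := hn
  rw [q.ωInt_sq, ht', hn']
  have := P.mul_mem_left (t' * q.ωInt - n') hpP
  convert this using 1
  push_cast; ring

lemma absNorm_of_ωInt_mem {p : ℕ} (hp : p.Prime) {P : Ideal (𝓞 k)} (hP : P ≠ ⊤)
    (hpP : (p : 𝓞 k) ∈ P) (hω : q.ωInt ∈ P) : Ideal.absNorm P = p := by
  refine (q.absNorm_prime hP hp hpP).resolve_left fun hPp => ?_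
  rw [hPp, Ideal.mem_span_singleton] at hω
  have := (q.dvd_of_natCast_dvd (u := 0) (v := 1) (by simpa using hω)).2
  exact (Nat.prime_iff_prime_int.mp hp).not_isUnit (isUnit_of_dvd_one this)

/-- With `n = pn'` and `n'` prime to `p`, the Eisenstein equation gives `pn' = tω - ω² ∈ P²`;
combine it with `p² ∈ P²`. -/
lemma natCast_mem_sq {p : ℕ} (hp : p.Prime) (ht : (p : ℤ) ∣ q.t) (hn : (p : ℤ) ∣ q.n)
    {P : Ideal (𝓞 k)} (hP : P.IsPrime) (hpP : (p : 𝓞 k) ∈ P) : (p : 𝓞 k) ∈ P ^ 2 := by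
  have hn2 := q.not_sq_dvd_n hp ht
  have hω := q.ωInt_mem ht hn hP hpP
  obtain ⟨t', ht'⟩ := ht
  obtain ⟨n', hn'⟩ := hn
  have hpn : ¬ (p : ℤ) ∣ n' := by
    rintro ⟨m, rfl⟩
    exact hn2 ⟨m, by rw [hn']; ring⟩
  obtain ⟨x, y, hxy⟩ := ((Nat.prime_iff_prime_int.mp hp).coprime_iff_not_dvd).mpr hpn
  have h1 : (p : 𝓞 k) * p ∈ P ^ 2 := by rw [_root_.sq]; exact Ideal.mul_mem_mul hpP hpP
  have h2 : (p : 𝓞 k) * q.ωInt ∈ P ^ 2 := by rw [_root_.sq]; exact Ideal.mul_mem_mul hpP hω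
  have h3 : q.ωInt * q.ωInt ∈ P ^ 2 := by rw [_root_.sq]; exact Ideal.mul_mem_mul hω hω
  have hωs := q.ωInt_sq
  rw [ht', hn'] at hωs
  push_cast at hωs
  have hxy' : (x : 𝓞 k) * p + y * n' = 1 := by exact_mod_cast hxy
  have := add_mem ((P ^ 2).mul_mem_left (x : 𝓞 k) h1)
    ((P ^ 2).mul_mem_left (y : 𝓞 k) (sub_mem ((P ^ 2).mul_mem_left (t' : 𝓞 k) h2) h3))
  convert this using 1
  linear_combination -(p : 𝓞 k) * hxy' + (y : 𝓞 k) * hωs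

lemma exists_maximal_above (q : QuadBasis σ) {p : ℕ} (hp : p.Prime) :
    ∃ P : Ideal (𝓞 k), P.IsMaximal ∧ (p : 𝓞 k) ∈ P := by
  have hne : Ideal.span {(p : 𝓞 k)} ≠ ⊤ := by
    intro htop
    have h1 : (1 : 𝓞 k) ∈ Ideal.span {(p : 𝓞 k)} := by rw [htop]; trivial
    rw [Ideal.mem_span_singleton] at h1
    have := (q.dvd_of_natCast_dvd (u := 1) (v := 0) (by simpa using h1)).1
    exact (Nat.prime_iff_prime_int.mp hp).not_isUnit (isUnit_of_dvd_one this)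
  obtain ⟨P, hP, hle⟩ := Ideal.exists_le_maximal _ hne
  exact ⟨P, hP, hle (Ideal.mem_span_singleton_self _)⟩

lemma isRamifiedInField {p : ℕ} (hp : p.Prime) (hd : (p : ℤ) ∣ q.disc) :
    IsRamifiedInField k p := by
  obtain ⟨c, ht, hn⟩ := q.exists_eisenstein_shift hp hd
  obtain ⟨P, hP, hpP⟩ := q.exists_maximal_above hp
  exact ⟨hp, P, hP.isPrime, (Ideal.span_singleton_le_iff_mem _).mpr
    ((q.shift c).natCast_mem_sq hp ht hn hP.isPrime hpP)⟩

end QuadBasis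

/-! ### Valuations of the index of a pair -/

section Index

variable {k : Type*} [Field k] [NumberField k] {σ : k ≃ₐ[ℚ] k}
  {B : Type*} [Ring B] [Algebra ℚ B] (Q : QuatData σ B)

/-- The integers attached to a pair with integral first component. -/
lemma exists_int_data {q : QuadBasis σ} {κ : ℚ} {a : FracIdeal k} {lam : k}
    (h : q.IsPreadmissible κ a lam) (ha : a ≤ 1) :
    ∃ κ' u v C : ℤ, (κ' : ℚ) = -q.disc * κ ∧ q.s * lam = u + v * q.ω ∧
      Algebra.norm ℚ lam - κ = C ∧ κ' = normForm q.t q.n u v + q.disc * C := by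
  obtain ⟨u, v, huv⟩ := (q.isIntegral_iff _).mp (mem_one_iff_isIntegral.mp (ha h.s_mul_mem))
  obtain ⟨J, hJ⟩ := FractionalIdeal.le_one_iff_exists_coeIdeal.mp ha
  obtain ⟨n, hn⟩ := h.norm_congr
  rw [← hJ, FractionalIdeal.coeIdeal_absNorm] at hn
  have hC : Algebra.norm ℚ lam - κ = ((n * Ideal.absNorm J : ℤ) : ℚ) := by rw [hn]; push_cast; rfl
  refine ⟨_, u, v, n * Ideal.absNorm J, ?_, huv, hC, rfl⟩
  have hdn := q.disc_mul_norm huv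
  push_cast at hC ⊢
  linear_combination hdn - (q.disc : ℚ) * hC

/-- The normalized `𝔞` has norm an integer prime to `p`, so only `κ' = -disc·κ` contributes to the
valuation. -/
lemma padicValRat_index {q : QuadBasis σ} {κ : ℚ} (hκ : κ ≠ 0) {a : FracIdeal k} (ha0 : a ≠ 0)
    (ha : a ≤ 1) {p : ℕ} (hp : p.Prime) {M : ℤ} (hM : (M : k) ∈ a) (hpM : ¬ (p : ℤ) ∣ M) {κ' : ℤ}
    (hκ' : (κ' : ℚ) = -q.disc * κ) (n : ℕ) : (n : ℤ) ≤ padicValRat p (q.index κ a) ↔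
      (p : ℤ) ^ n ∣ κ' := by
  have := Fact.mk hp
  obtain ⟨m, hm, hpm⟩ := absNorm_of_le_one ha ha0 q hp hM hpM
  have hd : (q.disc : ℚ) ≠ 0 := by exact_mod_cast q.disc_ne_zero
  have hκ0 : κ' ≠ 0 := by
    rintro rfl
    rw [Int.cast_zero, zero_eq_mul, neg_eq_zero] at hκ'
    tauto
  have hm0 : (m : ℚ) ≠ 0 := by rw [← hm]; exact (absNorm_pos ha0).ne'
  have h1 : q.index κ a = |(κ' : ℚ)| / m := by
    rw [QuadBasis.index, hm, hκ', neg_mul, abs_neg]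
  have hκq : |(κ' : ℚ)| ≠ 0 := by simpa using hκ0
  have habs : padicValRat p |(κ' : ℚ)| = padicValInt p κ' := by
    rcases abs_choice (κ' : ℚ) with h | h <;> rw [h]
    · exact padicValRat.of_int
    · rw [padicValRat.neg]; exact padicValRat.of_int
  rw [h1, padicValRat.div hκq hm0, habs, padicValRat.of_int,
    padicValInt.eq_zero_of_not_dvd hpm, Nat.cast_zero, sub_zero, padicValInt_dvd_iff]
  simp only [hκ0, false_or]
  exact Nat.cast_le

variable {Q} {a : FracIdeal k} {lam : k}

lemma padicValRat_index_nonneg (h : Q.IsPreadmissible a lam) {p : ℕ} (hp : p.Prime) :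
    0 ≤ padicValRat p (Q.q.index Q.κ a) := by
  obtain ⟨e, he, hle, M, hM, hpM⟩ := Q.q.exists_scaling_int h.ne_zero hp
  have h' : (Q.scale e he).IsPreadmissible _ _ := h.scale he
  obtain ⟨κ', u, v, C, hκ', -, -, -⟩ := exists_int_data h' hle
  rw [← Q.q.index_scale Q.κ a he]
  exact (padicValRat_index (Q.scale e he).κ_ne h'.ne_zero hle hp hM hpM hκ' 0).mpr (by simp)

/-- Scaling leaves the index unchanged, so `𝔞` may be assumed trivial at `p`, where isotropy of the
lattice form applies. -/
lemma one_le_padicValRat_index (h : Q.IsPreadmissible a lam) {p : ℕ} (hp : IsRamifiedAt B p) :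
    1 ≤ padicValRat p (Q.q.index Q.κ a) := by
  obtain ⟨e, he, hle, M, hM, hpM⟩ := Q.q.exists_scaling_int h.ne_zero hp.1
  have h' : (Q.scale e he).IsPreadmissible _ _ := h.scale he
  obtain ⟨κ', u, v, C, hκ', -, -, hC⟩ := exists_int_data h' hle
  rw [← Q.q.index_scale Q.κ a he]
  refine (padicValRat_index (Q.scale e he).κ_ne h'.ne_zero hle hp.1 hM hpM hκ' 1).mpr ?_
  rw [pow_one]
  exact (Q.scale e he).dvd_of_isRamifiedAt hκ' hC hp

/-- The normalized case, transported back through the scaling of `δ`. -/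
lemma exists_refinement (h : Q.IsPreadmissible a lam) {p : ℕ} (hp : p.Prime)
    (h1 : 1 ≤ padicValRat p (Q.q.index Q.κ a))
    (h2 : IsRamifiedAt B p → 2 ≤ padicValRat p (Q.q.index Q.κ a)) :
    ∃ (a' : FracIdeal k) (lam' : k), Q.IsPreadmissible a' lam' ∧ a' ≤ a ∧ a' ≠ a ∧
      lam' - lam ∈ a := by
  obtain ⟨e, he, hle, M, hM, hpM⟩ := Q.q.exists_scaling_int h.ne_zero hp
  have h' : (Q.scale e he).IsPreadmissible _ _ := h.scale he
  obtain ⟨κ', u, v, C, hκ', -, -, hC⟩ := exists_int_data h' hle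
  rw [← Q.q.index_scale Q.κ a he] at h1 h2
  have key := padicValRat_index (Q.scale e he).κ_ne h'.ne_zero hle hp hM hpM hκ'
  obtain ⟨a', lam', hpre, hle', hne, hl⟩ := exists_refinement_of_le_one (Q.scale e he) h' hle hp
    hM hpM hκ' (by simpa using (key 1).mp h1) (fun hr => (key 2).mp (h2 hr))
  have hcancel : principal e⁻¹ * (principal e * a) = a := by
    rw [← mul_assoc, FractionalIdeal.spanSingleton_mul_spanSingleton, inv_mul_cancel₀ he]; simp
  refine ⟨principal e⁻¹ * a', e⁻¹ * lam', QuadBasis.IsPreadmissible.of_scale he hpre, ?_, ?_, ?_⟩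
  · rw [← hcancel]; exact mul_le_mul_right hle' _
  · intro heq
    apply hne
    rw [← heq, ← mul_assoc, FractionalIdeal.spanSingleton_mul_spanSingleton, mul_inv_cancel₀ he]
    simp
  · have := (mem_principal_mul_iff he a).mp hl
    convert this using 1
    field_simp

end Index

/-! ### Maximality and the discriminant -/

section PrimeProducts

variable {S : ℕ → Prop}

lemma finprod_primes_eq (hS : {p | S p}.Finite) :
    (∏ᶠ (p : ℕ) (_ : S p), p) = ∏ p ∈ hS.toFinset, p :=
  finprod_mem_eq_finite_toFinset_prod (fun p => p) hS

lemma finprod_primes_ne_zero (hS : {p | S p}.Finite) (hp : ∀ p, S p → p.Prime) :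
    (∏ᶠ (p : ℕ) (_ : S p), p) ≠ 0 := by
  rw [finprod_primes_eq hS, Finset.prod_ne_zero_iff]
  intro p h
  exact (hp p (by simpa using h)).ne_zero

lemma prime_dvd_finprod_primes (hS : {p | S p}.Finite) (hp : ∀ p, S p → p.Prime) {p : ℕ}
    (hpp : p.Prime) : p ∣ (∏ᶠ (p : ℕ) (_ : S p), p) ↔ S p := by
  rw [finprod_primes_eq hS, Prime.dvd_finsetProd_iff hpp.prime]
  constructor
  · rintro ⟨r, hr, hpr⟩
    have hr' : S r := by simpa using hr
    rwa [(Nat.prime_dvd_prime_iff_eq hpp (hp r hr')).mp hpr]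
  · intro h
    exact ⟨p, by simpa using h, dvd_rfl⟩

lemma squarefree_finprod_primes (hS : {p | S p}.Finite) (hp : ∀ p, S p → p.Prime) :
    Squarefree (∏ᶠ (p : ℕ) (_ : S p), p) := by
  rw [finprod_primes_eq hS]
  refine Finset.squarefree_prod_of_pairwise_isCoprime ?_ ?_
  · intro p h r h' hne
    exact Nat.coprime_iff_isRelPrime.mp ((Nat.coprime_primes (hp p (by simpa using h))
      (hp r (by simpa using h'))).mpr hne)
  · intro p h
    exact (hp p (by simpa using h)).prime.squarefree

lemma padicValRat_of_squarefree {D p : ℕ} (hD : Squarefree D) (hp : p.Prime) :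
    (p ∣ D → padicValRat p D = 1) ∧ (¬ p ∣ D → padicValRat p D = 0) := by
  have := Fact.mk hp
  have h2 : ¬ p ^ 2 ∣ D := fun h =>
    hp.one_lt.ne' (Nat.isUnit_iff.mp (hD p (by rwa [← sq])))
  have h0 : D ≠ 0 := hD.ne_zero
  rw [padicValRat.of_nat]
  constructor
  · intro h
    have h1 := one_le_padicValNat_of_dvd h0 h
    rw [padicValNat_dvd_iff] at h2
    push Not at h2
    have := h2.2
    norm_cast
    omega
  · intro h
    rw [padicValNat.eq_zero_of_not_dvd h, Nat.cast_zero]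

end PrimeProducts

/-! ### Orders of index `D` are the maximal ones -/

section Maximal

variable {k : Type*} [Field k] [NumberField k] {σ : k ≃ₐ[ℚ] k}
  {B : Type*} [Ring B] [Algebra ℚ B] {Q : QuatData σ B} {a : FracIdeal k} {lam : k}

/-- A single pair bounds ramification, since every ramified prime divides the numerator of its
index. Without finiteness the `finprod` defining `D` would take its default value `1`. -/
lemma finite_isRamifiedAt (h : Q.IsPreadmissible a lam) : {p | IsRamifiedAt B p}.Finite := by
  have hpos := Q.q.index_pos Q.κ_ne h.ne_zero
  refine Set.Finite.subset (Q.q.index Q.κ a).num.natAbs.primeFactors.finite_toSet ?_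
  intro p hp
  have := Fact.mk hp.1
  have h1 := one_le_padicValRat_index h hp
  rw [padicValRat_def] at h1
  have hn : (Q.q.index Q.κ a).num ≠ 0 := by simpa using hpos.ne'
  simp only [Finset.mem_coe, Nat.mem_primeFactors]
  refine ⟨hp.1, ?_, by simpa using hn⟩
  rw [← Int.natCast_dvd]
  have h2 : ((p : ℤ) ^ 1) ∣ (Q.q.index Q.κ a).num :=
    (padicValInt_dvd_iff 1 _).mpr (Or.inr (by omega))
  simpa using h2

lemma ramProd_ne_zero (h : Q.IsPreadmissible a lam) : ramProd B ≠ 0 :=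
  finprod_primes_ne_zero (finite_isRamifiedAt h) fun _ hp => hp.1

lemma absNorm_eq_iff (h : Q.IsPreadmissible a lam) :
    FractionalIdeal.absNorm a = |Q.κ| * |(NumberField.discr k : ℚ)| / (ramProd B : ℚ) ↔
      Q.q.index Q.κ a = ramProd B := by
  have hD : (ramProd B : ℚ) ≠ 0 := by exact_mod_cast ramProd_ne_zero h
  have ha := (absNorm_pos h.ne_zero).ne'
  rw [QuadBasis.index, Q.q.abs_discr, abs_mul, eq_div_iff hD, div_eq_iff ha, mul_comm (|Q.κ|)]
  constructor <;> intro h <;> linarith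

lemma padicValRat_ramProd (h : Q.IsPreadmissible a lam) {p : ℕ} (hp : p.Prime) :
    (IsRamifiedAt B p → padicValRat p (ramProd B) = 1) ∧
      (¬ IsRamifiedAt B p → padicValRat p (ramProd B) = 0) := by
  have hfin := finite_isRamifiedAt h
  have h1 := padicValRat_of_squarefree
    (squarefree_finprod_primes hfin fun _ hp => hp.1) hp
  rw [prime_dvd_finprod_primes hfin (fun _ hp => hp.1) hp] at h1
  exact h1

lemma isIntegral_of_mem_order {L : Submodule ℤ B} (hL : IsOrder L) {x : B} (hx : x ∈ L) :
    IsIntegral ℤ x := by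
  let S : Subalgebra ℤ B :=
    { L with
      mul_mem' := fun {x y} hx hy => hL.mul_mem x hx y hy
      algebraMap_mem' := fun n => by
        have := L.smul_mem n hL.one_mem
        simpa [Algebra.algebraMap_eq_smul_one] using this }
  exact IsIntegral.of_mem_of_fg S hL.fg x hx

/-- Elements of an order are integral, so any order containing `O_k` meets `k` exactly in `O_k`.
Hence the description by pairs also applies to overorders. -/
lemma mem_iff_isIntegral_of_le {L : Submodule ℤ B} (hL : IsOrder L)
    (h : ∀ x : k, IsIntegral ℤ x → Q.i x ∈ L) (x : k) : Q.i x ∈ L ↔ IsIntegral ℤ x := by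
  refine ⟨fun hx => ?_, h x⟩
  exact (isIntegral_algHom_iff (Q.i.restrictScalars ℤ) Q.i_injective).mp
    (isIntegral_of_mem_order hL hx)

lemma eq_of_le_of_absNorm_eq {I J : FracIdeal k} (hJ : J ≠ 0) (hle : I ≤ J)
    (h : FractionalIdeal.absNorm I = FractionalIdeal.absNorm J) : I = J := by
  have h1 : I * J⁻¹ ≤ 1 := by
    rw [← mul_inv_cancel₀ hJ]; exact mul_le_mul_left hle _
  obtain ⟨K, hK⟩ := FractionalIdeal.le_one_iff_exists_coeIdeal.mp h1
  have hI : I = K * J := by rw [hK, mul_assoc, inv_mul_cancel₀ hJ, mul_one]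
  have h2 := congrArg FractionalIdeal.absNorm hI
  rw [map_mul, FractionalIdeal.coeIdeal_absNorm, h] at h2
  have h3 : (Ideal.absNorm K : ℚ) = 1 := by
    have := (absNorm_pos hJ).ne'
    field_simp at h2
    exact h2.symm
  have hK1 : K = ⊤ := Ideal.absNorm_eq_one_iff.mp (by exact_mod_cast h3)
  rw [hI, hK1]
  simp

/-- A smaller first component has a smaller index. -/
lemma exists_index_eq_mul {q : QuadBasis σ} {κ : ℚ} {I J : FracIdeal k} (hI : I ≠ 0)
    (hJ : J ≠ 0) (hle : I ≤ J) :
    ∃ c : ℕ, c ≠ 0 ∧ q.index κ J = q.index κ I * c ∧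
      FractionalIdeal.absNorm I = c * FractionalIdeal.absNorm J := by
  have h1 : I * J⁻¹ ≤ 1 := by
    rw [← mul_inv_cancel₀ hJ]; exact mul_le_mul_left hle _
  obtain ⟨K, hK⟩ := FractionalIdeal.le_one_iff_exists_coeIdeal.mp h1
  have hI' : I = K * J := by rw [hK, mul_assoc, inv_mul_cancel₀ hJ, mul_one]
  have hN : FractionalIdeal.absNorm I = Ideal.absNorm K * FractionalIdeal.absNorm J := by
    rw [hI', map_mul, FractionalIdeal.coeIdeal_absNorm]
  have hK0 : Ideal.absNorm K ≠ 0 := by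
    intro h0
    rw [h0] at hN
    simp [hI] at hN
  refine ⟨Ideal.absNorm K, hK0, ?_, hN⟩
  have hJp := (absNorm_pos hJ).ne'
  have hK0' : (Ideal.absNorm K : ℚ) ≠ 0 := by exact_mod_cast hK0
  rw [QuadBasis.index, QuadBasis.index, hN]
  field_simp

/-- An overorder comes from a pair with ideal `𝔞' ⊆ 𝔞`, and the index drops by the factor `[𝔞 :
𝔞']`. At every prime `D` has the smallest valuation an index can have, so the factor is `1` and `𝔞'
= 𝔞`. -/
lemma isMaximalOrder_of_index (h : Q.IsPreadmissible a lam)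
    (hidx : Q.q.index Q.κ a = ramProd B) : IsMaximalOrder (Q.pairOrder a lam) := by
  refine ⟨QuatData.isOrder_pairOrder h, fun L' hL' hle => ?_⟩
  obtain ⟨a', lam', h', rfl⟩ := Q.exists_pair hL'
    (mem_iff_isIntegral_of_le hL' fun x hx => hle (Q.i_mem_pairOrder.mpr hx))
  obtain ⟨hle1, hlam⟩ := (Q.pairOrder_le_iff h.ne_zero h'.ne_zero).mp hle
  obtain ⟨c, hc0, hc, hN⟩ := exists_index_eq_mul (q := Q.q) (κ := Q.κ) h'.ne_zero h.ne_zero hle1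
  have hi' := Q.q.index_pos Q.κ_ne h'.ne_zero
  have hc1 : (c : ℚ) = 1 := by
    refine Rat.eq_one_of_padicValRat_eq_zero (by positivity) fun p hp => ?_
    have := Fact.mk hp
    have h1 : padicValRat p (ramProd B : ℚ) = padicValRat p (Q.q.index Q.κ a') + padicValRat p c :=
        by
      rw [← hidx, hc, padicValRat.mul hi'.ne' (by exact_mod_cast hc0)]
    have h2 : 0 ≤ padicValRat p (c : ℚ) := by rw [padicValRat.of_nat]; positivity
    by_cases hr : IsRamifiedAt B p
    · have := one_le_padicValRat_index h' hr
      have := (padicValRat_ramProd h hp).1 hr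
      omega
    · have := padicValRat_index_nonneg h' hp
      have := (padicValRat_ramProd h hp).2 hr
      omega
  rw [hc1, one_mul] at hN
  obtain rfl := eq_of_le_of_absNorm_eq h.ne_zero hle1 hN
  refine le_antisymm ((Q.pairOrder_le_iff h'.ne_zero h'.ne_zero).mpr ⟨le_rfl, ?_⟩) hle
  have := frac_neg_mem hlam
  rwa [neg_sub] at this

/-- If the valuations of the index and of `D` differed at some prime, the pair could be refined
there, giving a strictly larger order. -/
lemma index_of_isMaximalOrder (h : Q.IsPreadmissible a lam)
    (hmax : IsMaximalOrder (Q.pairOrder a lam)) : Q.q.index Q.κ a = ramProd B := by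
  have hD : (ramProd B : ℚ) ≠ 0 := by exact_mod_cast ramProd_ne_zero h
  have hpos := Q.q.index_pos Q.κ_ne h.ne_zero
  have hD' : (0 : ℚ) < ramProd B := lt_of_le_of_ne (by positivity) hD.symm
  suffices Q.q.index Q.κ a / ramProd B = 1 by rwa [div_eq_one_iff_eq hD] at this
  refine Rat.eq_one_of_padicValRat_eq_zero (div_pos hpos hD') fun p hp => ?_
  have := Fact.mk hp
  rw [padicValRat.div hpos.ne' hD]
  have hno : ¬ (1 ≤ padicValRat p (Q.q.index Q.κ a) ∧
      (IsRamifiedAt B p → 2 ≤ padicValRat p (Q.q.index Q.κ a))) := by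
    rintro ⟨h1, h2⟩
    obtain ⟨a', lam', h', hle, hne, hl⟩ := exists_refinement h hp h1 h2
    have hL := hmax.2 _ (QuatData.isOrder_pairOrder h')
        ((Q.pairOrder_le_iff h.ne_zero h'.ne_zero).mpr ⟨hle, hl⟩)
    exact hne (le_antisymm hle ((Q.pairOrder_le_iff h'.ne_zero h.ne_zero).mp hL.le).1)
  by_cases hr : IsRamifiedAt B p
  · have := one_le_padicValRat_index h hr
    have := (padicValRat_ramProd h hp).1 hr
    by_contra hne
    exact hno ⟨by omega, fun _ => by omega⟩
  · have := padicValRat_index_nonneg h hp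
    have := (padicValRat_ramProd h hp).2 hr
    by_contra hne
    exact hno ⟨by omega, fun hr' => absurd hr' hr⟩

end Maximal

/-! ### The ideal `(z, s𝔞)𝔞⁻¹` tested at primes -/

section Generator

variable {k : Type*} [Field k] [NumberField k] {σ : k ≃ₐ[ℚ] k}

lemma exists_prime_mem {P : Ideal (𝓞 k)} (hP : P.IsPrime) (hP0 : P ≠ ⊥) :
    ∃ p : ℕ, p.Prime ∧ (p : 𝓞 k) ∈ P := by
  classical
  have hex : ∃ n : ℕ, n ≠ 0 ∧ (n : 𝓞 k) ∈ P :=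
    ⟨Ideal.absNorm P, by rwa [Ne, Ideal.absNorm_eq_zero_iff], Ideal.absNorm_mem P⟩
  obtain ⟨hn0, hn⟩ := Nat.find_spec hex
  set n := Nat.find hex
  have hn1 : n ≠ 1 := by
    intro h1
    rw [h1, Nat.cast_one] at hn
    exact hP.ne_top ((Ideal.eq_top_iff_one P).mpr hn)
  refine ⟨n.minFac, Nat.minFac_prime hn1, ?_⟩
  have hmul : (n : 𝓞 k) = n.minFac * (n / n.minFac : ℕ) := by
    rw [← Nat.cast_mul, Nat.mul_div_cancel' n.minFac_dvd]
  rw [hmul] at hn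
  refine (hP.mem_or_mem hn).resolve_right fun h => ?_
  refine Nat.find_min hex (m := n / n.minFac)
    (Nat.div_lt_self (Nat.pos_of_ne_zero hn0) (Nat.minFac_prime hn1).one_lt) ⟨?_, h⟩
  exact (Nat.div_pos (Nat.minFac_le (Nat.pos_of_ne_zero hn0)) n.minFac_pos).ne'

/-- Since `𝔞` contains an integer prime to `p`, it is trivial at `p`, and `E` is there simply
generated by `z` and `s`. This direction allows `I` to be any ideal containing a power of `p`, such
as `P²`. -/
lemma mem_ideal_of_le {E I : Ideal (𝓞 k)} {a : FracIdeal k} {z s : k} (ha0 : a ≠ 0) (ha : a ≤ 1)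
    (hE : (E : FracIdeal k) = (principal z + principal s * a) * a⁻¹) {p : ℕ} (hp : p.Prime) {M : ℤ}
    (hM : (M : k) ∈ a) (hpM : ¬ (p : ℤ) ∣ M) {j : ℕ} (hpI : (p : 𝓞 k) ^ j ∈ I)
    (hs : IsIntegral ℤ s) (hEI : E ≤ I) :
    z ∈ (I : FracIdeal k) ∧ s ∈ (I : FracIdeal k) := by
  have h1 : (E : FracIdeal k) * a = principal z + principal s * a := by
    rw [hE, mul_assoc, inv_mul_cancel₀ ha0, mul_one]
  have h2 : principal z + principal s * a ≤ (I : FracIdeal k) := by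
    rw [← h1]
    calc (E : FracIdeal k) * a ≤ E * 1 := mul_le_mul_right ha _
      _ = E := mul_one _
      _ ≤ I := FractionalIdeal.coeIdeal_le_coeIdeal k |>.mpr hEI
  have hz : z ∈ principal z + principal s * a :=
    (le_add_of_nonneg_right zero_le : principal z ≤ _) (FractionalIdeal.mem_spanSingleton_self _ z)
  have hsM : s * M ∈ principal z + principal s * a :=
    (le_add_of_nonneg_left zero_le : principal s * a ≤ _)
      (mem_mul_of_mem (FractionalIdeal.mem_spanSingleton_self _ s) hM)
  refine ⟨h2 hz, ?_⟩
  obtain ⟨x, y, hxy⟩ := (((Nat.prime_iff_prime_int.mp hp).coprime_iff_not_dvd).mpr hpM).pow_left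
    (m := j)
  have hpk : (p : k) ^ j ∈ (I : FracIdeal k) := by
    have := coe_mem_coeIdeal.mpr hpI
    simpa using this
  have := frac_add_mem (integral_mul_mem ((isIntegral_intCast x).mul hs) hpk)
    (int_mul_mem y (h2 hsM))
  convert this using 1
  have hxy' : (x : k) * p ^ j + y * M = 1 := by exact_mod_cast hxy
  linear_combination -s * hxy'

lemma le_ideal_of_mem {E P : Ideal (𝓞 k)} {a : FracIdeal k} {z s : k} (ha0 : a ≠ 0)
    (hE : (E : FracIdeal k) = (principal z + principal s * a) * a⁻¹) {p : ℕ} (hp : p.Prime) {M : ℤ}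
    (hM : (M : k) ∈ a) (hpM : ¬ (p : ℤ) ∣ M) (hpP : (p : 𝓞 k) ∈ P)
    (hza : z ∈ a) (hz : z ∈ (P : FracIdeal k)) (hs : s ∈ (P : FracIdeal k)) : E ≤ P := by
  rw [← FractionalIdeal.coeIdeal_le_coeIdeal k, hE, add_mul, mul_assoc, mul_inv_cancel₀ ha0,
    mul_one]
  rw [← FractionalIdeal.sup_eq_add]
  refine sup_le ?_ ((FractionalIdeal.spanSingleton_le_iff_mem).mpr hs)
  intro x hx
  rw [FractionalIdeal.mem_singleton_mul] at hx
  obtain ⟨b, hb, rfl⟩ := hx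
  obtain ⟨x, y, hxy⟩ := ((Nat.prime_iff_prime_int.mp hp).coprime_iff_not_dvd).mpr hpM
  have hpk : (p : k) ∈ (P : FracIdeal k) := by
    have := coe_mem_coeIdeal.mpr hpP
    simpa using this
  have h1 := integral_mul_mem ((isIntegral_intCast x).mul (isIntegral_mul_of_mem_inv hb hza)) hpk
  have h2 := integral_mul_mem ((isIntegral_intCast y).mul (isIntegral_mul_of_mem_inv hb hM)) hz
  have := frac_add_mem h1 h2
  convert this using 1
  have hxy' : (x : k) * p + y * M = 1 := by exact_mod_cast hxy
  linear_combination -z * b * hxy'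

end Generator

/-! ### The generator condition -/

section Generator

variable {k : Type*} [Field k] [NumberField k] {σ : k ≃ₐ[ℚ] k}

/-- A squarefree ideal is its own radical, and radicals are compared through their prime factors. -/
lemma dvd_of_squarefree_ideal {E d : Ideal (𝓞 k)} (hE : Squarefree E) (hd : d ≠ ⊥)
    (h : ∀ P : Ideal (𝓞 k), P.IsPrime → P ≠ ⊥ → P ∣ E → P ∣ d) : E ∣ d := by
  classical
  have h1 : E ∣ UniqueFactorizationMonoid.radical E :=
    (UniqueFactorizationMonoid.dvd_radical_iff hE.isRadical hE.ne_zero).mpr dvd_rfl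
  have h2 : UniqueFactorizationMonoid.radical E ∣ UniqueFactorizationMonoid.radical d := by
    rw [UniqueFactorizationMonoid.radical_dvd_radical_iff_normalizedFactors_subset_normalizedFactors
      ]
    intro P hP
    have hPp := UniqueFactorizationMonoid.prime_of_normalized_factor P hP
    have := h P (Ideal.isPrime_of_prime hPp) hPp.ne_zero
      (UniqueFactorizationMonoid.dvd_of_mem_normalizedFactors hP)
    obtain ⟨P', hP', hass⟩ :=
      UniqueFactorizationMonoid.exists_mem_normalizedFactors_of_dvd hd hPp.irreducible this
    rwa [associated_iff_eq.mp hass]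
  exact (h1.trans h2).trans UniqueFactorizationMonoid.radical_dvd_self

lemma squarefree_ideal {E : Ideal (𝓞 k)} (hE : E ≠ ⊥)
    (h : ∀ P : Ideal (𝓞 k), P.IsPrime → P ≠ ⊥ → ¬ P ^ 2 ∣ E) : Squarefree E := by
  rw [squarefree_iff_irreducible_sq_not_dvd_of_ne_zero hE]
  intro P hP
  rw [← sq]
  exact h P (Ideal.isPrime_of_prime hP.prime) hP.ne_zero

/-- Simultaneous normalization at `p` of a pair and of the associated ideal. -/
lemma exists_local_data {q : QuadBasis σ} {κ : ℚ} (hκ : κ ≠ 0) {a : FracIdeal k} {lam : k}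
    (h : q.IsPreadmissible κ a lam) {E : Ideal (𝓞 k)}
    (hE : (E : FracIdeal k) = (principal (q.s * lam) + principal q.s * a) * a⁻¹)
    {p : ℕ} (hp : p.Prime) :
    ∃ (a₁ : FracIdeal k) (z : k) (M κ' u v C : ℤ), a₁ ≠ 0 ∧ a₁ ≤ 1 ∧ (M : k) ∈ a₁ ∧
      ¬ (p : ℤ) ∣ M ∧ (E : FracIdeal k) = (principal z + principal q.s * a₁) * a₁⁻¹ ∧ z ∈ a₁ ∧
      z = u + v * q.ω ∧ κ' = normForm q.t q.n u v + q.disc * C ∧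
      ∀ n : ℕ, (n : ℤ) ≤ padicValRat p (q.index κ a) ↔ (p : ℤ) ^ n ∣ κ' := by
  obtain ⟨e, he, hle, M, hM, hpM⟩ := q.exists_scaling_int h.ne_zero hp
  have h' := h.scale he
  obtain ⟨κ', u, v, C, hκ', huv, -, hC⟩ := exists_int_data h' hle
  have hκ0 : Algebra.norm ℚ e * κ ≠ 0 :=
    mul_ne_zero (by simpa [Algebra.norm_eq_zero_iff] using he) hκ
  refine ⟨_, _, M, κ', u, v, C, h'.ne_zero, hle, hM, hpM, ?_, h'.s_mul_mem, huv, hC, ?_⟩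
  · have he1 : principal e * principal e⁻¹ = 1 := by
      rw [FractionalIdeal.spanSingleton_mul_spanSingleton, mul_inv_cancel₀ he]; simp
    have he2 : principal (q.s * (e * lam)) = principal e * principal (q.s * lam) := by
      rw [FractionalIdeal.spanSingleton_mul_spanSingleton, mul_left_comm]
    rw [hE, mul_inv, FractionalIdeal.spanSingleton_inv, he2]
    calc _ = (principal (q.s * lam) + principal q.s * a) * a⁻¹ * (principal e * principal e⁻¹) := by
          rw [he1, mul_one]
      _ = _ := by ring
  · rw [← q.index_scale κ a he]
    exact padicValRat_index hκ0 h'.ne_zero hle hp hM hpM hκ'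

namespace QuadBasis

variable (q : QuadBasis σ)

lemma dvd_disc_of_mem {P : Ideal (𝓞 k)} (hP : P ≠ ⊤) {p : ℕ} (hp : p.Prime)
    (hpP : (p : 𝓞 k) ∈ P) (hs : q.sInt ∈ P) : (p : ℤ) ∣ q.disc := by
  refine dvd_of_mem_ideal hP hp hpP ?_
  have : (q.disc : 𝓞 k) = q.sInt * q.sInt := by
    apply NumberField.RingOfIntegers.ext
    have := q.s_sq
    simp only [map_intCast, map_mul]
    rw [← this, _root_.sq]
    rfl
  rw [this]
  exact P.mul_mem_left _ hs

lemma mem_of_repr {p : ℕ} {P : Ideal (𝓞 k)} (hpP : (p : 𝓞 k) ∈ P) (hω : q.ωInt ∈ P) {u v : ℤ}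
    (hu : (p : ℤ) ∣ u) : (u : 𝓞 k) + v * q.ωInt ∈ P := by
  obtain ⟨u', rfl⟩ := hu
  push_cast
  exact P.add_mem (P.mul_mem_right _ hpP) (P.mul_mem_left _ hω)

lemma eq_of_ωInt_mem {p : ℕ} (hp : p.Prime) {P P' : Ideal (𝓞 k)} (hP : P ≠ ⊤)
    (hpP : (p : 𝓞 k) ∈ P) (hω : q.ωInt ∈ P) (hpP' : (p : 𝓞 k) ∈ P') (hω' : q.ωInt ∈ P') :
    P ≤ P' := by
  intro x hx
  obtain ⟨u, v, rfl⟩ := q.exists_int_repr x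
  refine q.mem_of_repr hpP' hω' (dvd_of_mem_ideal hP hp hpP ?_)
  have := P.sub_mem hx (P.mul_mem_left (v : 𝓞 k) hω)
  simpa using this

lemma sq_eq_span (q : QuadBasis σ) {p : ℕ} (hp : p.Prime) {P : Ideal (𝓞 k)}
    (hN : Ideal.absNorm P = p) (hpP2 : (p : 𝓞 k) ∈ P ^ 2) : P ^ 2 = Ideal.span {(p : 𝓞 k)} := by
  have hfin : Module.finrank ℤ (𝓞 k) = 2 := by
    rw [NumberField.RingOfIntegers.rank, Module.finrank_eq_card_basis q.basis, Fintype.card_fin]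
  obtain ⟨J, hJ⟩ := Ideal.dvd_iff_le.mpr ((Ideal.span_singleton_le_iff_mem _).mpr hpP2)
  have h2 := congrArg Ideal.absNorm hJ
  rw [map_mul, Ideal.absNorm_span_natCast, hfin, map_pow, hN] at h2
  have h3 : Ideal.absNorm J = 1 :=
    Nat.eq_of_mul_eq_mul_left (pow_pos hp.pos 2) (by rw [mul_one]; exact h2.symm)
  rw [hJ, Ideal.absNorm_eq_one_iff.mp h3, Ideal.mul_top]

end QuadBasis

variable {B : Type*} [Ring B] [Algebra ℚ B] {Q : QuatData σ B} {a : FracIdeal k} {lam : k}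

/-- If the discriminant of a pair is that of a maximal order, the second component generates the
expected module. -/
theorem generator_of_index (h : Q.IsPreadmissible a lam) (hidx : Q.q.index Q.κ a = ramProd B)
    {d₁ d₂ : Ideal (𝓞 k)} (hd : d₁ * d₂ = Ideal.span {Q.q.sInt})
    (hd₁ : Ideal.absNorm d₁ = commonRamProd B k) :
    principal lam ⊔ a = (d₂ : FracIdeal k)⁻¹ * a := by
  have hs0 : Q.q.sInt ≠ 0 := fun h0 => Q.q.s_ne_zero (congrArg (algebraMap (𝓞 k) k) h0)
  have hspan : Ideal.span {Q.q.sInt} ≠ ⊥ := by simpa using hs0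
  have hd10 : d₁ ≠ ⊥ := by rintro rfl; exact hspan (by rw [← hd, Ideal.bot_mul])
  have hd20 : d₂ ≠ ⊥ := by rintro rfl; exact hspan (by rw [← hd, Ideal.mul_bot])
  have hfin : {p | IsRamifiedAt B p ∧ IsRamifiedInField k p}.Finite :=
    (finite_isRamifiedAt h).subset fun p hp => hp.1
  have hcommon : ∀ p : ℕ, p.Prime → (p ∣ Ideal.absNorm d₁ ↔
      IsRamifiedAt B p ∧ IsRamifiedInField k p) := by
    intro p hp
    rw [hd₁]
    exact prime_dvd_finprod_primes hfin (fun _ h => h.1.1) hp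
  have hsqf : Squarefree (Ideal.absNorm d₁) := by
    rw [hd₁]; exact squarefree_finprod_primes hfin fun _ h => h.1.1
  -- The plan is to show that `E = s(λ, 𝔞)𝔞⁻¹` equals `𝔡₁`; cancelling `s = 𝔡₁𝔡₂` then gives the
  -- claim. Both ideals are shown to be squarefree with the same prime divisors.
  obtain ⟨E, hE⟩ : ∃ E : Ideal (𝓞 k),
      (E : FracIdeal k) = (principal (Q.q.s * lam) + principal Q.q.s * a) * a⁻¹ := by
    apply FractionalIdeal.le_one_iff_exists_coeIdeal.mp
    rw [← mul_inv_cancel₀ h.ne_zero]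
    refine mul_le_mul_left ?_ _
    rw [← FractionalIdeal.sup_eq_add]
    refine sup_le (FractionalIdeal.spanSingleton_le_iff_mem.mpr h.s_mul_mem) ?_
    calc principal Q.q.s * a ≤ 1 * a := mul_le_mul_left
          (FractionalIdeal.spanSingleton_le_iff_mem.mpr
            (mem_one_iff_isIntegral.mpr Q.q.isIntegral_s)) _
      _ = a := one_mul a
  have hE0 : E ≠ ⊥ := by
    rintro rfl
    have h1 : principal Q.q.s * a ≤ (principal (Q.q.s * lam) + principal Q.q.s * a) :=
      le_add_of_nonneg_left zero_le
    have h2 : (principal (Q.q.s * lam) + principal Q.q.s * a) * a⁻¹ = 0 := by rw [← hE]; simp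
    rw [(mul_eq_zero.mp h2).resolve_right (inv_ne_zero h.ne_zero)] at h1
    have h3 : principal Q.q.s * a = 0 := le_antisymm h1 zero_le
    exact mul_ne_zero (principal_ne_zero Q.q.s_ne_zero) h.ne_zero h3
  -- the ramified primes
  have hram : ∀ P : Ideal (𝓞 k), P.IsPrime → ∀ p : ℕ, p.Prime → (p : 𝓞 k) ∈ P → Q.q.sInt ∈ P →
      ∃ q : QuadBasis σ, q.s = Q.q.s ∧ q.disc = Q.q.disc ∧ (p : ℤ) ∣ q.t ∧ (p : ℤ) ∣ q.n ∧
        (p : ℤ) ∣ q.disc ∧ q.ωInt ∈ P ∧ Ideal.absNorm P = p ∧ q.IsPreadmissible Q.κ a lam := by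
    intro P hP p hp hpP hsP
    have hdisc := Q.q.dvd_disc_of_mem hP.ne_top hp hpP hsP
    obtain ⟨c, ht, hn⟩ := Q.q.exists_eisenstein_shift hp hdisc
    have hω := (Q.q.shift c).ωInt_mem ht hn hP hpP
    exact ⟨Q.q.shift c, Q.q.shift_s c, Q.q.shift_disc c, ht, hn, by rwa [Q.q.shift_disc], hω,
      (Q.q.shift c).absNorm_of_ωInt_mem hp hP.ne_top hpP hω,
        (QuadBasis.IsPreadmissible.shift c).mpr h⟩
  -- If `P ∣ E`, then `s ∈ P`, so `p` ramifies in `k`, and `z ∈ P`, so `p` divides `N(z)` and hence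
  -- `κ'`. The index being `D`, `p` ramifies in `B` as well; so `p ∣ N(𝔡₁)`, and `P` is the only
  -- prime above `p`.
  have hmemE : ∀ P : Ideal (𝓞 k), P.IsPrime → P ≠ ⊥ → P ∣ E → P ∣ d₁ := by
    intro P hP hP0 hPE
    obtain ⟨p, hp, hpP⟩ := exists_prime_mem hP hP0
    obtain ⟨a₁, z, M, κ', u, v, C, ha0, ha, hM, hpM, hE', hza, hz, hκ', hval⟩ :=
      exists_local_data Q.κ_ne h hE hp
    obtain ⟨hzP, hsP⟩ := mem_ideal_of_le ha0 ha hE' hp hM hpM (j := 1) (by simpa using hpP)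
      Q.q.isIntegral_s (Ideal.dvd_iff_le.mp hPE)
    have hsP' : Q.q.sInt ∈ P := coe_mem_coeIdeal.mp hsP
    have hdisc := Q.q.dvd_disc_of_mem hP.ne_top hp hpP hsP'
    have hκp : (p : ℤ) ∣ κ' := by
      rw [hκ']
      refine dvd_add (QuadBasis.dvd_of_mem_ideal hP.ne_top hp hpP ?_) (hdisc.mul_right _)
      have hzI : (u : 𝓞 k) + v * Q.q.ωInt ∈ P := by
        apply coe_mem_coeIdeal.mp
        rw [hz] at hzP
        simpa using hzP
      have := P.mul_mem_right (((u + v * Q.q.t : ℤ) : 𝓞 k) + ((-v : ℤ) : 𝓞 k) * Q.q.ωInt) hzI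
      convert this using 1
      simp only [normForm]
      push_cast
      linear_combination (v : 𝓞 k) ^ 2 * Q.q.ωInt_sq
    have hramB : IsRamifiedAt B p := by
      by_contra hno
      have h1 := (hval 1).mpr (by simpa using hκp)
      rw [hidx, (padicValRat_ramProd h hp).2 hno] at h1
      norm_num at h1
    have hpd : p ∣ Ideal.absNorm d₁ := (hcommon p hp).mpr ⟨hramB, Q.q.isRamifiedInField hp hdisc⟩
    obtain ⟨P', hP', hP'd⟩ : ∃ P' : Ideal (𝓞 k), (P'.IsPrime ∧ (p : 𝓞 k) ∈ P') ∧ P' ∣ d₁ := by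
      obtain ⟨P', hP', hu, hd'⟩ := Ideal.exists_isMaximal_dvd_of_dvd_absNorm' hp d₁ hpd
      refine ⟨P', ⟨hP'.isPrime, ?_⟩, hd'⟩
      have h1 : (p : ℤ) ∈ P'.under ℤ := by rw [hu]; exact Ideal.mem_span_singleton_self _
      simpa [Ideal.mem_comap] using h1
    obtain ⟨q, -, -, ht, hn, -, hω, -, -⟩ := hram P hP p hp hpP hsP'
    have := q.eq_of_ωInt_mem hp hP'.1.ne_top hP'.2 (q.ωInt_mem ht hn hP'.1 hP'.2) hpP hω
    exact Ideal.dvd_iff_le.mpr ((Ideal.dvd_iff_le.mp hP'd).trans this)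
  have hsd : ∀ P : Ideal (𝓞 k), P ∣ d₁ → Q.q.sInt ∈ P := by
    intro P hP
    have h1 : P ∣ Ideal.span {Q.q.sInt} := hP.trans (Dvd.intro _ hd)
    exact Ideal.dvd_span_singleton.mp h1
  -- Conversely `p ∣ D` gives `p ∣ κ'`. For an Eisenstein generator this forces `u² ≡ 0` modulo `p`,
  -- so `z = u + vω ∈ P`.
  have hmemd : ∀ P : Ideal (𝓞 k), P.IsPrime → P ≠ ⊥ → P ∣ d₁ → P ∣ E := by
    intro P hP hP0 hPd
    obtain ⟨p, hp, hpP⟩ := exists_prime_mem hP hP0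
    obtain ⟨q, hqs, hqd, ht, hn, hdisc, hω, hN, hq⟩ := hram P hP p hp hpP (hsd P hPd)
    rw [← hqs] at hE
    obtain ⟨a₁, z, M, κ', u, v, C, ha0, ha, hM, hpM, hE', hza, hz, hκ', hval⟩ :=
      exists_local_data Q.κ_ne hq hE hp
    have hidx' : q.index Q.κ a = ramProd B := by rw [← hidx, QuadBasis.index, QuadBasis.index, hqd]
    have hpd : p ∣ Ideal.absNorm d₁ := by
      rw [← hN]; exact Ideal.absNorm_dvd_absNorm_of_le (Ideal.dvd_iff_le.mp hPd)
    have hκp : (p : ℤ) ∣ κ' := by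
      have := (hval 1).mp (by
        rw [hidx', (padicValRat_ramProd h hp).1 ((hcommon p hp).mp hpd).1]; norm_num)
      simpa using this
    have hu : (p : ℤ) ∣ u := by
      apply (Nat.prime_iff_prime_int.mp hp).dvd_of_dvd_pow (n := 2)
      have : u ^ 2 = κ' - q.disc * C - q.t * (u * v) - q.n * v ^ 2 := by
        rw [hκ']; simp only [normForm]; push_cast; ring
      rw [this]
      exact ((hκp.sub (hdisc.mul_right _)).sub (ht.mul_right _)).sub (hn.mul_right _)
    refine Ideal.dvd_iff_le.mpr (le_ideal_of_mem ha0 hE' hp hM hpM hpP hza ?_ ?_)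
    · have := coe_mem_coeIdeal.mpr (q.mem_of_repr (v := v) hpP hω hu)
      rw [hz]; simpa using this
    · rw [hqs]
      exact coe_mem_coeIdeal.mpr (hsd P hPd)
  -- If `P² = (p)` divided `E`, both `z` and `s` would be divisible by `p`, so `p²` would divide
  -- `κ'`; but the index `D` is squarefree.
  have hEsq : Squarefree E := by
    refine squarefree_ideal hE0 fun P hP hP0 hPE => ?_
    obtain ⟨p, hp, hpP⟩ := exists_prime_mem hP hP0
    have hsP : Q.q.sInt ∈ P := hsd P (hmemE P hP hP0 ((dvd_pow_self P two_ne_zero).trans hPE))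
    obtain ⟨q, hqs, hqd, ht, hn, hdisc, hω, hN, hq⟩ := hram P hP p hp hpP hsP
    rw [← hqs] at hE
    obtain ⟨a₁, z, M, κ', u, v, C, ha0, ha, hM, hpM, hE', hza, hz, hκ', hval⟩ :=
      exists_local_data Q.κ_ne hq hE hp
    have hidx' : q.index Q.κ a = ramProd B := by rw [← hidx, QuadBasis.index, QuadBasis.index, hqd]
    have hpP2 := q.natCast_mem_sq hp ht hn hP hpP
    have hP2 := q.sq_eq_span hp hN hpP2
    obtain ⟨hzP, hsP2⟩ := mem_ideal_of_le ha0 ha hE' hp hM hpM (j := 1) (by simpa using hpP2)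
      q.isIntegral_s (Ideal.dvd_iff_le.mp hPE)
    rw [hP2] at hzP hsP2
    have hzI : (u : 𝓞 k) + v * q.ωInt ∈ Ideal.span {(p : 𝓞 k)} := by
      apply coe_mem_coeIdeal.mp
      rw [hz] at hzP
      simpa using hzP
    obtain ⟨⟨u', hu⟩, ⟨v', hv⟩⟩ := q.dvd_of_natCast_dvd (Ideal.mem_span_singleton.mp hzI)
    have hsI : ((-q.t : ℤ) : 𝓞 k) + ((2 : ℤ) : 𝓞 k) * q.ωInt ∈ Ideal.span {(p : 𝓞 k)} := by
      apply coe_mem_coeIdeal.mp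
      convert hsP2 using 1
      rw [QuadBasis.s]
      simp only [map_add, map_mul, map_intCast, QuadBasis.coe_ωInt]
      push_cast
      ring
    obtain ⟨⟨t', ht'⟩, ⟨w, hw⟩⟩ := q.dvd_of_natCast_dvd (Ideal.mem_span_singleton.mp hsI)
    have hκp : (p : ℤ) ^ 2 ∣ κ' := by
      refine ⟨normForm q.t q.n u' v' + (t' ^ 2 - w ^ 2 * q.n) * C, ?_⟩
      rw [hκ', hu, hv, QuadBasis.disc, show (4 : ℤ) = (p * w) ^ 2 by rw [← hw]; norm_num,
        show q.t ^ 2 = (p * t') ^ 2 by rw [← ht']; ring]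
      simp only [normForm]
      push_cast
      ring
    have h1 := (hval 2).mpr hκp
    rw [hidx'] at h1
    by_cases hr : IsRamifiedAt B p
    · rw [(padicValRat_ramProd h hp).1 hr] at h1; norm_num at h1
    · rw [(padicValRat_ramProd h hp).2 hr] at h1; norm_num at h1
  -- `P² ∣ 𝔡₁` would give `p² ∣ N(𝔡₁)`, whereas that norm is a product of distinct primes.
  have hdsq : Squarefree d₁ := by
    refine squarefree_ideal hd10 fun P hP hP0 hPd => ?_
    obtain ⟨p, hp, hpP⟩ := exists_prime_mem hP hP0
    have hsP : Q.q.sInt ∈ P := hsd P ((dvd_pow_self P two_ne_zero).trans hPd)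
    obtain ⟨q, -, -, -, -, -, -, hN, -⟩ := hram P hP p hp hpP hsP
    have h1 := Ideal.absNorm_dvd_absNorm_of_le (Ideal.dvd_iff_le.mp hPd)
    rw [map_pow, hN, sq] at h1
    exact hp.one_lt.ne' (Nat.isUnit_iff.mp (hsqf p h1))
  have hEd : E = d₁ := associated_iff_eq.mp (associated_of_dvd_dvd
    (dvd_of_squarefree_ideal hEsq hd10 hmemE) (dvd_of_squarefree_ideal hdsq hE0 hmemd))
  have hss : principal Q.q.s = (d₁ : FracIdeal k) * (d₂ : FracIdeal k) := by
    rw [← FractionalIdeal.coeIdeal_mul, hd, FractionalIdeal.coeIdeal_span_singleton]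
    rfl
  have hd1' : (d₁ : FracIdeal k) ≠ 0 := by simpa using hd10
  have hd2' : (d₂ : FracIdeal k) ≠ 0 := by simpa using hd20
  have h1 : (d₁ : FracIdeal k) * a = principal Q.q.s * (principal lam + a) := by
    rw [← hEd, hE, mul_assoc, inv_mul_cancel₀ h.ne_zero, mul_one, mul_add,
      FractionalIdeal.spanSingleton_mul_spanSingleton]
  rw [FractionalIdeal.sup_eq_add]
  rw [hss, mul_assoc] at h1
  have h2 := mul_left_cancel₀ hd1' h1
  conv_rhs => rw [h2, ← mul_assoc, inv_mul_cancel₀ hd2', one_mul]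

end Generator

/-! ### Admissible pairs and maximal orders -/

section Admissible

variable {k : Type*} [Field k] [NumberField k] {σ : k ≃ₐ[ℚ] k}
  {B : Type*} [Ring B] [Algebra ℚ B] {Q : QuatData σ B} {a : FracIdeal k} {lam : k}
  {d₁ d₂ : Ideal (𝓞 k)}

variable (B) in
lemma ramProd_pos : 0 < ramProd B := by
  refine Nat.pos_of_ne_zero ?_
  exact finprod_mem_induction (s := {p | IsRamifiedAt B p}) (· ≠ 0) one_ne_zero
    (fun _ _ => mul_ne_zero) (fun p hp => (hp.1.ne_zero : p ≠ 0))

namespace QuadBasis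

variable (q : QuadBasis σ)

lemma ideal_ne_bot_of_mul_eq (hd : d₁ * d₂ = Ideal.span {q.sInt}) : d₂ ≠ ⊥ := by
  rintro rfl
  rw [Ideal.mul_bot, eq_comm, Ideal.span_singleton_eq_bot] at hd
  exact q.s_ne_zero (congrArg (algebraMap (𝓞 k) k) hd)

lemma s_mul_mem_of_mem (hd : d₁ * d₂ = Ideal.span {q.sInt}) (h : lam ∈ (d₂ : FracIdeal k)⁻¹ * a) :
    q.s * lam ∈ a := by
  have hd2 : (d₂ : FracIdeal k) ≠ 0 := by simpa using q.ideal_ne_bot_of_mul_eq hd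
  have h1 : q.s ∈ (d₂ : FracIdeal k) := by
    have h2 : q.sInt ∈ d₁ * d₂ := by rw [hd]; exact Ideal.mem_span_singleton_self _
    have hle : d₁ * d₂ ≤ d₂ := Ideal.dvd_iff_le.mp (dvd_mul_left d₂ d₁)
    have h3 : q.sInt ∈ d₂ := hle h2
    exact coe_mem_coeIdeal.mpr h3
  have := mem_mul_of_mem h1 h
  rwa [← mul_assoc, mul_inv_cancel₀ hd2, one_mul] at this

end QuadBasis

lemma IsAdmissible.mem {κ : ℚ} (h : IsAdmissible B κ d₂ a lam) : lam ∈ (d₂ : FracIdeal k)⁻¹ * a :=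
    by
  rw [← h.generator]
  exact (le_sup_left : principal lam ≤ _) (FractionalIdeal.mem_spanSingleton_self _ lam)

/-- The generator condition is traded for `sλ ∈ 𝔞`: it implies this because `s ∈ 𝔡₂`, and it follows
from it once the index is `D`. -/
lemma isAdmissible_iff (hd : d₁ * d₂ = Ideal.span {Q.q.sInt})
    (hd₁ : Ideal.absNorm d₁ = commonRamProd B k) : IsAdmissible B Q.κ d₂ a lam ↔
      Q.IsPreadmissible a lam ∧ Q.q.index Q.κ a = ramProd B := by
  constructor
  · intro h
    have ha : a ≠ 0 := by
      rintro rfl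
      have h1 := h.norm_ideal
      rw [Q.q.abs_discr, map_zero, eq_comm, div_eq_zero_iff] at h1
      have h2 := Q.κ_ne
      have h3 := Q.q.disc_ne_zero
      have h4 := (ramProd_pos B).ne'
      simp_all
    have hpre : Q.IsPreadmissible a lam := ⟨ha, Q.q.s_mul_mem_of_mem hd h.mem, h.norm_congr⟩
    exact ⟨hpre, (absNorm_eq_iff hpre).mp h.norm_ideal⟩
  · rintro ⟨h, hidx⟩
    exact ⟨(absNorm_eq_iff h).mpr hidx, generator_of_index h hidx hd hd₁, h.norm_congr⟩

lemma classicalOrder_eq_of_isAdmissible (hd : d₁ * d₂ = Ideal.span {Q.q.sInt})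
    (h : IsAdmissible B Q.κ d₂ a lam) : classicalOrder Q.i Q.δ d₂ a lam = Q.pairOrder a lam :=
  Q.classicalOrder_eq h.mem (by simpa using Q.q.ideal_ne_bot_of_mul_eq hd)

lemma mem_maxOrders_iff {L : Submodule ℤ B} : L ∈ MaxOrders Q.i ↔
    ∃ (a : FracIdeal k) (lam : k), (Q.IsPreadmissible a lam ∧ Q.q.index Q.κ a = ramProd B) ∧
      L = Q.pairOrder a lam := by
  constructor
  · rintro ⟨hmax, hk⟩
    obtain ⟨a, lam, h, rfl⟩ := Q.exists_pair hmax.1 hk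
    exact ⟨a, lam, ⟨h, index_of_isMaximalOrder h hmax⟩, rfl⟩
  · rintro ⟨a, lam, ⟨h, hidx⟩, rfl⟩
    exact ⟨isMaximalOrder_of_index h hidx, fun x => Q.i_mem_pairOrder⟩

lemma pairOrder_congr (h : Q.IsPreadmissible a lam) {lam' : k} (hl : lam' - lam ∈ a) :
    Q.pairOrder a lam' = Q.pairOrder a lam := by
  have hl' : lam - lam' ∈ a := by
    have := frac_neg_mem hl
    rwa [neg_sub] at this
  exact le_antisymm ((Q.pairOrder_le_iff h.ne_zero h.ne_zero).mpr ⟨le_rfl, hl'⟩)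
    ((Q.pairOrder_le_iff h.ne_zero h.ne_zero).mpr ⟨le_rfl, hl⟩)

end Admissible

/-! ### Lattices in adelic spaces -/

section Adele

/-- The component of a finite adele at a place. -/
noncomputable def evalAt (v : HeightOneSpectrum ℤ) : FinAdele →ₐ[ℚ] v.adicCompletion ℚ where
  toFun x := x v
  map_one' := rfl
  map_mul' _ _ := rfl
  map_zero' := rfl
  map_add' _ _ := rfl
  commutes' _ := rfl

lemma evalAt_apply (v : HeightOneSpectrum ℤ) (x : FinAdele) : evalAt v x = x v := rfl

lemma valuation_eq_one_of_notMem {v : HeightOneSpectrum ℤ} {m : ℤ} (hm : m ∉ v.asIdeal) :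
    v.valuation ℚ (m : ℚ) = 1 := by
  exact (v.valuation_of_algebraMap (K := ℚ) m).trans
    (HeightOneSpectrum.intValuation_eq_one_iff.mpr hm)

/-- A rational number with denominator prime to a place is integral there. -/
lemma algebraMap_mem_of_int_mul {v : HeightOneSpectrum ℤ} {m c : ℤ} {x : ℚ} (hm : m ∉ v.asIdeal)
    (h : (m : ℚ) * x = c) : algebraMap ℚ (v.adicCompletion ℚ) x ∈ v.adicCompletionIntegers ℚ := by
  rw [HeightOneSpectrum.mem_adicCompletionIntegers]
  refine (HeightOneSpectrum.valuedAdicCompletion_eq_valuation' v x).trans_le ?_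
  have h1 := congrArg (v.valuation ℚ) h
  rw [map_mul, valuation_eq_one_of_notMem hm, one_mul] at h1
  rw [h1]
  have := v.valuation_le_one (K := ℚ) c
  simpa using this

/-- Density of `ℚ` in the completion, together with openness of the ring of integers. -/
lemma exists_rat_sub_mem (v : HeightOneSpectrum ℤ) (a : v.adicCompletion ℚ) :
    ∃ x : ℚ, a - algebraMap ℚ _ x ∈ v.adicCompletionIntegers ℚ := by
  have hopen : IsOpen ((fun y => a - y) ⁻¹' (v.adicCompletionIntegers ℚ : Set
      (v.adicCompletion ℚ))) := by
    refine IsOpen.preimage (by fun_prop) ?_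
    exact Valued.isOpen_valuationSubring _
  have hmem : a ∈ (fun y => a - y) ⁻¹' (v.adicCompletionIntegers ℚ : Set (v.adicCompletion ℚ)) := by
    rw [Set.mem_preimage, sub_self]
    exact zero_mem (v.adicCompletionIntegers ℚ)
  have hd : DenseRange (algebraMap ℚ (v.adicCompletion ℚ)) :=
    HeightOneSpectrum.denseRange_algebraMap (R := ℤ) ℚ v
  exact hd.exists_mem_open hopen ⟨a, hmem⟩

/-- The partial fraction decomposition of a rational number at a place. -/
lemma exists_partial_fraction (v : HeightOneSpectrum ℤ) (x : ℚ) :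
    ∃ r : ℚ, (∃ m c : ℤ, m ∉ v.asIdeal ∧ m * (x - r) = c) ∧
      ∀ w : HeightOneSpectrum ℤ, w ≠ v → ∃ m c : ℤ, m ∉ w.asIdeal ∧ m * r = c := by
  obtain ⟨π, hπ⟩ := (IsPrincipalIdealRing.principal v.asIdeal).principal
  have hπ' : v.asIdeal = Ideal.span {π} := hπ
  have hπ0 : π ≠ 0 := by
    rintro rfl
    exact v.ne_bot (by rw [hπ']; simp)
  have hprime : Prime π := by
    rw [← Ideal.span_singleton_prime hπ0, ← hπ']
    exact v.isPrime
  have hden : (x.den : ℤ) ≠ 0 := by exact_mod_cast x.den_ne_zero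
  obtain ⟨d, hxd, hd⟩ :=
    (FiniteMultiplicity.of_prime_left hprime hden).exists_eq_pow_mul_and_not_dvd
  set e := multiplicity π (x.den : ℤ)
  -- With denominator `π^e d` and `uπ^e + wd = 1`, split `x = num·w/π^e + num·u/d`. The first term
  -- is integral away from `v`, the second at `v`.
  obtain ⟨u, w, huw⟩ := ((hprime.coprime_iff_not_dvd).mpr hd).pow_left (m := e)
  have hd0 : (d : ℚ) ≠ 0 := by
    rintro h0
    exact hd (by rw [show d = 0 by exact_mod_cast h0]; exact dvd_zero π)
  have hπq : (π : ℚ) ^ e ≠ 0 := pow_ne_zero _ (by exact_mod_cast hπ0)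
  have hx : x * (π ^ e * d) = x.num := by
    have h1 := Rat.mul_den_eq_num x
    have h2 : (x.den : ℚ) = π ^ e * d := by exact_mod_cast hxd
    rwa [h2] at h1
  have huw' : (u : ℚ) * π ^ e + w * d = 1 := by exact_mod_cast huw
  refine ⟨x.num * w / π ^ e, ⟨d, x.num * u, ?_, ?_⟩, fun v' hv' => ⟨π ^ e, x.num * w, ?_, ?_⟩⟩
  · rwa [hπ', Ideal.mem_span_singleton]
  · push_cast
    rw [← hx]
    have h2 : x * (π ^ e * d) * w / π ^ e = x * d * w := by field_simp
    rw [h2]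
    linear_combination -(x * d) * huw'
  · intro hmem
    apply hv'
    have h1 : v.asIdeal ≤ v'.asIdeal := by
      rw [hπ', Ideal.span_singleton_le_iff_mem]
      exact v'.isPrime.mem_of_pow_mem _ hmem
    exact (HeightOneSpectrum.ext (v.isMaximal.eq_of_le v'.isPrime.ne_top h1)).symm
  · push_cast
    field_simp

/-- Strong approximation `𝔸_f = ℚ + Ẑ`, by induction on the places where `a` is not integral:
subtracting the polar part at one place does not disturb the others. -/
lemma exists_rat_sub_mem_zHat (a : FinAdele) : ∃ r : ℚ, a - algebraMap ℚ FinAdele r ∈ zHat := by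
  classical
  have key : ∀ (S : Finset (HeightOneSpectrum ℤ)) (a : FinAdele),
      (∀ v ∉ S, a v ∈ v.adicCompletionIntegers ℚ) →
      ∃ r : ℚ, a - algebraMap ℚ FinAdele r ∈ zHat := by
    intro S
    induction S using Finset.induction with
    | empty => exact fun a h => ⟨0, fun v => by rw [map_zero, sub_zero]; exact h v (by simp)⟩
    | insert v S hv ih =>
      intro a ha
      obtain ⟨x, hx⟩ := exists_rat_sub_mem v (a v)
      obtain ⟨r, ⟨m, c, hm, hmc⟩, hr⟩ := exists_partial_fraction v x
      obtain ⟨r', hr'⟩ := ih (a - algebraMap ℚ FinAdele r) fun w hw => by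
        change a w - algebraMap ℚ _ r ∈ _
        by_cases hwv : w = v
        · subst hwv
          have h1 := algebraMap_mem_of_int_mul hm hmc
          rw [map_sub] at h1
          have := add_mem hx h1
          rwa [sub_add_sub_cancel] at this
        · obtain ⟨m', c', hm', hmc'⟩ := hr w hwv
          exact sub_mem (ha w (by simp [hwv, hw])) (algebraMap_mem_of_int_mul hm' hmc')
      refine ⟨r + r', ?_⟩
      rwa [map_add, ← sub_sub]
  have hfin : {v : HeightOneSpectrum ℤ | a v ∉ v.adicCompletionIntegers ℚ}.Finite := a.2
  exact key hfin.toFinset a fun v hv => by simpa using hv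

end Adele

/-! ### Completions of lattices and strong approximation -/

section Hat

variable {V W : Type*} [AddCommGroup V] [Module ℚ V] [AddCommGroup W] [Module ℚ W]

lemma tmul_mem_hat {L : Submodule ℤ V} {x : V} (hx : x ∈ L) {z : FinAdele} (hz : z ∈ zHat) :
    x ⊗ₜ[ℚ] z ∈ hat L := Submodule.subset_span ⟨x, hx, z, hz, rfl⟩

lemma tmul_one_mem_hat {L : Submodule ℤ V} {x : V} (hx : x ∈ L) :
    x ⊗ₜ[ℚ] (1 : FinAdele) ∈ hat L := tmul_mem_hat hx (one_mem _)

lemma hat_map {L : Submodule ℤ V} {L' : Submodule ℤ W} (f : V →ₗ[ℚ] W) (h : ∀ x ∈ L, f x ∈ L')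
    {y : V ⊗[ℚ] FinAdele} (hy : y ∈ hat L) : f.rTensor FinAdele y ∈ hat L' := by
  refine Submodule.span_induction ?_ ?_ ?_ ?_ hy
  · rintro _ ⟨x, hx, z, hz, rfl⟩
    rw [LinearMap.rTensor_tmul]
    exact tmul_mem_hat (h x hx) hz
  · simp
  · intro x y _ _ hx hy; rw [map_add]; exact add_mem hx hy
  · intro n x _ hx; rw [map_zsmul]; exact Submodule.smul_mem _ n hx

lemma hat_mono {L L' : Submodule ℤ V} (h : L ≤ L') : hat L ≤ hat L' := by
  intro y hy
  have := hat_map (L' := L') LinearMap.id (fun x hx => h hx) hy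
  simpa using this

/-- Strong approximation: every adelic vector is rational up to a full lattice. -/
lemma exists_sub_mem_hat {L : Submodule ℤ V} (hL : ∀ x : V, ∃ m : ℤ, m ≠ 0 ∧ m • x ∈ L)
    (y : V ⊗[ℚ] FinAdele) : ∃ x : V, y - x ⊗ₜ 1 ∈ hat L := by
  induction y using TensorProduct.induction_on with
  | zero => exact ⟨0, by simp⟩
  | tmul x a =>
    obtain ⟨m, hm, hmx⟩ := hL x
    obtain ⟨r, hr⟩ := exists_rat_sub_mem_zHat ((m : ℚ)⁻¹ • a)
    have hmq : (m : ℚ) ≠ 0 := by exact_mod_cast hm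
    refine ⟨(m * r : ℚ) • x, ?_⟩
    have h1 : x ⊗ₜ[ℚ] a - ((m * r : ℚ) • x) ⊗ₜ[ℚ] (1 : FinAdele) =
        (m • x) ⊗ₜ[ℚ] ((m : ℚ)⁻¹ • a - algebraMap ℚ FinAdele r) := by
      rw [TensorProduct.tmul_sub, ← Int.cast_smul_eq_zsmul ℚ, Algebra.algebraMap_eq_smul_one,
        TensorProduct.tmul_smul, TensorProduct.tmul_smul, ← TensorProduct.smul_tmul',
        ← TensorProduct.smul_tmul', smul_smul, inv_mul_cancel₀ hmq, one_smul,
        ← TensorProduct.smul_tmul', smul_smul, mul_comm r]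
    rw [h1]
    exact tmul_mem_hat hmx hr
  | add y y' hy hy' =>
    obtain ⟨x, hx⟩ := hy
    obtain ⟨x', hx'⟩ := hy'
    refine ⟨x + x', ?_⟩
    rw [TensorProduct.add_tmul, add_sub_add_comm]
    exact add_mem hx hx'

end Hat

/-! ### Ideles and fractional ideals -/

section IdealHat

variable {k : Type*} [Field k] [NumberField k]

/-- The completion of a fractional ideal. -/
noncomputable abbrev hatI (I : FracIdeal k) : Submodule ℤ (FinAdeleOf k) :=
  hat ((I : Submodule (𝓞 k) k).restrictScalars ℤ)

lemma hatI_one : hatI (1 : FracIdeal k) = hat (intSubmodule k) := by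
  have : ((1 : FracIdeal k) : Submodule (𝓞 k) k).restrictScalars ℤ = intSubmodule k := by
    ext x
    exact mem_one_iff_isIntegral
  rw [hatI, this]

lemma tmul_one_mem_hatI {I : FracIdeal k} {x : k} (hx : x ∈ I) : x ⊗ₜ[ℚ] (1 : FinAdele) ∈ hatI I :=
  tmul_one_mem_hat (L := (I : Submodule (𝓞 k) k).restrictScalars ℤ) hx

lemma hatI_mono {I J : FracIdeal k} (h : I ≤ J) : hatI I ≤ hatI J :=
  hat_mono fun _ hx => h hx

lemma hatI_mul_mem {I J : FracIdeal k} {s t : FinAdeleOf k} (hs : s ∈ hatI I) (ht : t ∈ hatI J) :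
    s * t ∈ hatI (I * J) := by
  refine Submodule.span_induction (p := fun s _ => s * t ∈ hatI (I * J)) ?_ ?_ ?_ ?_ hs
  · rintro _ ⟨x, hx, z, hz, rfl⟩
    refine Submodule.span_induction
      (p := fun t _ => x ⊗ₜ[ℚ] z * t ∈ hatI (I * J)) ?_ ?_ ?_ ?_ ht
    · rintro _ ⟨y, hy, w, hw, rfl⟩
      rw [Algebra.TensorProduct.tmul_mul_tmul]
      exact tmul_mem_hat (L := ((I * J : FracIdeal k) : Submodule (𝓞 k) k).restrictScalars ℤ)
        (mem_mul_of_mem hx hy) (mul_mem hz hw)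
    · simp
    · intro s t _ _ h1 h2; rw [mul_add]; exact add_mem h1 h2
    · intro n s _ h1; rw [mul_smul_comm]; exact Submodule.smul_mem _ n h1
  · simp
  · intro s t _ _ h1 h2; rw [add_mul]; exact add_mem h1 h2
  · intro n s _ h1; rw [smul_mul_assoc]; exact Submodule.smul_mem _ n h1

lemma isIntegral_of_mem_hatI {x : k} (h : x ⊗ₜ[ℚ] (1 : FinAdele) ∈ hatI (1 : FracIdeal k)) :
    IsIntegral ℤ x := mem_of_mem_hat_int (hatI_one (k := k) ▸ h)

/-- Multiplying by `I⁻¹` reduces to `I = O_k`, where integral coordinates can be compared. -/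
lemma mem_of_mem_hatI {I : FracIdeal k} (hI : I ≠ 0) {x : k}
    (h : x ⊗ₜ[ℚ] (1 : FinAdele) ∈ hatI I) : x ∈ I := by
  refine mem_of_forall_mem_inv hI fun y hy => isIntegral_of_mem_hatI ?_
  have := hatI_mul_mem h (tmul_one_mem_hatI hy)
  rwa [mul_inv_cancel₀ hI, Algebra.TensorProduct.tmul_mul_tmul, mul_one] at this

lemma conjT_eq_rTensor {σ : k ≃ₐ[ℚ] k} (y : FinAdeleOf k) :
    conjT σ FinAdele y = σ.toLinearMap.rTensor FinAdele y := by
  induction y using TensorProduct.induction_on with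
  | zero => simp
  | tmul x f => simp
  | add x y hx hy => simp [hx, hy]

lemma conjT_mem_hatI {σ : k ≃ₐ[ℚ] k} {I : FracIdeal k} {y : FinAdeleOf k} (hy : y ∈ hatI I) :
    conjT σ FinAdele y ∈ hatI (conjIdeal σ I) := by
  have h1 := hat_map (L' := ((conjIdeal σ I : FracIdeal k) : Submodule (𝓞 k) k).restrictScalars ℤ)
    σ.toLinearMap (fun x hx => conj_mem_conjIdeal hx) hy
  rwa [← conjT_eq_rTensor] at h1

/-- A finite idele generates the completion of a fractional ideal. -/
structure Represents (b : (FinAdeleOf k)ˣ) (I : FracIdeal k) : Prop where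
  ne_zero : I ≠ 0
  mem : (b : FinAdeleOf k) ∈ hatI I
  inv_mem : ((b⁻¹ : (FinAdeleOf k)ˣ) : FinAdeleOf k) ∈ hatI I⁻¹

lemma Represents.mul {b c : (FinAdeleOf k)ˣ} {I J : FracIdeal k} (hb : Represents b I)
    (hc : Represents c J) : Represents (b * c) (I * J) where
  ne_zero := mul_ne_zero hb.ne_zero hc.ne_zero
  mem := by rw [Units.val_mul]; exact hatI_mul_mem hb.mem hc.mem
  inv_mem := by
    rw [_root_.mul_inv, mul_inv, Units.val_mul]
    exact hatI_mul_mem hb.inv_mem hc.inv_mem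

lemma Represents.inv {b : (FinAdeleOf k)ˣ} {I : FracIdeal k} (hb : Represents b I) :
    Represents b⁻¹ I⁻¹ where
  ne_zero := inv_ne_zero hb.ne_zero
  mem := hb.inv_mem
  inv_mem := by rw [inv_inv, inv_inv]; exact hb.mem

lemma Represents.conj {σ : k ≃ₐ[ℚ] k} (q : QuadBasis σ) {b : (FinAdeleOf k)ˣ} {I : FracIdeal k}
    (hb : Represents b I) : Represents (conjIdele σ b) (conjIdeal σ I) where
  ne_zero := conjIdeal_ne_zero hb.ne_zero
  mem := conjT_mem_hatI hb.mem
  inv_mem := by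
    rw [← map_inv, ← conjIdeal_inv q]
    exact conjT_mem_hatI hb.inv_mem

lemma mem_ideleIdeal {b : (FinAdeleOf k)ˣ} {x : k} : x ∈ ideleIdeal b ↔
    (↑b⁻¹ : FinAdeleOf k) * (x ⊗ₜ[ℚ] (1 : FinAdele)) ∈ hatI (1 : FracIdeal k) := by
  rw [hatI_one]; rfl

lemma Represents.ideleIdeal_eq {b : (FinAdeleOf k)ˣ} {I : FracIdeal k} (hb : Represents b I) :
    ideleIdeal b = I := by
  ext x
  rw [mem_ideleIdeal]
  constructor
  · intro h
    have := hatI_mul_mem hb.mem h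
    rw [mul_one, Units.mul_inv_cancel_left] at this
    exact mem_of_mem_hatI hb.ne_zero this
  · intro h
    have := hatI_mul_mem hb.inv_mem (tmul_one_mem_hatI h)
    rwa [inv_mul_cancel₀ hb.ne_zero] at this

lemma intCast_eq_tmul (m : ℤ) : (m : FinAdeleOf k) = (m : k) ⊗ₜ[ℚ] (1 : FinAdele) := by
  rw [← map_intCast (Algebra.TensorProduct.includeLeft : k →ₐ[ℚ] k ⊗[ℚ] FinAdele) m,
    Algebra.TensorProduct.includeLeft_apply]

lemma exists_int_smul_mem_fracIdeal {I : FracIdeal k} (hI : I ≠ 0) (x : k) :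
    ∃ m : ℤ, m ≠ 0 ∧ m • x ∈ (I : Submodule (𝓞 k) k).restrictScalars ℤ := by
  obtain ⟨m, hm, h⟩ := exists_int_mul_mem hI x
  exact ⟨m, hm, by rw [zsmul_eq_mul]; exact h⟩

/-- Choose `m ≠ 0` with `mb⁻¹` integral, so that `m` lies in the ideal of `b`. Approximate `b` by
some `x ∈ k` modulo the completion of `(m)`; then `b⁻¹x = 1 - b⁻¹(b - x)` is integral, so `x` and `b
- x` both lie in the required completion. -/
lemma mem_hatI_ideleIdeal (b : (FinAdeleOf k)ˣ) :
    ideleIdeal b ≠ 0 ∧ (b : FinAdeleOf k) ∈ hatI (ideleIdeal b) := by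
  obtain ⟨m, hm, h⟩ := int_denominator ((b⁻¹ : (FinAdeleOf k)ˣ) : FinAdeleOf k)
  rw [← hatI_one] at h
  have hmk : (m : k) ≠ 0 := by exact_mod_cast hm
  have hle : principal (m : k) ≤ ideleIdeal b := by
    rw [FractionalIdeal.spanSingleton_le_iff_mem, mem_ideleIdeal, mul_comm, ← intCast_eq_tmul]
    exact h
  have hne : ideleIdeal b ≠ 0 := by
    intro h0
    rw [h0] at hle
    exact principal_ne_zero hmk (le_antisymm hle zero_le)
  refine ⟨hne, ?_⟩
  obtain ⟨x, hx⟩ := exists_sub_mem_hat (exists_int_smul_mem_fracIdeal (principal_ne_zero hmk))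
    (b : FinAdeleOf k)
  have hx' : x ∈ ideleIdeal b := by
    rw [mem_ideleIdeal]
    have h1 : ((b⁻¹ : (FinAdeleOf k)ˣ) : FinAdeleOf k) * ((b : FinAdeleOf k) - x ⊗ₜ 1) ∈ hatI (1 :
        FracIdeal k) := by
      have hxI : (b : FinAdeleOf k) - x ⊗ₜ 1 ∈ hatI (principal (m : k)) := hx
      have h2 := hatI_mul_mem (tmul_one_mem_hatI (I := principal (m : k)⁻¹)
        (FractionalIdeal.mem_spanSingleton_self _ _)) hxI
      rw [FractionalIdeal.spanSingleton_mul_spanSingleton, inv_mul_cancel₀ hmk,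
        FractionalIdeal.spanSingleton_one] at h2
      have h3 := hatI_mul_mem h h2
      rw [mul_one] at h3
      convert h3 using 1
      rw [intCast_eq_tmul, mul_comm ((m : k) ⊗ₜ[ℚ] (1 : FinAdele)), mul_assoc, ← mul_assoc
        (_ ⊗ₜ[ℚ] _),
        Algebra.TensorProduct.tmul_mul_tmul, mul_inv_cancel₀ hmk, mul_one,
        ← Algebra.TensorProduct.one_def, one_mul]
    rw [mul_sub, Units.inv_mul] at h1
    have h2 : (1 : FinAdeleOf k) ∈ hatI (1 : FracIdeal k) :=
      tmul_one_mem_hatI (mem_one_iff_isIntegral.mpr isIntegral_one)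
    have := sub_mem h2 h1
    rwa [sub_sub_cancel] at this
  have := add_mem (hatI_mono hle hx) (tmul_one_mem_hatI hx')
  rwa [sub_add_cancel] at this

lemma represents_ideleIdeal (b : (FinAdeleOf k)ˣ) : Represents b (ideleIdeal b) := by
  obtain ⟨hne, hmem⟩ := mem_hatI_ideleIdeal b
  obtain ⟨hne', hmem'⟩ := mem_hatI_ideleIdeal b⁻¹
  refine ⟨hne, hmem, hatI_mono ?_ hmem'⟩
  intro x hx
  rw [mem_inv_iff_isIntegral hne]
  intro y hy
  rw [mem_ideleIdeal, inv_inv] at hx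
  rw [mem_ideleIdeal] at hy
  have := hatI_mul_mem hx hy
  rw [mul_one, mul_mul_mul_comm, Units.mul_inv, one_mul, Algebra.TensorProduct.tmul_mul_tmul,
    mul_one] at this
  exact isIntegral_of_mem_hatI this

lemma ideleIdeal_mul (b c : (FinAdeleOf k)ˣ) :
    ideleIdeal (b * c) = ideleIdeal b * ideleIdeal c :=
  ((represents_ideleIdeal b).mul (represents_ideleIdeal c)).ideleIdeal_eq

lemma ideleIdeal_one : ideleIdeal (1 : (FinAdeleOf k)ˣ) = 1 := by
  refine Represents.ideleIdeal_eq ⟨one_ne_zero, ?_, ?_⟩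
  · exact tmul_one_mem_hatI (mem_one_iff_isIntegral.mpr isIntegral_one)
  · rw [inv_one, inv_one]
    exact tmul_one_mem_hatI (mem_one_iff_isIntegral.mpr isIntegral_one)

end IdealHat

/-! ### Conjugation by ideles -/

section Conjugation

variable {k : Type*} [Field k] [NumberField k] {σ : k ≃ₐ[ℚ] k}
  {B : Type*} [Ring B] [Algebra ℚ B] (Q : QuatData σ B)

namespace QuatData

/-- The lattice is the direct sum of `O_k` and the lift `b ↦ -λb + bδ` of `𝔞⁻¹`, so its completion
is cut out by the completed conditions. -/
lemma mem_hat_pairOrder {a : FracIdeal k} {lam : k} {y : B ⊗[ℚ] FinAdele} :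
    y ∈ hat (Q.pairOrder a lam) ↔ Q.sndT FinAdele y ∈ hatI a⁻¹ ∧
      Q.fstT FinAdele y + (lam ⊗ₜ 1) * Q.sndT FinAdele y ∈ hatI (1 : FracIdeal k) := by
  constructor
  · intro hy
    constructor
    · exact hat_map (L' := ((a⁻¹ : FracIdeal k) : Submodule (𝓞 k) k).restrictScalars ℤ) Q.snd
        (fun x (hx : x ∈ Q.pairOrder a lam) => hx.1) hy
    · have h1 := hat_map (L' := ((1 : FracIdeal k) : Submodule (𝓞 k) k).restrictScalars ℤ)
        (Q.fst + LinearMap.mulLeft ℚ lam ∘ₗ Q.snd)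
        (fun x (hx : x ∈ Q.pairOrder a lam) => mem_one_iff_isIntegral.mpr hx.2) hy
      convert h1 using 1
      clear hy h1
      induction y using TensorProduct.induction_on with
      | zero => simp
      | tmul x f => simp
      | add x y hx hy => simp only [map_add, mul_add, ← hx, ← hy]; abel
  · rintro ⟨hv, hw⟩
    set v := Q.sndT FinAdele y with hvdef
    set w := Q.fstT FinAdele y + (lam ⊗ₜ 1) * v with hwdef
    have h1 := hat_map (L' := Q.pairOrder a lam) Q.i.toLinearMap
      (fun x hx => Q.i_mem_pairOrder.mpr (mem_one_iff_isIntegral.mp hx)) hw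
    have h2 := hat_map (L' := Q.pairOrder a lam)
      (Q.ofPair ∘ₗ (LinearMap.mulLeft ℚ (-lam)).prod LinearMap.id)
      (fun x hx => Q.section_mem_pairOrder lam hx) hv
    have e1 : ∀ w : FinAdeleOf k, Q.i.toLinearMap.rTensor FinAdele w = Q.iT FinAdele w := by
      intro w
      induction w using TensorProduct.induction_on with
      | zero => simp
      | tmul x f => simp
      | add x y hx hy => simp [hx, hy]
    have e2 : ∀ v : FinAdeleOf k,
        (Q.ofPair ∘ₗ (LinearMap.mulLeft ℚ (-lam)).prod LinearMap.id).rTensor FinAdele v =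
          Q.iT FinAdele (-(lam ⊗ₜ 1) * v) + Q.iT FinAdele v * Q.δT FinAdele := by
      intro v
      induction v using TensorProduct.induction_on with
      | zero => simp
      | tmul x f =>
        rw [LinearMap.rTensor_tmul, iT_mul_δT, ← TensorProduct.neg_tmul,
          Algebra.TensorProduct.tmul_mul_tmul, one_mul, iT_tmul, ← TensorProduct.add_tmul]
        rfl
      | add x y hx hy => simp only [map_add, hx, hy, mul_add, add_mul]; abel
    have h3 := add_mem h1 h2
    rw [e1, e2] at h3
    convert h3 using 1
    conv_lhs => rw [← Q.etaT y]
    rw [hwdef, ← hvdef, map_add, neg_mul, map_neg]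
    abel

end QuatData

variable {Q} {a : FracIdeal k} {lam lam' : k}

lemma represents_twist (q : QuadBasis σ) (b : (FinAdeleOf k)ˣ) :
    Represents (conjIdele σ b * b⁻¹) (conjIdeal σ (ideleIdeal b) * (ideleIdeal b)⁻¹) :=
  ((represents_ideleIdeal b).conj q).mul (represents_ideleIdeal b).inv

lemma exists_isTwist (q : QuadBasis σ) (b : (FinAdeleOf k)ˣ) (ha : a ≠ 0) (lam : k) :
    ∃ lam' : k, IsTwist σ b a lam lam' := by
  have hne : twistIdeal σ b a ≠ 0 := mul_ne_zero (represents_twist q b).ne_zero ha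
  obtain ⟨x, hx⟩ := exists_sub_mem_hat (exists_int_smul_mem_fracIdeal hne)
    ((↑(conjIdele σ b * b⁻¹) : FinAdeleOf k) * (lam ⊗ₜ[ℚ] (1 : FinAdele)))
  refine ⟨x, ?_⟩
  have := neg_mem hx
  rwa [neg_sub] at this

/-- For `c = b̄b⁻¹` this says `c̄ = c⁻¹`, the reason why twisting preserves norms. -/
lemma conjT_twist (q : QuadBasis σ) (b : (FinAdeleOf k)ˣ) :
    conjT σ FinAdele (↑(conjIdele σ b * b⁻¹) : FinAdeleOf k) =
      ↑(conjIdele σ b * b⁻¹)⁻¹ := by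
  have h1 : ∀ c : (FinAdeleOf k)ˣ, conjT σ FinAdele (c : FinAdeleOf k) = ↑(conjIdele σ c) :=
    fun c => rfl
  have h2 : conjIdele σ (conjIdele σ b) = b := by
    ext
    exact conjT_conjT q _
  rw [h1, map_mul, map_inv, h2, _root_.mul_inv, inv_inv, mul_comm]

lemma absNorm_twistIdeal (q : QuadBasis σ) (b : (FinAdeleOf k)ˣ) (a : FracIdeal k) :
    FractionalIdeal.absNorm (twistIdeal σ b a) = FractionalIdeal.absNorm a := by
  have h := (absNorm_pos (represents_ideleIdeal b).ne_zero).ne'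
  rw [twistIdeal, map_mul, map_mul, q.absNorm_conj, map_inv₀, mul_inv_cancel₀ h, one_mul]

/-- Write `λ' = e + w` with `e = cλ`, `c = b̄b⁻¹`, and `w` in the completion of the new ideal `A`.
As `c c̄ = 1`, `e ē = N(λ)`, so `N(λ') - N(λ)` is the trace of `e w̄` plus `w w̄`. Both lie in the
completion of `(N(A))`, the trace because `se` is in that of `A` and traces are integral on the
inverse different. -/
lemma isPreadmissible_twist {q : QuadBasis σ} {κ : ℚ} (h : q.IsPreadmissible κ a lam)
    {b : (FinAdeleOf k)ˣ} (ht : IsTwist σ b a lam lam') :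
    q.IsPreadmissible κ (twistIdeal σ b a) lam' := by
  have hR := represents_twist q b
  have hne : twistIdeal σ b a ≠ 0 := mul_ne_zero hR.ne_zero h.ne_zero
  have hct := conjT_twist q b
  have hN := absNorm_twistIdeal q b a
  have htw : twistIdeal σ b a = conjIdeal σ (ideleIdeal b) * (ideleIdeal b)⁻¹ * a := rfl
  have ht' : lam' ⊗ₜ[ℚ] (1 : FinAdele) -
      (↑(conjIdele σ b * b⁻¹) : FinAdeleOf k) * (lam ⊗ₜ[ℚ] (1 : FinAdele)) ∈
        hatI (twistIdeal σ b a) := ht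
  set c : (FinAdeleOf k)ˣ := conjIdele σ b * b⁻¹
  set A := twistIdeal σ b a
  set w : FinAdeleOf k := lam' ⊗ₜ[ℚ] (1 : FinAdele) - c * (lam ⊗ₜ[ℚ] (1 : FinAdele)) with hw
  have hcl : (q.s ⊗ₜ[ℚ] (1 : FinAdele)) * (c * (lam ⊗ₜ[ℚ] (1 : FinAdele))) ∈ hatI A := by
    have h1 := hatI_mul_mem hR.mem (tmul_one_mem_hatI h.s_mul_mem)
    rw [← htw] at h1
    convert h1 using 1
    rw [mul_left_comm, Algebra.TensorProduct.tmul_mul_tmul, mul_one]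
  have hs1 : q.s ⊗ₜ[ℚ] (1 : FinAdele) ∈ hatI (1 : FracIdeal k) :=
    tmul_one_mem_hatI (mem_one_iff_isIntegral.mpr q.isIntegral_s)
  refine ⟨hne, ?_, ?_⟩
  · apply mem_of_mem_hatI hne
    have h1 := hatI_mul_mem hs1 ht'
    rw [one_mul] at h1
    have h2 := add_mem h1 hcl
    rwa [hw, mul_sub, sub_add_cancel, Algebra.TensorProduct.tmul_mul_tmul, mul_one] at h2
  · obtain ⟨n₀, hn₀⟩ := h.norm_congr
    have hapos := (absNorm_pos hne).ne'
    have hNk : ((FractionalIdeal.absNorm A : ℚ) : k) ≠ 0 := by exact_mod_cast hapos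
    suffices hsuff : ((Algebra.norm ℚ lam' - Algebra.norm ℚ lam : ℚ) : k) ∈
        principal ((FractionalIdeal.absNorm A : ℚ) : k) by
      obtain ⟨j, hj⟩ := (rat_mem_principal_iff hapos).mp hsuff
      refine ⟨j + n₀, ?_⟩
      rw [hN] at hj ⊢
      push_cast
      linear_combination hj + hn₀
    apply mem_of_mem_hatI (principal_ne_zero hNk)
    set e : FinAdeleOf k := c * (lam ⊗ₜ[ℚ] (1 : FinAdele)) with he
    have hmulconj : ∀ x y : FinAdeleOf k, x ∈ hatI A → y ∈ hatI A →
        x * conjT σ FinAdele y ∈ hatI (principal ((FractionalIdeal.absNorm A : ℚ) : k)) := by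
      intro x y hx hy
      rw [← q.mul_conj A]
      exact hatI_mul_mem hx (conjT_mem_hatI hy)
    have hwt : lam' ⊗ₜ[ℚ] (1 : FinAdele) = e + w := by rw [hw]; ring
    have hwt' : (σ lam') ⊗ₜ[ℚ] (1 : FinAdele) = conjT σ FinAdele e + conjT σ FinAdele w := by
      rw [← map_add, ← hwt, conjT_tmul]
    have hee : e * conjT σ FinAdele e = (lam * σ lam) ⊗ₜ[ℚ] (1 : FinAdele) := by
      rw [he, map_mul, hct, conjT_tmul, mul_mul_mul_comm, Units.mul_inv, one_mul,
        Algebra.TensorProduct.tmul_mul_tmul, mul_one]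
    have hexp : ((Algebra.norm ℚ lam' - Algebra.norm ℚ lam : ℚ) : k) ⊗ₜ[ℚ] (1 : FinAdele) =
        (e * conjT σ FinAdele w + conjT σ FinAdele (e * conjT σ FinAdele w)) +
          w * conjT σ FinAdele w := by
      have hm : conjT σ FinAdele (e * conjT σ FinAdele w) = conjT σ FinAdele e * w := by
        rw [map_mul, conjT_conjT q]
      rw [Rat.cast_sub, q.norm_eq, q.norm_eq, TensorProduct.sub_tmul, ← hee, hm]
      have : (lam' * σ lam') ⊗ₜ[ℚ] (1 : FinAdele) =
          (e + w) * (conjT σ FinAdele e + conjT σ FinAdele w) := by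
        rw [← hwt, ← hwt', Algebra.TensorProduct.tmul_mul_tmul, mul_one]
      rw [this]
      ring
    rw [hexp]
    refine add_mem ?_ (hmulconj w w ht' ht')
    -- the trace of an element of the completion of `s⁻¹ N(a)`
    have hy : e * conjT σ FinAdele w ∈
        hatI (principal q.s⁻¹ * principal ((FractionalIdeal.absNorm A : ℚ) : k)) := by
      have h1 := hmulconj _ _ hcl ht'
      have h2 := hatI_mul_mem (tmul_one_mem_hatI (I := principal q.s⁻¹)
        (FractionalIdeal.mem_spanSingleton_self _ _)) h1
      convert h2 using 1
      have hs : q.s⁻¹ ⊗ₜ[ℚ] (1 : FinAdele) * (q.s ⊗ₜ[ℚ] (1 : FinAdele)) = 1 := by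
        rw [Algebra.TensorProduct.tmul_mul_tmul, inv_mul_cancel₀ q.s_ne_zero, mul_one,
          ← Algebra.TensorProduct.one_def]
      linear_combination -(e * conjT σ FinAdele w) * hs
    have h3 := hat_map
      (L' := (principal ((FractionalIdeal.absNorm A : ℚ) : k) : Submodule
        (𝓞 k) k).restrictScalars ℤ)
      (LinearMap.id + σ.toLinearMap) (by
        intro x hx
        change x ∈ principal q.s⁻¹ * principal ((FractionalIdeal.absNorm A : ℚ) : k) at hx
        change x + σ x ∈ principal ((FractionalIdeal.absNorm A : ℚ) : k)
        rw [mem_principal_mul_iff (inv_ne_zero q.s_ne_zero), div_inv_eq_mul,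
          mem_principal_iff hNk] at hx
        obtain ⟨v, hv⟩ := q.trace_of_mul_s (x := x / ((FractionalIdeal.absNorm A : ℚ) : k)) (by
          convert hx using 1; ring)
        rw [mem_principal_iff hNk]
        convert isIntegral_intCast (k := k) v using 1
        rw [← hv, map_div₀, map_ratCast]
        ring) hy
    rw [LinearMap.rTensor_add, LinearMap.add_apply, LinearMap.rTensor_id, LinearMap.id_apply,
      ← conjT_eq_rTensor] at h3
    exact h3

/-- Moving `b` past `δ` conjugates it: `b⁻¹(α + βδ)b = α + (b̄/b)βδ`. So the conditions for `(𝔞, λ)`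
on the conjugate become those for the twisted pair on `α + βδ`. -/
lemma ideleConj_pairOrder (ha : a ≠ 0) {b : (FinAdeleOf k)ˣ} (ht : IsTwist σ b a lam lam') :
    ideleConj Q.i b (Q.pairOrder a lam) = Q.pairOrder (twistIdeal σ b a) lam' := by
  have hR := represents_twist Q.q b
  have htw : twistIdeal σ b a = conjIdeal σ (ideleIdeal b) * (ideleIdeal b)⁻¹ * a := rfl
  have hne : twistIdeal σ b a ≠ 0 := mul_ne_zero hR.ne_zero ha
  have ht' : lam' ⊗ₜ[ℚ] (1 : FinAdele) -
      (↑(conjIdele σ b * b⁻¹) : FinAdeleOf k) * (lam ⊗ₜ[ℚ] (1 : FinAdele)) ∈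
        hatI (twistIdeal σ b a) := ht
  have hc : (↑(conjIdele σ b * b⁻¹) : FinAdeleOf k) =
      ↑b⁻¹ * conjT σ FinAdele (b : FinAdeleOf k) := mul_comm _ _
  ext x
  have hconj : (↑(ideleEmb Q.i b)⁻¹ : B ⊗[ℚ] FinAdele) * (x ⊗ₜ[ℚ] (1 : FinAdele)) *
      (↑(ideleEmb Q.i b) : B ⊗[ℚ] FinAdele) =
      Q.iT FinAdele (Q.fst x ⊗ₜ 1) +
        Q.iT FinAdele ((↑(conjIdele σ b * b⁻¹) : FinAdeleOf k) * (Q.snd x ⊗ₜ 1)) * Q.δT FinAdele :=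
          by
    have e1 : (↑(ideleEmb Q.i b) : B ⊗[ℚ] FinAdele) = Q.iT FinAdele b := rfl
    have e2 : (↑(ideleEmb Q.i b)⁻¹ : B ⊗[ℚ] FinAdele) = Q.iT FinAdele ↑b⁻¹ := rfl
    conv_lhs => rw [← Q.etaT (x ⊗ₜ 1)]
    rw [QuatData.fstT_tmul, QuatData.sndT_tmul, e1, e2, mul_add, add_mul, ← map_mul, ← map_mul,
      ← mul_assoc, ← map_mul, mul_assoc _ (Q.δT FinAdele), Q.δT_comm, ← mul_assoc, ← map_mul, hc]
    congr 2
    · rw [mul_comm, ← mul_assoc, Units.mul_inv, one_mul]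
    · congr 1
      ring
  change (↑(ideleEmb Q.i b)⁻¹ : B ⊗[ℚ] FinAdele) * (x ⊗ₜ[ℚ] (1 : FinAdele)) *
      (↑(ideleEmb Q.i b) : B ⊗[ℚ] FinAdele) ∈ hat (Q.pairOrder a lam) ↔ _
  rw [hconj, Q.mem_hat_pairOrder, Q.fstT_mkT, Q.sndT_mkT, QuatData.mem_pairOrder]
  set c : (FinAdeleOf k)ˣ := conjIdele σ b * b⁻¹
  have hiff : (c : FinAdeleOf k) * (Q.snd x ⊗ₜ 1) ∈ hatI a⁻¹ ↔ Q.snd x ∈ (twistIdeal σ b a)⁻¹ := by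
    constructor
    · intro h
      have := hatI_mul_mem hR.inv_mem h
      rw [Units.inv_mul_cancel_left, ← mul_inv, ← htw] at this
      exact mem_of_mem_hatI (inv_ne_zero hne) this
    · intro h
      have := hatI_mul_mem hR.mem (tmul_one_mem_hatI h)
      rwa [htw, mul_inv _ a, mul_inv_cancel_left₀ hR.ne_zero] at this
  rw [hiff]
  refine and_congr_right fun hx => ?_
  have h1 : (lam' ⊗ₜ[ℚ] (1 : FinAdele) - (c : FinAdeleOf k) * (lam ⊗ₜ[ℚ] (1 : FinAdele))) *
      (Q.snd x ⊗ₜ 1) ∈ hatI (1 : FracIdeal k) := by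
    have := hatI_mul_mem ht' (tmul_one_mem_hatI hx)
    rwa [mul_inv_cancel₀ hne] at this
  have h2 : Q.fst x ⊗ₜ[ℚ] (1 : FinAdele) + lam ⊗ₜ 1 * ((c : FinAdeleOf k) * (Q.snd x ⊗ₜ 1)) =
      (Q.fst x + lam' * Q.snd x) ⊗ₜ[ℚ] (1 : FinAdele) -
        (lam' ⊗ₜ[ℚ] (1 : FinAdele) - (c : FinAdeleOf k) * (lam ⊗ₜ[ℚ] (1 : FinAdele))) *
          (Q.snd x ⊗ₜ 1) := by
    have e : (lam' * Q.snd x) ⊗ₜ[ℚ] (1 : FinAdele) =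
        lam' ⊗ₜ[ℚ] (1 : FinAdele) * (Q.snd x ⊗ₜ[ℚ] (1 : FinAdele)) := by simp
    rw [TensorProduct.add_tmul, e]
    ring
  rw [h2]
  constructor
  · intro h
    have := add_mem h h1
    rw [sub_add_cancel] at this
    exact isIntegral_of_mem_hatI this
  · intro h
    exact sub_mem (tmul_one_mem_hatI (mem_one_iff_isIntegral.mpr h)) h1

lemma twistIdeal_one (q : QuadBasis σ) (a : FracIdeal k) : twistIdeal σ 1 a = a := by
  rw [twistIdeal, ideleIdeal_one, conjIdeal_one q, inv_one, one_mul, one_mul]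

lemma twistIdeal_mul (q : QuadBasis σ) (b c : (FinAdeleOf k)ˣ) (a : FracIdeal k) :
    twistIdeal σ b (twistIdeal σ c a) = twistIdeal σ (b * c) a := by
  rw [twistIdeal, twistIdeal, twistIdeal, ideleIdeal_mul, conjIdeal_mul q, mul_inv]
  ring

lemma IsTwist.one (a : FracIdeal k) (lam : k) : IsTwist σ 1 a lam lam := by
  rw [IsTwist, map_one, inv_one, one_mul, Units.val_one, one_mul, sub_self]
  exact zero_mem _

lemma IsTwist.mul (q : QuadBasis σ) {b c : (FinAdeleOf k)ˣ} {lam'' : k}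
    (hc : IsTwist σ c a lam lam') (hb : IsTwist σ b (twistIdeal σ c a) lam' lam'') :
    IsTwist σ (b * c) a lam lam'' := by
  have h1 := hatI_mul_mem (represents_twist q b).mem hc
  have h2 := add_mem hb h1
  rw [IsTwist, ← twistIdeal_mul q]
  convert h2 using 1
  simp only [map_mul, _root_.mul_inv, Units.val_mul]
  ring

end Conjugation

/-! ### Ideles with prescribed rational components -/

section Glue

lemma exists_prime_of_place (v : HeightOneSpectrum ℤ) :
    ∃ p : ℕ, p.Prime ∧ ∀ m : ℤ, m ∈ v.asIdeal ↔ (p : ℤ) ∣ m := by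
  obtain ⟨π, hπ⟩ := (IsPrincipalIdealRing.principal v.asIdeal).principal
  have hπ' : v.asIdeal = Ideal.span {π} := hπ
  have hπ0 : π ≠ 0 := by
    rintro rfl
    exact v.ne_bot (by rw [hπ']; simp)
  have hprime : Prime π := by
    rw [← Ideal.span_singleton_prime hπ0, ← hπ']
    exact v.isPrime
  refine ⟨π.natAbs, Int.prime_iff_natAbs_prime.mp hprime, fun m => ?_⟩
  rw [hπ', Ideal.mem_span_singleton, Int.natAbs_dvd]

/-- The adele with given rational components. -/
noncomputable def ofRat (f : HeightOneSpectrum ℤ → ℚ) (S : Set (HeightOneSpectrum ℤ)) (hS :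
    S.Finite)
    (hf : ∀ v ∉ S, ∃ n : ℤ, f v = n) : FinAdele :=
  ⟨fun v => algebraMap ℚ (v.adicCompletion ℚ) (f v), by
    refine hS.subset fun v hv => ?_
    by_contra hvS
    apply hv
    obtain ⟨n, hn⟩ := hf v hvS
    exact algebraMap_mem_of_int_mul (m := 1) (c := n)
      (fun h1 => v.isPrime.ne_top ((Ideal.eq_top_iff_one _).mpr h1)) (by simp [hn])⟩

lemma evalAt_ofRat (f : HeightOneSpectrum ℤ → ℚ) (S : Set (HeightOneSpectrum ℤ)) (hS : S.Finite)
    (hf : ∀ v ∉ S, ∃ n : ℤ, f v = n) (v : HeightOneSpectrum ℤ) :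
    evalAt v (ofRat f S hS hf) = algebraMap ℚ _ (f v) := rfl

variable {k : Type*} [Field k] [NumberField k]

/-- The component at a place of an element of `k ⊗ 𝔸`. -/
noncomputable def evalT (v : HeightOneSpectrum ℤ) : FinAdeleOf k →ₐ[ℚ] k ⊗[ℚ] v.adicCompletion ℚ :=
  Algebra.TensorProduct.map (AlgHom.id ℚ k) (evalAt v)

@[simp] lemma evalT_tmul (v : HeightOneSpectrum ℤ) (x : k) (a : FinAdele) :
    evalT v (x ⊗ₜ[ℚ] a) = x ⊗ₜ evalAt v a := by
  simp [evalT]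

lemma coordT_evalT {ι : Type*} (e : Module.Basis ι ℚ k) (j : ι) (v : HeightOneSpectrum ℤ)
    (y : FinAdeleOf k) : coordT _ e j (evalT v y) = evalAt v (coordT _ e j y) := by
  induction y using TensorProduct.induction_on with
  | zero => simp
  | tmul x f => simp
  | add x y hx hy => simp only [map_add, hx, hy]

lemma evalT_ext {y y' : FinAdeleOf k} (h : ∀ v, evalT v y = evalT v y') : y = y' := by
  let e := NumberField.integralBasis k
  rw [← sum_coordT e y, ← sum_coordT e y']
  refine Finset.sum_congr rfl fun j _ => ?_
  congr 1
  refine FiniteAdeleRing.ext ℚ fun v => ?_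
  rw [← evalAt_apply, ← evalAt_apply, ← coordT_evalT, ← coordT_evalT, h v]

lemma evalT_conjT {σ : k ≃ₐ[ℚ] k} (v : HeightOneSpectrum ℤ) (y : FinAdeleOf k) :
    evalT v (conjT σ FinAdele y) = conjT σ _ (evalT v y) := by
  induction y using TensorProduct.induction_on with
  | zero => simp
  | tmul x f => simp
  | add x y hx hy => simp only [map_add, hx, hy]

/-- Expand `y` in a `ℤ`-basis of `I`. At `v` the coordinates are rational, and integral after
multiplication by `m`, which is a unit at `v`. -/
lemma mem_hatI_of_forall {I : FracIdeal k} (hI : I ≠ 0) {y : FinAdeleOf k}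
    (h : ∀ v : HeightOneSpectrum ℤ, ∃ (w : k) (m : ℤ), evalT v y = w ⊗ₜ 1 ∧ m ∉ v.asIdeal ∧
      (m : k) * w ∈ I) : y ∈ hatI I := by
  let e := NumberField.basisOfFractionalIdeal k (Units.mk0 I hI)
  rw [← sum_coordT e y]
  refine Submodule.sum_mem _ fun j _ => ?_
  refine tmul_mem_hat (L := (I : Submodule (𝓞 k) k).restrictScalars ℤ) ?_ fun v => ?_
  · change e j ∈ I
    have := NumberField.mem_span_basisOfFractionalIdeal (K := k) (I := Units.mk0 I hI) (x := e j)
    exact this.mp (Submodule.subset_span ⟨j, rfl⟩)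
  · obtain ⟨w, m, hw, hm, hmw⟩ := h v
    rw [← evalAt_apply, ← coordT_evalT, hw, coordT_tmul]
    have hspan : (m : k) * w ∈ Submodule.span ℤ (Set.range e) :=
      (NumberField.mem_span_basisOfFractionalIdeal (K := k) (I := Units.mk0 I hI)).mpr hmw
    obtain ⟨c, hc⟩ := (e.mem_span_iff_repr_mem ℤ _).mp hspan j
    have h1 : (m : ℚ) * e.repr w j = c := by
      have h2 : (m : k) * w = (m : ℚ) • w := by rw [Algebra.smul_def]; simp
      rw [h2, map_smul, Finsupp.smul_apply, smul_eq_mul] at hc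
      rw [← hc]; simp
    rw [← Algebra.algebraMap_eq_smul_one]
    exact algebraMap_mem_of_int_mul hm h1

/-- An idele with prescribed components in `k`. -/
lemma exists_idele (t : HeightOneSpectrum ℤ → k) (h0 : ∀ v, t v ≠ 0)
    (hfin : {v | t v ≠ 1}.Finite) :
    ∃ b : (FinAdeleOf k)ˣ, ∀ v, evalT v (b : FinAdeleOf k) = t v ⊗ₜ 1 := by
  have key : ∀ t : HeightOneSpectrum ℤ → k, {v | t v ≠ 1}.Finite →
      ∃ y : FinAdeleOf k, ∀ v, evalT v y = t v ⊗ₜ 1 := by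
    intro t hfin
    let e := NumberField.integralBasis k
    -- Where `t v = 1` the coordinates are those of `1` in an integral basis, hence integers, so the
    -- components do form a finite adele.
    have hint : ∀ j, ∀ v ∉ {v | t v ≠ 1}, ∃ n : ℤ, e.repr (t v) j = n := by
      intro j v hv
      have hv1 : t v = 1 := by simpa using hv
      have hrep := NumberField.integralBasis_repr_apply k (1 : 𝓞 k) j
      refine ⟨(NumberField.RingOfIntegers.basis k).repr 1 j, ?_⟩
      rw [hv1]
      simpa using hrep
    refine ⟨∑ j, e j ⊗ₜ ofRat (fun v => e.repr (t v) j) _ hfin (hint j), fun v => ?_⟩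
    rw [map_sum]
    simp only [evalT_tmul, evalAt_ofRat, Algebra.algebraMap_eq_smul_one, TensorProduct.tmul_smul,
      TensorProduct.smul_tmul']
    rw [← TensorProduct.sum_tmul, e.sum_repr]
  obtain ⟨y, hy⟩ := key t hfin
  obtain ⟨y', hy'⟩ := key (fun v => (t v)⁻¹) (hfin.subset fun v hv h1 => hv (by simp [h1]))
  have hmul : y * y' = 1 := by
    refine evalT_ext fun v => ?_
    rw [map_mul, hy, hy', Algebra.TensorProduct.tmul_mul_tmul, mul_inv_cancel₀ (h0 v), mul_one,
      map_one, Algebra.TensorProduct.one_def]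
  exact ⟨⟨y, y', hmul, by rw [mul_comm]; exact hmul⟩, hy⟩

end Glue

/-! ### Membership in a fractional ideal locally at a prime -/

section Local

variable {k : Type*} [Field k] [NumberField k]

/-- Membership in a fractional ideal, locally at `p`. -/
def LocalMem (p : ℕ) (x : k) (I : FracIdeal k) : Prop := ∃ m : ℤ, ¬ (p : ℤ) ∣ m ∧ (m : k) * x ∈ I

variable {p : ℕ} {I J K : FracIdeal k} {x y : k}

lemma LocalMem.of_mem (hp : p.Prime) (h : x ∈ I) : LocalMem p x I :=
  ⟨1, fun h1 => (Nat.prime_iff_prime_int.mp hp).not_isUnit (isUnit_of_dvd_one h1), by simpa using h⟩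

lemma LocalMem.mul (hp : p.Prime) (hx : LocalMem p x I) (hy : LocalMem p y J) :
    LocalMem p (x * y) (I * J) := by
  obtain ⟨m, hm, hmx⟩ := hx
  obtain ⟨n, hn, hny⟩ := hy
  refine ⟨m * n, fun h => ((Nat.prime_iff_prime_int.mp hp).dvd_or_dvd h).elim hm hn, ?_⟩
  have := mem_mul_of_mem hmx hny
  convert this using 1
  push_cast; ring

lemma LocalMem.add (hp : p.Prime) (hx : LocalMem p x I) (hy : LocalMem p y I) :
    LocalMem p (x + y) I := by
  obtain ⟨m, hm, hmx⟩ := hx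
  obtain ⟨n, hn, hny⟩ := hy
  refine ⟨m * n, fun h => ((Nat.prime_iff_prime_int.mp hp).dvd_or_dvd h).elim hm hn, ?_⟩
  have := frac_add_mem (int_mul_mem n hmx) (int_mul_mem m hny)
  convert this using 1
  push_cast; ring

lemma LocalMem.neg (hx : LocalMem p x I) : LocalMem p (-x) I := by
  obtain ⟨m, hm, hmx⟩ := hx
  exact ⟨m, hm, by rw [mul_neg]; exact frac_neg_mem hmx⟩

lemma LocalMem.of_int_mul (hp : p.Prime) {m : ℤ} (hm : ¬ (p : ℤ) ∣ m)
    (h : LocalMem p ((m : k) * x) I) :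
    LocalMem p x I := by
  obtain ⟨n, hn, hnx⟩ := h
  refine ⟨n * m, fun h => ((Nat.prime_iff_prime_int.mp hp).dvd_or_dvd h).elim hn hm, ?_⟩
  convert hnx using 1
  push_cast; ring

lemma LocalMem.principal_mul {h : k} (hh : h ≠ 0) (hx : LocalMem p x (principal h * I)) :
    LocalMem p (x / h) I := by
  obtain ⟨m, hm, hmx⟩ := hx
  refine ⟨m, hm, ?_⟩
  rw [mem_principal_mul_iff hh] at hmx
  rwa [← mul_div_assoc]

end Local

/-! ### Transitivity -/

section Ramified

variable {k : Type*} [Field k] [NumberField k] {σ : k ≃ₐ[ℚ] k} (q : QuadBasis σ)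

namespace QuadBasis

/-- Dividing by `s` is multiplying by `s/disc`, and `s(u + vω) = -(tu + 2nv) + (2u + tv)ω`. So `e`
must divide both coordinates, and `d` is a unit at `p`. -/
lemma localMem_principal_s {p : ℕ} {e d u v : ℤ} (he : e ≠ 0) (hdisc : q.disc = e * d)
    (hd : ¬ (p : ℤ) ∣ d) (h1 : e ∣ q.t * u + 2 * q.n * v) (h2 : e ∣ 2 * u + q.t * v) :
    LocalMem p ((u : k) + v * q.ω) (principal q.s) := by
  obtain ⟨f, hf⟩ := h1
  obtain ⟨g, hg⟩ := h2
  refine ⟨d, hd, ?_⟩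
  rw [mem_principal_iff q.s_ne_zero, q.isIntegral_iff]
  refine ⟨-f, g, ?_⟩
  rw [div_eq_iff q.s_ne_zero]
  have hek : (e : k) ≠ 0 := by exact_mod_cast he
  have hf' : (q.t : k) * u + 2 * q.n * v = e * f := by exact_mod_cast hf
  have hg' : 2 * (u : k) + q.t * v = e * g := by exact_mod_cast hg
  have hd' : ((q.t : k) ^ 2 - 4 * q.n) = e * d := by rw [disc] at hdisc; exact_mod_cast hdisc
  apply mul_left_cancel₀ hek
  simp only [s]
  push_cast
  linear_combination -(u + v * q.ω) * hd' - (2 * q.ω - q.t) * hf' + (2 * q.ω - q.t) * q.ω * hg' -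
    (4 * u + 2 * q.t * v) * q.sq

lemma conj_s_div : σ q.s / q.s = -1 := by
  rw [q.conj_s, neg_div, div_self q.s_ne_zero]

lemma ω_ne_zero : q.ω ≠ 0 := by
  intro h
  have := q.repr_unique_int (u := 0) (v := 1) (u' := 0) (v' := 0) (by simp [h])
  omega

/-- Local comparison of two integers of `k` whose norms are congruent modulo the discriminant. -/
lemma exists_ratio {p : ℕ} (hp : p.Prime) (ht : (p : ℤ) ∣ q.t) (hn : (p : ℤ) ∣ q.n)
    {u v u' v' : ℤ} (h : q.disc ∣ normForm q.t q.n u v - normForm q.t q.n u' v') :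
    ∃ τ : k, τ ≠ 0 ∧ LocalMem p (σ τ / τ) 1 ∧
      LocalMem p (σ τ / τ * (u + v * q.ω) - (u' + v' * q.ω)) (principal q.s) := by
  have hpZ : Prime (p : ℤ) := Nat.prime_iff_prime_int.mp hp
  have hn2 := q.not_sq_dvd_n hp ht
  have hone : (1 : k) ∈ (1 : FracIdeal k) := mem_one_iff_isIntegral.mpr isIntegral_one
  have h_one : ∀ {J : FracIdeal k}, LocalMem p ((u - u' : ℤ) + (v - v' : ℤ) * q.ω) J →
      ∃ τ : k, τ ≠ 0 ∧ LocalMem p (σ τ / τ) 1 ∧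
        LocalMem p (σ τ / τ * (u + v * q.ω) - (u' + v' * q.ω)) J := by
    intro J hJ
    refine ⟨1, one_ne_zero, ?_, ?_⟩
    · rw [map_one, div_one]; exact LocalMem.of_mem hp hone
    · convert hJ using 1
      rw [map_one, div_one]; push_cast; ring
  -- The ratio `-1` is `σ τ/τ` for `τ = s`, while `1` above comes from `τ = 1`.
  have h_neg : ∀ {J : FracIdeal k}, LocalMem p ((u + u' : ℤ) + (v + v' : ℤ) * q.ω) J →
      ∃ τ : k, τ ≠ 0 ∧ LocalMem p (σ τ / τ) 1 ∧
        LocalMem p (σ τ / τ * (u + v * q.ω) - (u' + v' * q.ω)) J := by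
    intro J hJ
    refine ⟨q.s, q.s_ne_zero, ?_, ?_⟩
    · rw [conj_s_div]; exact (LocalMem.of_mem hp hone).neg
    · convert hJ.neg using 1
      rw [conj_s_div]; push_cast; ring
  obtain ⟨c, hc⟩ := h
  rw [disc] at hc
  simp only [normForm, Int.cast_id] at hc
  by_cases hp2 : p = 2
  · subst hp2
    obtain ⟨t', ht'⟩ := ht
    obtain ⟨n', hn'⟩ := hn
    push_cast at ht' hn' hn2
    have hno : Odd n' := by
      rw [← Int.not_even_iff_odd]
      rintro ⟨m, hm⟩
      exact hn2 ⟨m, by rw [hn', hm]; ring⟩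
    rw [ht', hn'] at hc
    have huu : Even (u - u') := by
      have h1 : Even (u ^ 2 - u' ^ 2) := ⟨c * (2 * t' ^ 2 - 4 * n') - t' * (u * v - u' * v') -
        n' * (v ^ 2 - v' ^ 2), by linear_combination hc⟩
      simpa [Int.even_sub, Int.even_pow] using h1
    obtain ⟨x, hx⟩ := huu
    have hu : u = u' + 2 * x := by linear_combination hx
    -- For `p = 2`, the discriminant is `8` times an odd number if `4 ∣ t` and `4` times one
    -- otherwise.
    rcases Int.even_or_odd t' with ⟨t₂, ht₂⟩ | hto
    · have hvv : Even (v - v') := by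
        have h1 : Even (n' * (v ^ 2 - v' ^ 2)) := ⟨c * (4 * t₂ ^ 2 - 2 * n') - (x ^ 2 + x * u') -
          t₂ * (u * v - u' * v'), by
            rw [ht₂, hu] at hc
            rw [hu]
            linarith⟩
        have hno' := Int.not_even_iff_odd.mpr hno
        simp only [Int.even_mul, hno', false_or] at h1
        simpa [Int.even_sub, Int.even_pow] using h1
      obtain ⟨y, hy⟩ := hvv
      have hv : v = v' + 2 * y := by linear_combination hy
      have hxe : Even (x * (x + u')) := by
        refine ⟨c * (2 * t₂ ^ 2 - n') - t₂ * (u' * y + x * v' + 2 * x * y) - n' * (y ^ 2 + y * v'),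
          ?_⟩
        rw [ht₂, hu, hv] at hc
        linarith
      have hdisc : q.disc = 8 * (2 * t₂ ^ 2 - n') := by
        rw [disc, ht', hn', ht₂]; ring
      have hd : ¬ ((2 : ℕ) : ℤ) ∣ 2 * t₂ ^ 2 - n' := by
        obtain ⟨m, hm⟩ := hno
        rw [hm]
        push_cast
        omega
      -- The norm congruence makes `x(x + u')` even: `x` even calls for the ratio `1`, `x + u'` even
      -- for `-1`.
      rcases Int.even_mul.mp hxe with ⟨z, hz⟩ | ⟨z, hz⟩
      · refine h_one (q.localMem_principal_s (e := 8) (by norm_num) hdisc hd ?_ ?_)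
        · exact ⟨2 * t₂ * z + n' * y, by rw [ht', hn', ht₂, hu, hv, hz]; ring⟩
        · exact ⟨z + t₂ * y, by rw [ht', ht₂, hu, hv, hz]; ring⟩
      · have hu' : u + u' = 4 * z := by rw [hu]; linear_combination 2 * hz
        refine h_neg (q.localMem_principal_s (e := 8) (by norm_num) hdisc hd ?_ ?_)
        · exact ⟨2 * t₂ * z + n' * (v' + y), by rw [ht', hn', ht₂, hu', hv]; ring⟩
        · exact ⟨z + t₂ * (v' + y), by rw [ht', ht₂, hu', hv]; ring⟩
    · have hdisc : q.disc = 4 * (t' ^ 2 - 2 * n') := by rw [disc, ht', hn']; ring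
      have hd : ¬ ((2 : ℕ) : ℤ) ∣ t' ^ 2 - 2 * n' := by
        obtain ⟨m, hm⟩ := hto
        rw [hm, show (2 * m + 1) ^ 2 = 2 * (2 * m ^ 2 + 2 * m) + 1 by ring]
        push_cast
        omega
      have hto' := Int.not_even_iff_odd.mpr hto
      have hno' := Int.not_even_iff_odd.mpr hno
      by_cases hvv : Even (v - v')
      · obtain ⟨y, hy⟩ := hvv
        have hv : v = v' + 2 * y := by linear_combination hy
        refine h_one (q.localMem_principal_s (e := 4) (by norm_num) hdisc hd ?_ ?_)
        · exact ⟨t' * x + 2 * n' * y, by rw [ht', hn', hu, hv]; ring⟩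
        · exact ⟨x + t' * y, by rw [ht', hu, hv]; ring⟩
      · have huo : Odd u := by
          have h1 : Even (t' * (u * v - u' * v') + n' * (v ^ 2 - v' ^ 2)) :=
            ⟨c * (t' ^ 2 - 2 * n') - (x ^ 2 + x * u'), by rw [hu] at hc ⊢; linarith⟩
          have huu : Even u ↔ Even u' := by rw [hu]; simp [Int.even_add]
          rw [← Int.not_even_iff_odd]
          simp only [Int.even_add, Int.even_sub, Int.even_mul, Int.even_pow, hto', hno'] at h1 hvv
          tauto
        have hvo : Odd (v + v') := by
          rw [← Int.not_even_iff_odd]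
          simp only [Int.even_add, Int.even_sub] at hvv ⊢
          exact hvv
        obtain ⟨y, hy⟩ := (hno.mul hvo).add_odd (hto.mul huo)
        have hω0 := q.ω_ne_zero
        -- If `v` and `v'` differ in parity, neither sign works. Then `τ = ω` does: `ω̄/ω` is
        -- integral at `2`, because `n' ω̄/ω = (2t'² - n') - t'ω` with `n'` odd.
        have hcω : (n' : k) * (σ q.ω / q.ω) = (2 * t' ^ 2 - n') - t' * q.ω := by
          rw [mul_div_assoc', div_eq_iff hω0, q.conj, ht']
          have hsq := q.sq
          rw [ht', hn'] at hsq
          push_cast at hsq ⊢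
          linear_combination (t' : k) * hsq
        have hn2' : ¬ ((2 : ℕ) : ℤ) ∣ n' := by
          rw [Nat.cast_ofNat, ← even_iff_two_dvd]; exact hno'
        refine ⟨q.ω, hω0, ⟨n', hn2', ?_⟩, LocalMem.of_int_mul hp hn2' (m := n') ?_⟩
        · rw [hcω, mem_one_iff_isIntegral, q.isIntegral_iff]
          exact ⟨2 * t' ^ 2 - n', -t', by push_cast; ring⟩
        · have key : (n' : k) * (σ q.ω / q.ω * (u + v * q.ω) - (u' + v' * q.ω)) =
              ((2 * (t' ^ 2 * u - n' * u' - n' * x + t' * n' * v) : ℤ) : k) +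
                ((-(2 * y) : ℤ) : k) * q.ω := by
            have hsq := q.sq
            rw [ht', hn'] at hsq
            have hy' : (n' : k) * (v + v') + t' * u = 2 * y := by
              have : n' * (v + v') + t' * u = 2 * y := by linear_combination hy
              exact_mod_cast this
            have hu'' : (u : k) = u' + 2 * x := by exact_mod_cast hu
            push_cast at hsq ⊢
            linear_combination (u + v * q.ω) * hcω - (t' : k) * v * hsq - q.ω * hy' - n' * hu''
          rw [key]
          refine q.localMem_principal_s (e := 4) (by norm_num) hdisc hd ?_ ?_
          · exact ⟨t' * (t' ^ 2 * u - n' * u' - n' * x + t' * n' * v) - 2 * n' * y, by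
              rw [ht', hn']; ring⟩
          · exact ⟨(t' ^ 2 * u - n' * u' - n' * x + t' * n' * v) - t' * y, by rw [ht']; ring⟩
  · have hp2' : ¬ (p : ℤ) ∣ 2 := by
      intro hdvd
      exact hp2 ((Nat.prime_dvd_prime_iff_eq hp Nat.prime_two).mp (by exact_mod_cast hdvd))
    obtain ⟨t', ht'⟩ := ht
    obtain ⟨n', hn'⟩ := hn
    have hpn' : ¬ (p : ℤ) ∣ n' := by
      rintro ⟨m, rfl⟩
      exact hn2 ⟨m, by rw [hn']; ring⟩
    have hdisc : q.disc = p * (p * t' ^ 2 - 4 * n') := by rw [disc, ht', hn']; ring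
    have hd : ¬ (p : ℤ) ∣ p * t' ^ 2 - 4 * n' := by
      intro hdvd
      have h1 : (p : ℤ) ∣ 2 * (2 * n') := by
        have h2 := dvd_sub (dvd_mul_right (p : ℤ) (t' ^ 2)) hdvd
        rwa [sub_sub_cancel, show (4 : ℤ) * n' = 2 * (2 * n') by ring] at h2
      exact ((hpZ.dvd_or_dvd h1).resolve_left hp2' |> hpZ.dvd_or_dvd).elim hp2' hpn'
    have hpz : (p : ℤ) ≠ 0 := hpZ.ne_zero
    -- For odd `p` the discriminant has valuation one and the norm is `u²` modulo `p`, so `u ≡ ±u'`,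
    -- which fixes the sign.
    have h1 : (p : ℤ) ∣ (u - u') * (u + u') := by
      rw [ht', hn'] at hc
      exact ⟨(p * t' ^ 2 - 4 * n') * c - t' * (u * v - u' * v') - n' * (v ^ 2 - v' ^ 2), by
        linear_combination hc⟩
    rcases hpZ.dvd_or_dvd h1 with ⟨x, hx⟩ | ⟨x, hx⟩
    · refine h_one (q.localMem_principal_s hpz hdisc hd ?_ ?_)
      · exact ⟨t' * (u - u') + 2 * n' * (v - v'), by rw [ht', hn']; ring⟩
      · exact ⟨2 * x + t' * (v - v'), by rw [ht', hx]; ring⟩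
    · refine h_neg (q.localMem_principal_s hpz hdisc hd ?_ ?_)
      · exact ⟨t' * (u + u') + 2 * n' * (v + v'), by rw [ht', hn']; ring⟩
      · exact ⟨2 * x + t' * (v + v'), by rw [ht', hx]; ring⟩

end QuadBasis

end Ramified

/-! ### Local twists between pairs and their gluing -/

section LocalTwist

variable {k : Type*} [Field k] [NumberField k] {σ : k ≃ₐ[ℚ] k} {q : QuadBasis σ}

lemma QuadBasis.mul_conj_of_absNorm_eq_one (q : QuadBasis σ) {J : FracIdeal k}
    (hJ : FractionalIdeal.absNorm J = 1) : J * conjIdeal σ J = 1 := by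
  rw [q.mul_conj, hJ]
  simp

/-- Hilbert's theorem 90 for local generators of ideals of norm one. -/
lemma exists_local_generator (q : QuadBasis σ) {J : FracIdeal k}
    (hJ : FractionalIdeal.absNorm J = 1) {p : ℕ} (hp : p.Prime) :
    ∃ t : k, t ≠ 0 ∧ LocalMem p (σ t / t) J := by
  have hJ1 := q.mul_conj_of_absNorm_eq_one hJ
  -- With `T = 1 + J̄` and `J J̄ = 1` one gets `JT = 1 + J = T̄`. If `e⁻¹` generates `T` at `p`,
  -- then `J` is generated there by `σ(e⁻¹)/e⁻¹`.
  have hT : (1 : FracIdeal k) + conjIdeal σ J ≠ 0 := by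
    intro h
    have h1 : (1 : FracIdeal k) ≤ 1 + conjIdeal σ J := le_sup_left
    rw [h] at h1
    have := h1 (mem_one_iff_isIntegral.mpr isIntegral_one)
    rw [FractionalIdeal.mem_zero_iff] at this
    exact one_ne_zero this
  obtain ⟨e, he, hle, M, hM, hpM⟩ := q.exists_scaling_int hT hp
  have hσe : σ e ≠ 0 := by simpa using he
  refine ⟨e⁻¹, inv_ne_zero he, M, hpM, ?_⟩
  rw [mem_principal_mul_iff he] at hM
  have h1 : (M : k) / σ e ∈ J * (1 + conjIdeal σ J) := by
    have e1 : (M : k) / σ e = σ (M / e) := by simp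
    rw [e1, mul_add, mul_one, hJ1]
    obtain ⟨y, hy, z, hz, hyz⟩ := (FractionalIdeal.mem_add _ _ _).mp hM
    rw [← hyz, map_add, add_comm (σ y)]
    refine (FractionalIdeal.mem_add _ _ _).mpr ⟨_, q.mem_conjIdeal_iff.mp hz, _, ?_, rfl⟩
    exact mem_one_iff_isIntegral.mpr (isIntegral_conj σ (mem_one_iff_isIntegral.mp hy))
  have h2 : e * (M / σ e) ∈ J * (principal e * (1 + conjIdeal σ J)) := by
    rw [mul_left_comm]
    exact mem_mul_of_mem (FractionalIdeal.mem_spanSingleton_self _ e) h1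
  have h3 := mul_le_mul_right hle J h2
  rw [mul_one] at h3
  convert h3 using 1
  rw [map_inv₀]
  field_simp

variable {κ : ℚ} {a a' : FracIdeal k} {lam lam' : k}

lemma absNorm_div_eq_one (ha : a ≠ 0)
    (hN : FractionalIdeal.absNorm a = FractionalIdeal.absNorm a') :
    FractionalIdeal.absNorm (a' * a⁻¹) = 1 := by
  rw [map_mul, map_inv₀, ← hN, mul_inv_cancel₀ (absNorm_pos ha).ne']

lemma norm_conj_div (q : QuadBasis σ) {t : k} (ht : t ≠ 0) : Algebra.norm ℚ (σ t / t) = 1 := by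
  have h0 : Algebra.norm ℚ t ≠ 0 := by simpa [Algebra.norm_eq_zero_iff] using ht
  apply mul_right_cancel₀ h0
  rw [← map_mul, div_mul_cancel₀ _ ht, q.norm_conj, one_mul]

lemma exists_int_norm_mul {h : k} (hle : principal h * a ≤ 1) :
    ∃ j : ℤ, Algebra.norm ℚ h * FractionalIdeal.absNorm a = j := by
  obtain ⟨J, hJ⟩ := FractionalIdeal.le_one_iff_exists_coeIdeal.mp hle
  have h1 := congrArg FractionalIdeal.absNorm hJ
  rw [FractionalIdeal.coeIdeal_absNorm, map_mul, absNorm_principal] at h1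
  rcases abs_choice (Algebra.norm ℚ h) with hc | hc <;> rw [hc] at h1
  · exact ⟨Ideal.absNorm J, by rw [← h1]; simp⟩
  · exact ⟨-Ideal.absNorm J, by push_cast; rw [h1]; ring⟩

namespace QuadBasis

/-- A Hilbert 90 generator `c = σ t/t` of `𝔞'𝔞⁻¹` matches the ideals at `p`. After scaling by a
suitable `e`, the elements `e c s λ` and `e s λ'` are integers whose norms agree modulo the
discriminant, so `exists_ratio` supplies a second factor matching the classes. -/
lemma exists_local_twist_of_dvd (h : q.IsPreadmissible κ a lam) (h' : q.IsPreadmissible κ a' lam')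
    (hN : FractionalIdeal.absNorm a = FractionalIdeal.absNorm a') {p : ℕ} (hp : p.Prime)
    (ht : (p : ℤ) ∣ q.t) (hn : (p : ℤ) ∣ q.n) :
    ∃ τ : k, τ ≠ 0 ∧ LocalMem p (σ τ / τ) (a' * a⁻¹) ∧
      LocalMem p (σ τ / τ * lam - lam') a' := by
  obtain ⟨t, ht0, htJ⟩ := exists_local_generator q (absNorm_div_eq_one h.ne_zero hN) hp
  set c := σ t / t with hc
  have hc0 : c ≠ 0 := div_ne_zero (by simpa using ht0) ht0
  have hca : ∀ x, LocalMem p x a → LocalMem p (c * x) a' := by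
    intro x hx
    have := htJ.mul hp hx
    rwa [inv_mul_cancel_right₀ h.ne_zero] at this
  -- The ideals `c𝔞` and `𝔞'` need only agree at `p`; normalizing their sum makes both integral with
  -- a single `e`, and `M/e` still lies in `𝔞'` locally.
  have hI : principal c * a + a' ≠ 0 := by
    intro h0
    have h1 : a' ≤ principal c * a + a' := le_sup_right
    rw [h0] at h1
    exact h'.ne_zero (FractionalIdeal.le_zero_iff.mp h1)
  obtain ⟨e, he, hle, M, hM, hpM⟩ := q.exists_scaling_int hI hp
  have hMe : LocalMem p ((M : k) / e) a' := by
    rw [mem_principal_mul_iff he] at hM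
    obtain ⟨y, hy, z, hz, hyz⟩ := (FractionalIdeal.mem_add _ _ _).mp hM
    rw [← hyz]
    rw [mem_principal_mul_iff hc0] at hy
    have := hca _ (LocalMem.of_mem hp hy)
    rw [mul_div_cancel₀ _ hc0] at this
    exact this.add hp (LocalMem.of_mem hp hz)
  have hint : ∀ x ∈ principal c * a + a', IsIntegral ℤ (e * x) := fun x hx =>
    mem_one_iff_isIntegral.mp
      (hle (mem_mul_of_mem (FractionalIdeal.mem_spanSingleton_self _ e) hx))
  have hz1 := hint (c * (q.s * lam)) ((le_sup_left : principal c * a ≤ principal c * a + a')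
    (mem_mul_of_mem (FractionalIdeal.mem_spanSingleton_self _ c) h.s_mul_mem))
  have hz2 := hint (q.s * lam') ((le_sup_right : a' ≤ principal c * a + a') h'.s_mul_mem)
  obtain ⟨u, v, huv⟩ := (q.isIntegral_iff _).mp hz1
  obtain ⟨u', v', huv'⟩ := (q.isIntegral_iff _).mp hz2
  have hdvd : q.disc ∣ normForm q.t q.n u v - normForm q.t q.n u' v' := by
    obtain ⟨j, hj⟩ := exists_int_norm_mul
      ((mul_le_mul_right (le_sup_right : a' ≤ principal c * a + a') (principal e)).trans hle)
    obtain ⟨m, hm⟩ := h.norm_congr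
    obtain ⟨m', hm'⟩ := h'.norm_congr
    rw [hN] at hm
    refine ⟨-(j * (m - m')), ?_⟩
    have e1 := q.norm_repr_int u v
    have e2 := q.norm_repr_int u' v'
    rw [← huv, map_mul, map_mul, map_mul, q.norm_s, norm_conj_div q ht0] at e1
    rw [← huv', map_mul, map_mul, q.norm_s] at e2
    have : ((normForm q.t q.n u v - normForm q.t q.n u' v' : ℤ) : ℚ) =
        ((q.disc * -(j * (m - m')) : ℤ) : ℚ) := by
      push_cast
      rw [← hj]
      linear_combination -e1 + e2 - q.disc * Algebra.norm ℚ e * (hm - hm')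
    exact_mod_cast this
  obtain ⟨τ, hτ0, hτ1, hτ⟩ := q.exists_ratio hp ht hn hdvd
  rw [← huv, ← huv'] at hτ
  have hcc : σ (t * τ) / (t * τ) = c * (σ τ / τ) := by
    rw [map_mul, hc, mul_div_mul_comm]
  refine ⟨t * τ, mul_ne_zero ht0 hτ0, ?_, ?_⟩
  · rw [hcc]
    have := htJ.mul hp hτ1
    rwa [mul_one] at this
  · rw [hcc]
    rw [← mul_one (principal q.s)] at hτ
    have h1 := (hτ.principal_mul q.s_ne_zero).mul hp hMe
    rw [one_mul] at h1
    refine LocalMem.of_int_mul hp hpM (m := M) ?_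
    convert h1 using 1
    have := q.s_ne_zero
    field_simp

/-- At an unramified prime `s` is a unit, so `λ` and `λ'` lie locally in `𝔞` and `𝔞'`, and any
generator from Hilbert 90 works. -/
theorem exists_local_twist (h : q.IsPreadmissible κ a lam) (h' : q.IsPreadmissible κ a' lam')
    (hN : FractionalIdeal.absNorm a = FractionalIdeal.absNorm a') {p : ℕ} (hp : p.Prime) :
    ∃ τ : k, τ ≠ 0 ∧ LocalMem p (σ τ / τ) (a' * a⁻¹) ∧
      LocalMem p (σ τ / τ * lam - lam') a' := by
  by_cases hd : (p : ℤ) ∣ q.disc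
  · obtain ⟨c, ht, hn⟩ := q.exists_eisenstein_shift hp hd
    exact exists_local_twist_of_dvd ((IsPreadmissible.shift c).mpr h)
      ((IsPreadmissible.shift c).mpr h') hN hp ht hn
  · obtain ⟨t, ht0, htJ⟩ := exists_local_generator q (absNorm_div_eq_one h.ne_zero hN) hp
    refine ⟨t, ht0, htJ, LocalMem.of_int_mul hp hd ?_⟩
    have h1 := htJ.mul hp (LocalMem.of_mem hp h.s_mul_mem)
    rw [inv_mul_cancel_right₀ h.ne_zero] at h1
    have h2 := (LocalMem.of_mem hp (mem_one_iff_isIntegral.mpr q.isIntegral_s)).mul hp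
      (h1.add hp (LocalMem.of_mem hp h'.s_mul_mem).neg)
    rw [one_mul] at h2
    convert h2 using 1
    rw [← q.s_sq]
    ring

end QuadBasis

lemma finite_places_dvd {N : ℤ} (hN : N ≠ 0) :
    {v : HeightOneSpectrum ℤ | N ∈ v.asIdeal}.Finite := by
  have := Ideal.finite_factors (I := Ideal.span {N}) (by simpa using hN)
  simpa [Ideal.dvd_span_singleton] using this

/-- Two admissible pairs with ideals of the same norm differ by an idele. -/
theorem exists_twist_eq (h : q.IsPreadmissible κ a lam) (h' : q.IsPreadmissible κ a' lam')
    (hN : FractionalIdeal.absNorm a = FractionalIdeal.absNorm a') :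
    ∃ b : (FinAdeleOf k)ˣ, twistIdeal σ b a = a' ∧ IsTwist σ b a lam lam' := by
  classical
  have hJ := q.mul_conj_of_absNorm_eq_one (absNorm_div_eq_one h.ne_zero hN)
  have hJ0 : a' * a⁻¹ ≠ 0 := mul_ne_zero h'.ne_zero (inv_ne_zero h.ne_zero)
  have hJinv : (a' * a⁻¹)⁻¹ = conjIdeal σ (a' * a⁻¹) := inv_eq_of_mul_eq_one_right hJ
  obtain ⟨m₁, hm₁, hm₁J⟩ := exists_int_mul_mem hJ0 (1 : k)
  obtain ⟨m₂, hm₂, hm₂a⟩ := exists_int_mul_mem h'.ne_zero (lam - lam')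
  -- Outside the finitely many places containing `m₁m₂`, one has `1 ∈ 𝔞'𝔞⁻¹` and `λ - λ' ∈ 𝔞'`
  -- locally, so `τ = 1` is allowed. This is what makes the components an idele.
  have key : ∀ v : HeightOneSpectrum ℤ, ∃ τ : k, τ ≠ 0 ∧ (m₁ * m₂ ∉ v.asIdeal → τ = 1) ∧
      (∃ m : ℤ, m ∉ v.asIdeal ∧ (m : k) * (σ τ / τ) ∈ a' * a⁻¹) ∧
      (∃ m : ℤ, m ∉ v.asIdeal ∧ (m : k) * (σ τ / τ * lam - lam') ∈ a') := by
    intro v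
    by_cases hv : m₁ * m₂ ∈ v.asIdeal
    · obtain ⟨p, hp, hpv⟩ := exists_prime_of_place v
      obtain ⟨τ, hτ0, hτ1, hτ2⟩ := QuadBasis.exists_local_twist h h' hN hp
      simp only [LocalMem, ← hpv] at hτ1 hτ2
      exact ⟨τ, hτ0, fun hn => absurd hv hn, hτ1, hτ2⟩
    · refine ⟨1, one_ne_zero, fun _ => rfl, ⟨m₁, fun h1 => hv (v.asIdeal.mul_mem_right _ h1), ?_⟩,
        ⟨m₂, fun h1 => hv (v.asIdeal.mul_mem_left _ h1), ?_⟩⟩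
      · simpa using hm₁J
      · simpa using hm₂a
  choose τ hτ0 hτ1 hτJ hτa using key
  obtain ⟨b, hb⟩ := exists_idele τ hτ0 ((finite_places_dvd (mul_ne_zero hm₁ hm₂)).subset
    fun v hv => by by_contra hn; exact hv (hτ1 v hn))
  have hbinv : ∀ v, evalT v (↑b⁻¹ : FinAdeleOf k) = (τ v)⁻¹ ⊗ₜ 1 := by
    intro v
    have h1 : evalT v (↑b⁻¹ : FinAdeleOf k) * evalT v (b : FinAdeleOf k) = 1 := by
      rw [← map_mul, Units.inv_mul, map_one]
    calc evalT v (↑b⁻¹ : FinAdeleOf k)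
        = evalT v (↑b⁻¹ : FinAdeleOf k) * (τ v ⊗ₜ 1 * (τ v)⁻¹ ⊗ₜ 1) := by
          rw [Algebra.TensorProduct.tmul_mul_tmul, mul_inv_cancel₀ (hτ0 v), mul_one,
            ← Algebra.TensorProduct.one_def, mul_one]
      _ = _ := by rw [← mul_assoc, ← hb, h1, one_mul]
  have hc : ∀ v, evalT v (↑(conjIdele σ b * b⁻¹) : FinAdeleOf k) = (σ (τ v) / τ v) ⊗ₜ 1 := by
    intro v
    have h1 : (↑(conjIdele σ b) : FinAdeleOf k) = conjT σ FinAdele (b : FinAdeleOf k) := rfl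
    rw [Units.val_mul, map_mul, h1, evalT_conjT, hb, hbinv, conjT_tmul,
      Algebra.TensorProduct.tmul_mul_tmul, mul_one, div_eq_mul_inv]
  -- The inverse needs no separate check: both `c = b̄b⁻¹` and `𝔞'𝔞⁻¹` are inverted by conjugation.
  have hrep : Represents (conjIdele σ b * b⁻¹) (a' * a⁻¹) := by
    have hmem : (↑(conjIdele σ b * b⁻¹) : FinAdeleOf k) ∈ hatI (a' * a⁻¹) := by
      refine mem_hatI_of_forall hJ0 fun v => ?_
      obtain ⟨m, hm, hmJ⟩ := hτJ v
      exact ⟨_, m, hc v, hm, hmJ⟩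
    refine ⟨hJ0, hmem, ?_⟩
    rw [← conjT_twist q, hJinv]
    exact conjT_mem_hatI hmem
  have hJeq : conjIdeal σ (ideleIdeal b) * (ideleIdeal b)⁻¹ = a' * a⁻¹ := by
    rw [← (represents_twist q b).ideleIdeal_eq, hrep.ideleIdeal_eq]
  have htw : twistIdeal σ b a = a' := by
    rw [twistIdeal, hJeq, inv_mul_cancel_right₀ h.ne_zero]
  refine ⟨b, htw, ?_⟩
  rw [IsTwist, htw]
  refine mem_hatI_of_forall h'.ne_zero fun v => ?_
  obtain ⟨m, hm, hma⟩ := hτa v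
  refine ⟨lam' - σ (τ v) / τ v * lam, m, ?_, hm, ?_⟩
  · rw [map_sub, map_mul, hc, evalT_tmul, evalT_tmul, map_one, TensorProduct.sub_tmul,
      Algebra.TensorProduct.tmul_mul_tmul, mul_one]
  · convert frac_neg_mem hma using 1
    ring

end LocalTwist

end QuatOrder

/-! ### Assembly of the theorem -/

theorem proposition6p1
    {k : Type*} [Field k] [NumberField k]
    (hk : Module.finrank ℚ k = 2) (hk' : NumberField.discr k < 0)
    (σ : k ≃ₐ[ℚ] k) (hσ : σ ≠ AlgEquiv.refl)
    {B : Type*} [Ring B] [Algebra ℚ B] [Algebra.IsCentral ℚ B] [IsSimpleRing B]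
    (hB : Module.finrank ℚ B = 4)
    (i : k →ₐ[ℚ] B) (δ : B) (κ : ℚ) (hκ : κ ≠ 0)
    (hδ : δ ^ 2 = algebraMap ℚ B κ) (hδσ : ∀ x : k, δ * i x = i (σ x) * δ)
    (d₁ d₂ : Ideal (𝓞 k)) (hd : d₁ * d₂ = differentIdeal ℤ (𝓞 k))
    (hd₁ : Ideal.absNorm d₁ = commonRamProd B k) :
    -- the conditions and the order depend only on the class of `lam` modulo `a`
    (∀ (a : FractionalIdeal (𝓞 k)⁰ k) (lam lam' : k), IsAdmissible B κ d₂ a lam →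
      lam' - lam ∈ a →
      IsAdmissible B κ d₂ a lam' ∧
        classicalOrder i δ d₂ a lam' = classicalOrder i δ d₂ a lam) ∧
    -- (i)
    (∀ (a : FractionalIdeal (𝓞 k)⁰ k) (lam : k), IsAdmissible B κ d₂ a lam →
      classicalOrder i δ d₂ a lam ∈ MaxOrders i) ∧
    -- (ii)
    (∀ L ∈ MaxOrders i, ∃ (a : FractionalIdeal (𝓞 k)⁰ k) (lam : k),
      IsAdmissible B κ d₂ a lam ∧ L = classicalOrder i δ d₂ a lam) ∧
    -- (iii), the action by conjugation and its transitivity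
    (∃ act : MulAction (FinAdeleOf k)ˣ (MaxOrders i),
      (∀ (b : (FinAdeleOf k)ˣ) (L : MaxOrders i),
        ((act.smul b L : MaxOrders i) : Submodule ℤ B) = ideleConj i b L) ∧
      ∀ L L' : MaxOrders i, ∃ b : (FinAdeleOf k)ˣ, act.smul b L = L') ∧
    -- (iii), the explicit form of the action
    (∀ (a : FractionalIdeal (𝓞 k)⁰ k) (lam : k), IsAdmissible B κ d₂ a lam →
      ∀ b : (FinAdeleOf k)ˣ,
        (∃ lam' : k, IsTwist σ b a lam lam') ∧
        ∀ lam' : k, IsTwist σ b a lam lam' →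
          IsAdmissible B κ d₂ (twistIdeal σ b a) lam' ∧
          ideleConj i b (classicalOrder i δ d₂ a lam) =
            classicalOrder i δ d₂ (twistIdeal σ b a) lam') ∧
    -- (iv)
    (∀ β₀ : k, β₀ ≠ 0 →
      ((i β₀ * δ) ^ 2 = algebraMap ℚ B (Algebra.norm ℚ β₀ * κ) ∧
        ∀ x : k, (i β₀ * δ) * i x = i (σ x) * (i β₀ * δ)) ∧
      ∀ (a : FractionalIdeal (𝓞 k)⁰ k) (lam : k), IsAdmissible B κ d₂ a lam →
        IsAdmissible B (Algebra.norm ℚ β₀ * κ) d₂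
          (FractionalIdeal.spanSingleton (𝓞 k)⁰ β₀ * a) (β₀ * lam) ∧
        classicalOrder i δ d₂ a lam =
          classicalOrder i (i β₀ * δ) d₂
            (FractionalIdeal.spanSingleton (𝓞 k)⁰ β₀ * a) (β₀ * lam)) := by
  obtain ⟨q⟩ := exists_quadBasis hk hσ
  let Q : QuatData σ B := ⟨q, i, δ, κ, hκ, hδ, hδσ, hB⟩
  have hd' : d₁ * d₂ = Ideal.span {Q.q.sInt} := by rw [hd, q.differentIdeal_eq]
  have hiff : ∀ {a : FracIdeal k} {lam : k}, IsAdmissible B κ d₂ a lam ↔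
      Q.IsPreadmissible a lam ∧ Q.q.index κ a = ramProd B := isAdmissible_iff (Q := Q) hd' hd₁
  have hord : ∀ {a : FracIdeal k} {lam : k}, IsAdmissible B κ d₂ a lam →
      classicalOrder i δ d₂ a lam = Q.pairOrder a lam :=
    classicalOrder_eq_of_isAdmissible (Q := Q) hd'
  have hmax : ∀ {L : Submodule ℤ B}, L ∈ MaxOrders i ↔ ∃ (a : FracIdeal k) (lam : k),
      IsAdmissible B κ d₂ a lam ∧ L = Q.pairOrder a lam := by
    intro L
    simp only [hiff]
    exact mem_maxOrders_iff (Q := Q)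
  have htwist : ∀ {a : FracIdeal k} {lam lam' : k} {b : (FinAdeleOf k)ˣ},
      IsAdmissible B κ d₂ a lam → IsTwist σ b a lam lam' →
        IsAdmissible B κ d₂ (twistIdeal σ b a) lam' ∧
          ideleConj i b (Q.pairOrder a lam) = Q.pairOrder (twistIdeal σ b a) lam' := by
    intro a lam lam' b h ht
    obtain ⟨h1, h2⟩ := hiff.mp h
    refine ⟨hiff.mpr ⟨isPreadmissible_twist h1 ht, ?_⟩,
      ideleConj_pairOrder (Q := Q) h1.ne_zero ht⟩
    rw [← h2, QuadBasis.index, QuadBasis.index, absNorm_twistIdeal q]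
  refine ⟨?_, ?_, ?_, ?_, ?_, ?_⟩
  · intro a lam lam' h hl
    obtain ⟨h1, h2⟩ := hiff.mp h
    have h' : IsAdmissible B κ d₂ a lam' := hiff.mpr ⟨h1.congr hl, h2⟩
    exact ⟨h', by rw [hord h, hord h', pairOrder_congr h1 hl]⟩
  · intro a lam h
    rw [hord h]
    exact hmax.mpr ⟨a, lam, h, rfl⟩
  · intro L hL
    obtain ⟨a, lam, h, rfl⟩ := hmax.mp hL
    exact ⟨a, lam, h, (hord h).symm⟩
  -- Stability and the action laws are read off from pairs: every maximal order in question comes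
  -- from one, and twists compose.
  · have hmem : ∀ (b : (FinAdeleOf k)ˣ) (L : Submodule ℤ B), L ∈ MaxOrders i →
        ideleConj i b L ∈ MaxOrders i := by
      intro b L hL
      obtain ⟨a, lam, h, rfl⟩ := hmax.mp hL
      obtain ⟨lam', ht⟩ := exists_isTwist q b (hiff.mp h).1.ne_zero lam
      obtain ⟨h1, h2⟩ := htwist h ht
      exact hmax.mpr ⟨_, _, h1, h2⟩
    refine ⟨{ smul := fun b L => ⟨ideleConj i b L, hmem b L L.2⟩
              one_smul := ?one
              mul_smul := ?mul }, fun b L => rfl, ?trans⟩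
    case one =>
      intro L
      obtain ⟨a, lam, h, hL⟩ := hmax.mp L.2
      apply Subtype.ext
      change ideleConj i 1 (L : Submodule ℤ B) = L
      rw [hL, (htwist h (IsTwist.one a lam)).2, twistIdeal_one q]
    case mul =>
      intro b c L
      obtain ⟨a, lam, h, hL⟩ := hmax.mp L.2
      apply Subtype.ext
      change ideleConj i (b * c) (L : Submodule ℤ B) = ideleConj i b (ideleConj i c L)
      obtain ⟨lam', hc⟩ := exists_isTwist q c (hiff.mp h).1.ne_zero lam
      obtain ⟨h1, h2⟩ := htwist h hc
      obtain ⟨lam'', hb⟩ := exists_isTwist q b (hiff.mp h1).1.ne_zero lam'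
      rw [hL, h2, (htwist h1 hb).2, (htwist h (hc.mul q hb)).2, twistIdeal_mul q]
    case trans =>
      intro L L'
      obtain ⟨a, lam, h, hL⟩ := hmax.mp L.2
      obtain ⟨a', lam', h', hL'⟩ := hmax.mp L'.2
      obtain ⟨h1, h2⟩ := hiff.mp h
      obtain ⟨h1', h2'⟩ := hiff.mp h'
      -- Admissibility prescribes the norm of the ideal, so any two admissible pairs have ideals of
      -- equal norm.
      have hN : FractionalIdeal.absNorm a = FractionalIdeal.absNorm a' := by
        rw [h.norm_ideal, h'.norm_ideal]
      obtain ⟨b, hb, ht⟩ := exists_twist_eq h1 h1' hN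
      refine ⟨b, Subtype.ext ?_⟩
      change ideleConj i b (L : Submodule ℤ B) = L'
      rw [hL, hL', (htwist h ht).2, hb]
  · intro a lam h b
    refine ⟨exists_isTwist q b (hiff.mp h).1.ne_zero lam, fun lam' ht => ?_⟩
    obtain ⟨h1, h2⟩ := htwist h ht
    exact ⟨h1, by rw [hord h, hord h1, h2]⟩
  · intro β₀ hβ
    refine ⟨⟨(Q.scale β₀ hβ).δ_sq, (Q.scale β₀ hβ).δ_comm⟩, fun a lam h => ?_⟩
    obtain ⟨h1, h2⟩ := hiff.mp h
    have h' : IsAdmissible B (Algebra.norm ℚ β₀ * κ) d₂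
        (FractionalIdeal.spanSingleton (𝓞 k)⁰ β₀ * a) (β₀ * lam) :=
      (isAdmissible_iff (Q := Q.scale β₀ hβ) hd' hd₁).mpr
        ⟨h1.scale hβ, by rw [← h2]; exact q.index_scale κ a hβ⟩
    refine ⟨h', ?_⟩
    rw [hord h, ← Q.scale_pairOrder β₀ hβ]
    exact (classicalOrder_eq_of_isAdmissible (Q := Q.scale β₀ hβ) hd' h').symm
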